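/- Let $\mathcal M=(m_k)_{k\ge 0}$ be a sequence of positive real numbers that is a regular weight sequence, i.e. $m_0=m_1=1$, $\sup_{k\ge 1}(m_{k+1}/m_k)^{1/k}<\infty$, $m_k^2\le m_{k-1}m_{k+1}$ for all $k\ge 1$, and $m_k^{1/k}\to\infty$. Suppose that $\mathcal M$ is quasianalytic, i.e. $\sum_{k\ge 1}\frac{m_{k-1}}{k\,m_k}=\infty$. A smooth map $f$ on an open set $U$ is of class $\{\mathcal M\}$ if for every compact $K\subseteq U$ there are $C,h>0$ with $|\partial^\alpha f(x)|\le C h^{|\alpha|}m_{|\alpha|}|\alpha|!$ for all $x\in K$ and all multi-indices $\alpha$. Submanifolds are embedded; a submanifold of $\mathbb C^N$ of dimension $d$ is of class $\{\mathcal M\}$ if it is locally the zero set of a map of class $\{\mathcal M\}$ into $\mathbb R^{2N-d}$ with surjective differential. Let $M\subseteq\mathbb C^N$ be a CR submanifold of class $\{\mathcal M\}$, that is, a real submanifold of class $\{\mathcal M\}$ such that the complex dimension of $T^c_pM=T_pM\cap iT_pM$ does not depend on $p\in M$, and let $p_0\in M$. Denote by $\mathcal E_{\mathcal M}(M,T^cM)$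 the space of sections of class $\{\mathcal M\}$ of $T^cM$. The CR orbit $\mathrm{Orb}_{p_0}$ is the germ at $p_0$ of a submanifold $W\subseteq M$ of class $\{\mathcal M\}$ through $p_0$ with the following properties: every $X\in\mathcal E_{\mathcal M}(M,T^cM)$ is tangent to $W$ at all points of $W$; if $W'\subseteq M$ is another submanifold of class $\{\mathcal M\}$ through $p_0$ with this property, then $W\cap V\subseteq W'\cap V$ for some neighbourhood $V$ of $p_0$; and for every open neighbourhood $U$ of $p_0$ there are $J\in\mathbb N$ and open neighbourhoods $V_1\subseteq V_2\subseteq U$ of $p_0$ such that every $p\in W\cap V_1$ can be reached from $p_0$ by a polygonal path of $J$ integral curves of vector fields in $\mathcal E_{\mathcal M}(M,T^cM)$ contained in $W\cap V_2$. Then the following statements are equivalent: 1. $M$ is minimal at $p_0$: there is no smooth submanifold $S\subseteq M$ through $p_0$ such that $\dim_{\mathbb R}S<\dim_{\mathbb R}M$ and $T^c_pM\subseteq T_pS$ for all $p\in S$. 1'. $M$ is minimal at $p_0$ within the class $\{\mathcal M\}$: there is no submanifold $S\subseteq M$ of class $\{\mathcal M\}$ through $p_0$ such that $\dim_{\mathbb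 R}S<\dim_{\mathbb R}M$ and $T^c_pM\subseteq T_pS$ for all $p\in S$. 2. $\dim_{\mathbb R}\mathrm{Orb}_{p_0}=\dim_{\mathbb R}M$. 3. $M$ is of finite type at $p_0$: there are finitely many $X_1,\dots,X_k\in\mathcal E_{\mathcal M}(M,T^cM)$ such that the values at $p_0$ of the elements of the real Lie algebra generated by $X_1,\dots,X_k$ make up all of $T_{p_0}M$. -/

import Mathlib

open Set Filter Topology
open scoped ContDiff Nat

/-- A regular weight sequence `(m_k)` of positive real numbers. -/
structure IsRegularWeightSequence (m : ℕ → ℝ) : Prop where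
  pos : ∀ k, 0 < m k
  zero_eq_one : m 0 = 1
  one_eq_one : m 1 = 1
  derivation_closed : BddAbove (Set.range fun k : ℕ => (m (k + 1) / m k) ^ ((k : ℝ)⁻¹))
  log_convex : ∀ k : ℕ, m (k + 1) ^ 2 ≤ m k * m (k + 2)
  tendsto_root : Tendsto (fun k : ℕ => m k ^ ((k : ℝ)⁻¹)) atTop atTop

/-- Quasianalyticity of a weight sequence: `∑_{k ≥ 1} m_{k-1} / (k m_k) = ∞`
(for positive terms, divergence is the failure of summability). -/
def IsQuasianalyticSequence (m : ℕ → ℝ) : Prop :=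
  ¬ Summable fun k : ℕ => m k / (((k : ℝ) + 1) * m (k + 1))

/-- `f` is ultradifferentiable of class `{m}` on the open set `U`: it is smooth on `U` and on every
compact subset its derivatives of order `k` are bounded by `C h ^ k m_k k!`. Bounding the norm of the
`k`-th total derivative is the same as bounding all partial derivatives of order `k`, up to
replacing `h` by a multiple that depends only on the dimension. -/
def IsUltradifferentiableOn {E F : Type*} [NormedAddCommGroup E] [NormedSpace ℝ E]
    [NormedAddCommGroup F] [NormedSpace ℝ F] (m : ℕ → ℝ) (f : E → F) (U : Set E) : Prop :=
  ContDiffOn ℝ ∞ f U ∧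
    ∀ K : Set E, K ⊆ U → IsCompact K → ∃ C h : ℝ, 0 < C ∧ 0 < h ∧
      ∀ x ∈ K, ∀ k : ℕ, ‖iteratedFDeriv ℝ k f x‖ ≤ C * h ^ k * m k * (k ! : ℝ)

/-- `S` is an (embedded) real submanifold of `ℂ^N`, of real dimension `d` and of class `{m}`:
locally it is the zero set of a map of class `{m}` into `ℝ^(2N-d)` whose differential is onto. -/
def IsUltradifferentiableSubmanifold {N : ℕ} (m : ℕ → ℝ)
    (S : Set (EuclideanSpace ℂ (Fin N))) (d : ℕ) : Prop :=
  ∀ p ∈ S, ∃ (c : ℕ) (U : Set (EuclideanSpace ℂ (Fin N)))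
    (ρ : EuclideanSpace ℂ (Fin N) → EuclideanSpace ℝ (Fin c)),
    d + c = 2 * N ∧ IsOpen U ∧ p ∈ U ∧ IsUltradifferentiableOn m ρ U ∧
    (∀ x ∈ U, Function.Surjective (fderiv ℝ ρ x)) ∧ S ∩ U = {x ∈ U | ρ x = 0}

/-- `S` is an (embedded) smooth real submanifold of `ℂ^N` of real dimension `d`. -/
def IsSmoothSubmanifold {N : ℕ} (S : Set (EuclideanSpace ℂ (Fin N))) (d : ℕ) : Prop :=
  ∀ p ∈ S, ∃ (c : ℕ) (U : Set (EuclideanSpace ℂ (Fin N)))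
    (ρ : EuclideanSpace ℂ (Fin N) → EuclideanSpace ℝ (Fin c)),
    d + c = 2 * N ∧ IsOpen U ∧ p ∈ U ∧ ContDiffOn ℝ ∞ ρ U ∧
    (∀ x ∈ U, Function.Surjective (fderiv ℝ ρ x)) ∧ S ∩ U = {x ∈ U | ρ x = 0}

/-- The real tangent space `T_p S ⊆ ℂ^N`: velocities at `p` of curves in `S` through `p`. For a
submanifold these velocities already form a real subspace, so that taking the span adds nothing. -/
noncomputable def realTangentSpace {N : ℕ} (S : Set (EuclideanSpace ℂ (Fin N)))
    (p : EuclideanSpace ℂ (Fin N)) : Submodule ℝ (EuclideanSpace ℂ (Fin N)) :=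
  Submodule.span ℝ {v | ∃ γ : ℝ → EuclideanSpace ℂ (Fin N),
    γ 0 = p ∧ (∀ᶠ t in 𝓝 (0 : ℝ), γ t ∈ S) ∧ HasDerivAt γ v 0}

/-- The complex tangent space `T^c_p S`: the largest complex subspace of `ℂ^N` contained in
`T_p S`, that is `T_p S ∩ i T_p S`. -/
noncomputable def complexTangentSpace {N : ℕ} (S : Set (EuclideanSpace ℂ (Fin N)))
    (p : EuclideanSpace ℂ (Fin N)) : Submodule ℂ (EuclideanSpace ℂ (Fin N)) where
  carrier := {v | v ∈ realTangentSpace S p ∧ Complex.I • v ∈ realTangentSpace S p}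
  zero_mem' := by
    simp
  add_mem' := by
    rintro a b ⟨ha, ha'⟩ ⟨hb, hb'⟩
    refine ⟨add_mem ha hb, ?_⟩
    rw [smul_add]
    exact add_mem ha' hb'
  smul_mem' := by
    rintro c v ⟨hv, hv'⟩
    have key : ∀ (z : ℂ), z • v ∈ realTangentSpace S p := by
      intro z
      have hz : z • v = z.re • v + z.im • (Complex.I • v) := by
        ext i
        simp only [PiLp.smul_apply, PiLp.add_apply, smul_eq_mul, Complex.real_smul]
        conv_lhs => rw [← Complex.re_add_im z]
        ring
      rw [hz]
      exact add_mem (Submodule.smul_mem _ _ hv) (Submodule.smul_mem _ _ hv')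
    refine ⟨key c, ?_⟩
    rw [smul_smul]
    exact key _

/-- `M ⊆ ℂ^N` is a CR submanifold of class `{m}`, of real dimension `d` and CR dimension `n`. -/
structure IsUltradifferentiableCRSubmanifold {N : ℕ} (m : ℕ → ℝ)
    (M : Set (EuclideanSpace ℂ (Fin N))) (d n : ℕ) : Prop where
  submanifold : IsUltradifferentiableSubmanifold m M d
  finrank_complexTangentSpace : ∀ p ∈ M, Module.finrank ℂ (complexTangentSpace M p) = n

/-- `X` (only its values on `M` matter) is a section of class `{m}` of the complex tangent bundle
`T^c M`: it takes values in `T^c M` and is locally the restriction to `M` of a map of class `{m}` on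
an open subset of `ℂ^N`. -/
def IsComplexTangentSection {N : ℕ} (m : ℕ → ℝ) (M : Set (EuclideanSpace ℂ (Fin N)))
    (X : EuclideanSpace ℂ (Fin N) → EuclideanSpace ℂ (Fin N)) : Prop :=
  (∀ p ∈ M, X p ∈ complexTangentSpace M p) ∧
    ∀ p ∈ M, ∃ (U : Set (EuclideanSpace ℂ (Fin N)))
      (Y : EuclideanSpace ℂ (Fin N) → EuclideanSpace ℂ (Fin N)),
      IsOpen U ∧ p ∈ U ∧ IsUltradifferentiableOn m Y U ∧ ∀ x ∈ M ∩ U, X x = Y x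

/-- `M` (of dimension `d`) is minimal at `p₀`, with respect to submanifolds in the sense of `IsSub`
(below: smooth ones, or those of class `{m}`): there is no submanifold `S ⊆ M` through `p₀` with
`T^c_p M ⊆ T_p S` for all `p ∈ S` and `dim S < dim M`. -/
def IsMinimalAt {N : ℕ} (IsSub : Set (EuclideanSpace ℂ (Fin N)) → ℕ → Prop)
    (M : Set (EuclideanSpace ℂ (Fin N))) (d : ℕ) (p₀ : EuclideanSpace ℂ (Fin N)) : Prop :=
  ¬ ∃ (S : Set (EuclideanSpace ℂ (Fin N))) (k : ℕ),
    IsSub S k ∧ S ⊆ M ∧ p₀ ∈ S ∧ k < d ∧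
      ∀ p ∈ S, ∀ v ∈ complexTangentSpace M p, v ∈ realTangentSpace S p

/-- `W` is a submanifold of `M`, of dimension `k` and class `{m}`, through `p₀`, to which all
vector fields of the collection `D` are tangent at every point of `W`. -/
structure IsTangentSubmanifold {N : ℕ} (m : ℕ → ℝ) (M : Set (EuclideanSpace ℂ (Fin N)))
    (D : Set (EuclideanSpace ℂ (Fin N) → EuclideanSpace ℂ (Fin N)))
    (p₀ : EuclideanSpace ℂ (Fin N)) (W : Set (EuclideanSpace ℂ (Fin N))) (k : ℕ) : Prop where
  submanifold : IsUltradifferentiableSubmanifold m W k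
  subset : W ⊆ M
  mem : p₀ ∈ W
  tangent : ∀ X ∈ D, ∀ p ∈ W, X p ∈ realTangentSpace W p

/-- `q` is joined to `p` inside `A` by an integral curve of a vector field of the collection `D`. -/
def JoinedByIntegralCurve {N : ℕ}
    (D : Set (EuclideanSpace ℂ (Fin N) → EuclideanSpace ℂ (Fin N)))
    (A : Set (EuclideanSpace ℂ (Fin N))) (p q : EuclideanSpace ℂ (Fin N)) : Prop :=
  ∃ X ∈ D, ∃ (T : ℝ) (γ : ℝ → EuclideanSpace ℂ (Fin N)), 0 ≤ T ∧ γ 0 = p ∧ γ T = q ∧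
    ∀ t ∈ Set.Icc 0 T, γ t ∈ A ∧ HasDerivWithinAt γ (X (γ t)) (Set.Icc 0 T) t

/-- `W`, of dimension `k`, represents the local Sussmann orbit of `p₀` in `M` relative to `D`:
the vector fields in `D` are tangent to `W`, the germ of `W` at `p₀` is contained in every other
submanifold of `M` through `p₀` with this property, and nearby points of `W` are reached from `p₀`
by polygonal paths that consist of a fixed number `J` of integral curves. -/
structure IsLocalSussmannOrbit {N : ℕ} (m : ℕ → ℝ) (M : Set (EuclideanSpace ℂ (Fin N)))
    (D : Set (EuclideanSpace ℂ (Fin N) → EuclideanSpace ℂ (Fin N)))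
    (p₀ : EuclideanSpace ℂ (Fin N)) (W : Set (EuclideanSpace ℂ (Fin N))) (k : ℕ) : Prop where
  isTangentSubmanifold : IsTangentSubmanifold m M D p₀ W k
  germ_subset : ∀ (W' : Set (EuclideanSpace ℂ (Fin N))) (k' : ℕ),
    IsTangentSubmanifold m M D p₀ W' k' →
      ∃ V : Set (EuclideanSpace ℂ (Fin N)), IsOpen V ∧ p₀ ∈ V ∧ W ∩ V ⊆ W' ∩ V
  reachable : ∀ U : Set (EuclideanSpace ℂ (Fin N)), IsOpen U → p₀ ∈ U →
    ∃ (J : ℕ) (V₁ V₂ : Set (EuclideanSpace ℂ (Fin N))), IsOpen V₁ ∧ IsOpen V₂ ∧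
      p₀ ∈ V₁ ∧ V₁ ⊆ V₂ ∧ V₂ ⊆ U ∧ ∀ p ∈ W ∩ V₁,
        ∃ q : ℕ → EuclideanSpace ℂ (Fin N), q 0 = p₀ ∧ q J = p ∧
          ∀ j < J, JoinedByIntegralCurve D (W ∩ V₂) (q j) (q (j + 1))

/-- The local Sussmann orbit is unique as a germ at `p₀`. -/
theorem IsLocalSussmannOrbit.germ_unique {N : ℕ} {m : ℕ → ℝ}
    {M : Set (EuclideanSpace ℂ (Fin N))}
    {D : Set (EuclideanSpace ℂ (Fin N) → EuclideanSpace ℂ (Fin N))}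
    {p₀ : EuclideanSpace ℂ (Fin N)} {W W' : Set (EuclideanSpace ℂ (Fin N))} {k k' : ℕ}
    (h : IsLocalSussmannOrbit m M D p₀ W k) (h' : IsLocalSussmannOrbit m M D p₀ W' k') :
    ∃ V : Set (EuclideanSpace ℂ (Fin N)), IsOpen V ∧ p₀ ∈ V ∧ W ∩ V = W' ∩ V := by
  obtain ⟨V, hV, hpV, hVs⟩ := h.germ_subset W' k' h'.isTangentSubmanifold
  obtain ⟨V', hV', hpV', hVs'⟩ := h'.germ_subset W k h.isTangentSubmanifold
  refine ⟨V ∩ V', hV.inter hV', ⟨hpV, hpV'⟩, ?_⟩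
  ext x
  constructor
  · rintro ⟨hx, h1, h2⟩
    exact ⟨(hVs ⟨hx, h1⟩).1, h1, h2⟩
  · rintro ⟨hx, h1, h2⟩
    exact ⟨(hVs' ⟨hx, h2⟩).1, h1, h2⟩

/-- `W`, of dimension `k`, represents the CR orbit of `p₀`: the local Sussmann orbit of `p₀` in `M`
relative to the sections of class `{m}` of `T^c M`. -/
def IsCROrbit {N : ℕ} (m : ℕ → ℝ) (M : Set (EuclideanSpace ℂ (Fin N)))
    (p₀ : EuclideanSpace ℂ (Fin N)) (W : Set (EuclideanSpace ℂ (Fin N))) (k : ℕ) : Prop :=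
  IsLocalSussmannOrbit m M {X | IsComplexTangentSection m M X} p₀ W k

/-- The CR orbit of `p₀` (a germ of a submanifold of `M`) has real dimension `k`. -/
def HasCROrbitDim {N : ℕ} (m : ℕ → ℝ) (M : Set (EuclideanSpace ℂ (Fin N)))
    (p₀ : EuclideanSpace ℂ (Fin N)) (k : ℕ) : Prop :=
  ∃ W : Set (EuclideanSpace ℂ (Fin N)), IsCROrbit m M p₀ W k

/-- Membership in the real Lie algebra of vector fields on `M` generated by `D`. The bracket of two
vector fields tangent to `M` is computed with derivatives along `M`; at points of `M` it agrees with
the bracket of any two local extensions to `ℂ^N` (see `lieBracketWithin_eq_of_extension`). -/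
inductive InGeneratedLieAlgebra {N : ℕ} (M : Set (EuclideanSpace ℂ (Fin N)))
    (D : Set (EuclideanSpace ℂ (Fin N) → EuclideanSpace ℂ (Fin N))) :
    (EuclideanSpace ℂ (Fin N) → EuclideanSpace ℂ (Fin N)) → Prop
  | base (X : EuclideanSpace ℂ (Fin N) → EuclideanSpace ℂ (Fin N)) :
      X ∈ D → InGeneratedLieAlgebra M D X
  | zero : InGeneratedLieAlgebra M D 0
  | add (X Y : EuclideanSpace ℂ (Fin N) → EuclideanSpace ℂ (Fin N)) :
      InGeneratedLieAlgebra M D X → InGeneratedLieAlgebra M D Y →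
      InGeneratedLieAlgebra M D (X + Y)
  | smul (r : ℝ) (X : EuclideanSpace ℂ (Fin N) → EuclideanSpace ℂ (Fin N)) :
      InGeneratedLieAlgebra M D X → InGeneratedLieAlgebra M D (r • X)
  | bracket (X Y : EuclideanSpace ℂ (Fin N) → EuclideanSpace ℂ (Fin N)) :
      InGeneratedLieAlgebra M D X → InGeneratedLieAlgebra M D Y →
      InGeneratedLieAlgebra M D (VectorField.lieBracketWithin ℝ X Y M)

/-- The derivative along `M` in a direction tangent to `M` is that of any local extension. -/
theorem fderivWithin_eq_of_extension {N : ℕ} {M U : Set (EuclideanSpace ℂ (Fin N))}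
    {p v : EuclideanSpace ℂ (Fin N)} {f g : EuclideanSpace ℂ (Fin N) → EuclideanSpace ℂ (Fin N)}
    (hU : IsOpen U) (hpU : p ∈ U) (hpM : p ∈ M) (hg : DifferentiableAt ℝ g p)
    (hfg : ∀ x ∈ M ∩ U, f x = g x) (hv : v ∈ realTangentSpace M p) :
    fderivWithin ℝ f M p v = fderiv ℝ g p v := by
  have hev : f =ᶠ[𝓝[M] p] g := by
    filter_upwards [self_mem_nhdsWithin, mem_nhdsWithin_of_mem_nhds (hU.mem_nhds hpU)]
      with x hx hx' using hfg x ⟨hx, hx'⟩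
  have h1 : HasFDerivWithinAt f (fderiv ℝ g p) M p :=
    (hg.hasFDerivAt.hasFDerivWithinAt).congr_of_eventuallyEq hev (hfg p ⟨hpM, hpU⟩)
  have h2 : HasFDerivWithinAt f (fderivWithin ℝ f M p) M p :=
    h1.differentiableWithinAt.hasFDerivWithinAt
  refine Submodule.span_induction (p := fun v _ => fderivWithin ℝ f M p v = fderiv ℝ g p v)
    ?_ (by simp) (fun a b _ _ ha hb => by rw [map_add, map_add, ha, hb])
    (fun r a _ ha => by rw [map_smul, map_smul, ha]) hv
  rintro w ⟨γ, hγ0, hγM, hγ⟩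
  subst hγ0
  have e1 : HasDerivAt (f ∘ γ) (fderivWithin ℝ f M (γ 0) w) 0 := h2.comp_hasDerivAt 0 hγ hγM
  have e2 : HasDerivAt (f ∘ γ) (fderiv ℝ g (γ 0) w) 0 := h1.comp_hasDerivAt 0 hγ hγM
  exact e1.unique e2

/-- The bracket along `M` of vector fields tangent to `M` is that of any local extensions. -/
theorem lieBracketWithin_eq_of_extension {N : ℕ} {M U : Set (EuclideanSpace ℂ (Fin N))}
    {p : EuclideanSpace ℂ (Fin N)}
    {X Y X' Y' : EuclideanSpace ℂ (Fin N) → EuclideanSpace ℂ (Fin N)}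
    (hU : IsOpen U) (hpU : p ∈ U) (hpM : p ∈ M)
    (hX' : DifferentiableAt ℝ X' p) (hY' : DifferentiableAt ℝ Y' p)
    (hX : ∀ x ∈ M ∩ U, X x = X' x) (hY : ∀ x ∈ M ∩ U, Y x = Y' x)
    (hXt : X p ∈ realTangentSpace M p) (hYt : Y p ∈ realTangentSpace M p) :
    VectorField.lieBracketWithin ℝ X Y M p = VectorField.lieBracket ℝ X' Y' p := by
  rw [VectorField.lieBracketWithin, VectorField.lieBracket,
    fderivWithin_eq_of_extension hU hpU hpM hY' hY hXt,
    fderivWithin_eq_of_extension hU hpU hpM hX' hX hYt, hX p ⟨hpM, hpU⟩, hY p ⟨hpM, hpU⟩]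

/-- `M` is of finite type at `p₀`: there are finitely many sections of class `{m}` of `T^c M` such
that the values at `p₀` of the Lie algebra they generate make up all of `T_{p₀} M`. -/
def IsFiniteTypeAt {N : ℕ} (m : ℕ → ℝ) (M : Set (EuclideanSpace ℂ (Fin N)))
    (p₀ : EuclideanSpace ℂ (Fin N)) : Prop :=
  ∃ (k : ℕ) (X : Fin k → EuclideanSpace ℂ (Fin N) → EuclideanSpace ℂ (Fin N)),
    (∀ j, IsComplexTangentSection m M (X j)) ∧
    {v | ∃ Z, InGeneratedLieAlgebra M (Set.range X) Z ∧ Z p₀ = v} =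
      (realTangentSpace M p₀ : Set (EuclideanSpace ℂ (Fin N)))

/-! Two implications are soft. Submanifolds of class `{m}` are smooth, so minimality implies
minimality within the class. If `S ⊆ M` has `T^c M` in its tangent spaces, then `S` competes in the
definition of the orbit, hence contains the germ of the orbit and has at least its dimension; a
full-dimensional orbit therefore forces minimality within the class. Finite type implies minimality
because fields tangent to `S` are closed under brackets: the values of the Lie algebra then lie in
`T_{p₀} S`, which is too small.

That minimality within the class implies finite type is Nagano's theorem (`exists_nagano_leaf`), the
place where quasianalyticity enters. Let `L` be the Lie algebra generated by local extensions of
sections that span `T^c M`, let `T = L(p₀)`, and let `π` be a projection onto `T`. Fields in the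
module generated by `L` can be normalized to a frame `Z` with `π Z = id`. A field `Y` of the module
with `π Y = 0` vanishes at `p₀`. Along an integral curve of `Z v` through `p₀` its derivative is `[Z
v, Y]`, a field of the same kind, plus a term linear in `Y`. So `Y` is flat at `p₀` along the curve,
and if it is of class `{m}` it vanishes there by the Denjoy–Carleman theorem. For `Y = [Z a, Z b]`
this is the integrability condition, and `exists_total_solution` integrates `Dw = Z ∘ w`. For `Y = Z
(π X) - X` it says that `X ∈ L` is tangent to the leaf. If `T` were a proper subspace of `T_{p₀} M`,
the leaf would contradict minimality.

That finite type yields an orbit of full dimension is Chow's theorem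
(`IsFiniteTypeAt.exists_reachable`). Conjugating short flows by other flows gives endpoint maps
whose velocities span a space closed under bracketing, hence all of `T_{p₀} M`; such an endpoint map
is locally onto `M`.

Regularity within the class rests on one principle, `IsUltradifferentiableOn.comp_total`: composing
a function of class `{m}` with a solution of `Dw = Φ ∘ w`, where `Φ` is of class `{m}`, stays in the
class. Inverses, integral curves and leaves all solve such equations, so this replaces separate
theorems on composition, inversion and differential equations. -/

/-! ### Weight sequences -/

namespace IsRegularWeightSequence

variable {m : ℕ → ℝ}

theorem ratio_monotone (hm : IsRegularWeightSequence m) : Monotone fun k => m (k + 1) / m k := by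
  refine monotone_nat_of_le_succ fun k => ?_
  rw [div_le_div_iff₀ (hm.pos _) (hm.pos _)]
  nlinarith [hm.log_convex k]

/-- Since `m 0 = 1`, `m b` is the product of the first `b` successive ratios. By log-convexity each
is at most the ratio shifted by `a`, and the shifted ratios multiply to `m (a + b) / m a`. This is
what makes the Leibniz rule preserve the class. -/
theorem mul_le (hm : IsRegularWeightSequence m) (a b : ℕ) : m a * m b ≤ m (a + b) := by
  induction b with
  | zero => simp [hm.zero_eq_one]
  | succ b ih =>
    have h1 : m (b + 1) / m b ≤ m (a + b + 1) / m (a + b) := hm.ratio_monotone (by omega)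
    have h2 : m (b + 1) = m (b + 1) / m b * m b := by field_simp [(hm.pos b).ne']
    have h3 : m (a + (b + 1)) = m (a + b + 1) / m (a + b) * m (a + b) := by
      rw [div_mul_cancel₀ _ (hm.pos _).ne', add_assoc]
    have h4 : 0 < m (a + b + 1) / m (a + b) := div_pos (hm.pos _) (hm.pos _)
    calc m a * m (b + 1) = m (b + 1) / m b * (m a * m b) := by rw [h2]; field_simp [(hm.pos b).ne']
      _ ≤ m (a + b + 1) / m (a + b) * m (a + b) := by
        gcongr
        exact mul_nonneg (hm.pos _).le (hm.pos _).le
      _ = m (a + (b + 1)) := h3.symm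

theorem exists_succ_le (hm : IsRegularWeightSequence m) :
    ∃ H : ℝ, 1 ≤ H ∧ ∀ k, m (k + 1) ≤ H ^ k * m k := by
  obtain ⟨B, hB⟩ := hm.derivation_closed
  refine ⟨max B 1, le_max_right _ _, fun k => ?_⟩
  -- For `k = 0` the exponent is `0⁻¹ = 0` and the root condition is empty; the normalization `m 0 =
  -- m 1 = 1` covers this case.
  rcases Nat.eq_zero_or_pos k with rfl | hk
  · simp [hm.zero_eq_one, hm.one_eq_one]
  have h1 : (m (k + 1) / m k) ^ ((k : ℝ)⁻¹) ≤ max B 1 :=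
    (hB ⟨k, rfl⟩).trans (le_max_left _ _)
  have h0 : 0 ≤ m (k + 1) / m k := (div_pos (hm.pos _) (hm.pos _)).le
  have h2 : m (k + 1) / m k ≤ (max B 1) ^ k := by
    have := pow_le_pow_left₀ (Real.rpow_nonneg h0 _) h1 k
    rwa [Real.rpow_inv_natCast_pow h0 hk.ne'] at this
  rwa [div_le_iff₀ (hm.pos _)] at h2

end IsRegularWeightSequence

/-! ### Closure properties of the class `{m}` -/

namespace IsUltradifferentiableOn

variable {E F G H : Type} [NormedAddCommGroup E] [NormedSpace ℝ E]
  [NormedAddCommGroup F] [NormedSpace ℝ F] [NormedAddCommGroup G] [NormedSpace ℝ G]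
  [NormedAddCommGroup H] [NormedSpace ℝ H] {m : ℕ → ℝ} {U : Set E}

theorem contDiffAt {f : E → F} (hf : IsUltradifferentiableOn m f U) (hU : IsOpen U) {x : E}
    (hx : x ∈ U) : ContDiffAt ℝ ∞ f x :=
  hf.1.contDiffAt (hU.mem_nhds hx)

theorem mono {f : E → F} (hf : IsUltradifferentiableOn m f U) {V : Set E} (hVU : V ⊆ U) :
    IsUltradifferentiableOn m f V :=
  ⟨hf.1.mono hVU, fun K hK hKc => hf.2 K (hK.trans hVU) hKc⟩

theorem congr {f g : E → F} (hf : IsUltradifferentiableOn m f U) (hU : IsOpen U)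
    (hfg : ∀ x ∈ U, g x = f x) : IsUltradifferentiableOn m g U := by
  refine ⟨hf.1.congr hfg, fun K hK hKc => ?_⟩
  obtain ⟨C, h, hC, hh, hb⟩ := hf.2 K hK hKc
  refine ⟨C, h, hC, hh, fun x hx k => ?_⟩
  have : g =ᶠ[𝓝 x] f := by
    filter_upwards [hU.mem_nhds (hK hx)] with y hy using hfg y hy
  rw [(this.iteratedFDeriv ℝ k).eq_of_nhds]
  exact hb x hx k

/-- Two functions of class `{m}` satisfy the defining bounds with common constants. -/
theorem common_bound (hm : IsRegularWeightSequence m) {f : E → F} {V : Set G} {g : G → H}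
    (hf : IsUltradifferentiableOn m f U) (hg : IsUltradifferentiableOn m g V) {K : Set E}
    {L : Set G} (hK : K ⊆ U) (hKc : IsCompact K) (hL : L ⊆ V) (hLc : IsCompact L) :
    ∃ C h : ℝ, 0 < C ∧ 0 < h ∧
      (∀ x ∈ K, ∀ k : ℕ, ‖iteratedFDeriv ℝ k f x‖ ≤ C * h ^ k * m k * (k ! : ℝ)) ∧
      ∀ x ∈ L, ∀ k : ℕ, ‖iteratedFDeriv ℝ k g x‖ ≤ C * h ^ k * m k * (k ! : ℝ) := by
  obtain ⟨C, h, hC, hh, hb⟩ := hf.2 K hK hKc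
  obtain ⟨C', h', hC', hh', hb'⟩ := hg.2 L hL hLc
  refine ⟨max C C', max h h', lt_max_of_lt_left hC, lt_max_of_lt_left hh, fun x hx k => ?_,
    fun x hx k => ?_⟩
  · refine (hb x hx k).trans ?_
    have := (hm.pos k).le
    gcongr
    exacts [le_max_left _ _, le_max_left _ _]
  · refine (hb' x hx k).trans ?_
    have := (hm.pos k).le
    gcongr
    exacts [le_max_right _ _, le_max_right _ _]

theorem clm_comp {f : E → F} (hf : IsUltradifferentiableOn m f U)
    (hU : IsOpen U) (L : F →L[ℝ] G) : IsUltradifferentiableOn m (fun x => L (f x)) U := by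
  refine ⟨L.contDiff.comp_contDiffOn hf.1, fun K hK hKc => ?_⟩
  obtain ⟨C, h, hC, hh, hb⟩ := hf.2 K hK hKc
  refine ⟨(‖L‖ + 1) * C, h, by positivity, hh, fun x hx k => ?_⟩
  have h1 := L.norm_iteratedFDeriv_comp_left (n := k) (hf.contDiffAt hU (hK hx))
    (by exact_mod_cast le_top)
  have h2 := hb x hx k
  have h3 : 0 ≤ C * h ^ k * m k * (k ! : ℝ) := (norm_nonneg _).trans h2
  calc _ ≤ ‖L‖ * ‖iteratedFDeriv ℝ k f x‖ := h1
    _ ≤ (‖L‖ + 1) * (C * h ^ k * m k * (k ! : ℝ)) := by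
      gcongr
      linarith
    _ = _ := by ring

theorem add {f g : E → F} (hm : IsRegularWeightSequence m) (hf : IsUltradifferentiableOn m f U)
    (hg : IsUltradifferentiableOn m g U) (hU : IsOpen U) :
    IsUltradifferentiableOn m (fun x => f x + g x) U := by
  refine ⟨hf.1.add hg.1, fun K hK hKc => ?_⟩
  obtain ⟨C, h, hC, hh, hb, hb'⟩ := common_bound hm hf hg hK hKc hK hKc
  refine ⟨2 * C, h, by positivity, hh, fun x hx k => ?_⟩
  have h1 : iteratedFDeriv ℝ k (fun x => f x + g x) x = _ :=
    iteratedFDeriv_add_apply (i := k)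
    ((hf.contDiffAt hU (hK hx)).of_le (by exact_mod_cast le_top))
    ((hg.contDiffAt hU (hK hx)).of_le (by exact_mod_cast le_top))
  rw [h1]
  refine (norm_add_le _ _).trans ?_
  linarith [hb x hx k, hb' x hx k]

theorem const (hm : IsRegularWeightSequence m) (c : F) :
    IsUltradifferentiableOn m (fun _ : E => c) U := by
  refine ⟨contDiffOn_const, fun K _ _ => ⟨‖c‖ + 1, 1, by positivity, one_pos, fun x _ k => ?_⟩⟩
  rcases Nat.eq_zero_or_pos k with rfl | hk
  · simp [hm.zero_eq_one]
  · rw [iteratedFDeriv_const_of_ne hk.ne']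
    have := hm.pos k
    simp only [Pi.zero_apply, norm_zero]
    positivity

/-- Shifting the order by one costs `m (k + 1) / m k ≤ B ^ k` and `k + 1 ≤ 2 ^ k`. Both are
geometric and are absorbed in the constant `h`. -/
theorem fderiv {f : E → F} (hm : IsRegularWeightSequence m) (hf : IsUltradifferentiableOn m f U)
    (hU : IsOpen U) : IsUltradifferentiableOn m (fderiv ℝ f) U := by
  refine ⟨hf.1.fderiv_of_isOpen hU (by simp), fun K hK hKc => ?_⟩
  obtain ⟨C, h, hC, hh, hb⟩ := hf.2 K hK hKc
  obtain ⟨B, hB, hmB⟩ := hm.exists_succ_le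
  refine ⟨C * h, 2 * h * B, by positivity, by positivity, fun x hx k => ?_⟩
  rw [norm_iteratedFDeriv_fderiv]
  refine (hb x hx (k + 1)).trans ?_
  have h1 : ((k + 1 : ℕ) : ℝ) ≤ 2 ^ k := by exact_mod_cast Nat.lt_two_pow_self
  calc C * h ^ (k + 1) * m (k + 1) * ((k + 1)! : ℝ)
      = C * h ^ (k + 1) * m (k + 1) * (((k + 1 : ℕ) : ℝ) * (k ! : ℝ)) := by
        rw [Nat.factorial_succ]; push_cast; ring
    _ ≤ C * h ^ (k + 1) * (B ^ k * m k) * (2 ^ k * (k ! : ℝ)) := by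
        have := (hm.pos k).le
        have := (hm.pos (k + 1)).le
        gcongr
        exact hmB k
    _ = _ := by ring

theorem clm (hm : IsRegularWeightSequence m) (L : E →L[ℝ] F) :
    IsUltradifferentiableOn m (fun x => L x) U := by
  refine ⟨L.contDiff.contDiffOn, fun K _ hKc => ?_⟩
  obtain ⟨R, hR⟩ := hKc.isBounded.exists_norm_le
  refine ⟨‖L‖ * (max R 0) + ‖L‖ + 1, 1, by positivity, one_pos, fun x hx k => ?_⟩
  have hp := hm.pos k
  rcases k with _ | _ | k
  · simp only [norm_iteratedFDeriv_zero, pow_zero, mul_one, hm.zero_eq_one, Nat.factorial_zero,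
      Nat.cast_one]
    have : ‖L x‖ ≤ ‖L‖ * max R 0 :=
      (L.le_opNorm x).trans (by gcongr; exact (hR x hx).trans (le_max_left _ _))
    linarith [norm_nonneg L]
  · rw [← norm_iteratedFDeriv_fderiv]
    simp only [zero_add, norm_iteratedFDeriv_zero, ContinuousLinearMap.fderiv, pow_one,
      mul_one, hm.one_eq_one, Nat.factorial_one, Nat.cast_one]
    have : 0 ≤ ‖L‖ * max R 0 := by positivity
    linarith
  · rw [← norm_iteratedFDeriv_fderiv]
    have : (_root_.fderiv ℝ fun x => L x) = fun _ => L := by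
      ext1 x; exact L.fderiv
    rw [this, iteratedFDeriv_const_of_ne (by omega)]
    simp only [Pi.zero_apply, norm_zero]
    positivity

theorem iteratedFDeriv_comp_right_le {f : F → G} {Ω : Set F} (hΩ : IsOpen Ω)
    (hf : ContDiffOn ℝ ∞ f Ω) (L : E →L[ℝ] F) {x : E} (hx : L x ∈ Ω) (k : ℕ) :
    ‖iteratedFDeriv ℝ k (fun y => f (L y)) x‖ ≤ ‖iteratedFDeriv ℝ k f (L x)‖ * ‖L‖ ^ k := by
  have hpre : IsOpen (L ⁻¹' Ω) := hΩ.preimage L.continuous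
  have h1 := L.iteratedFDerivWithin_comp_right hf hΩ.uniqueDiffOn hpre.uniqueDiffOn hx (i := k)
    (by exact_mod_cast le_top)
  rw [iteratedFDerivWithin_of_isOpen k hpre hx, iteratedFDerivWithin_of_isOpen k hΩ hx] at h1
  have h2 : iteratedFDeriv ℝ k (fun y => f (L y)) x = _ := h1
  rw [h2]
  refine (ContinuousMultilinearMap.norm_compContinuousLinearMap_le _ _).trans ?_
  simp

theorem comp_clm {f : F → G} {Ω : Set F}
    (hf : IsUltradifferentiableOn m f Ω) (hΩ : IsOpen Ω) (L : E →L[ℝ] F)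
    (hL : ∀ x ∈ U, L x ∈ Ω) : IsUltradifferentiableOn m (fun x => f (L x)) U := by
  refine ⟨hf.1.comp L.contDiff.contDiffOn hL, fun K hK hKc => ?_⟩
  obtain ⟨C, h, hC, hh, hb⟩ := hf.2 (L '' K) (image_subset_iff.2 fun x hx => hL x (hK hx))
    (hKc.image L.continuous)
  refine ⟨C, h * (‖L‖ + 1), hC, by positivity, fun x hx k => ?_⟩
  refine (iteratedFDeriv_comp_right_le hΩ hf.1 L (hL x (hK hx)) k).trans ?_
  have h2 := hb (L x) (mem_image_of_mem _ hx) k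
  have h3 : 0 ≤ C * h ^ k * m k * (k ! : ℝ) := (norm_nonneg _).trans h2
  calc _ ≤ (C * h ^ k * m k * (k ! : ℝ)) * (‖L‖ + 1) ^ k := by
        gcongr
        linarith
    _ = _ := by rw [mul_pow]; ring

theorem norm_iteratedFDeriv_bilinear_le {f : E → F} {g : E → G} (hU : IsOpen U)
    (hf : ContDiffOn ℝ ∞ f U) (hg : ContDiffOn ℝ ∞ g U) (B : F →L[ℝ] G →L[ℝ] H) {x : E}
    (hx : x ∈ U) (n : ℕ) :
    ‖iteratedFDeriv ℝ n (fun y => B (f y) (g y)) x‖ ≤ ‖B‖ * ∑ i ∈ Finset.range (n + 1),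
      (n.choose i : ℝ) * ‖iteratedFDeriv ℝ i f x‖ * ‖iteratedFDeriv ℝ (n - i) g x‖ := by
  have h := B.norm_iteratedFDerivWithin_le_of_bilinear hf hg hU.uniqueDiffOn hx (n := n)
    (by exact_mod_cast le_top)
  rw [iteratedFDerivWithin_of_isOpen n hU hx] at h
  refine h.trans (le_of_eq ?_)
  congr 1
  refine Finset.sum_congr rfl fun i _ => ?_
  rw [iteratedFDerivWithin_of_isOpen i hU hx, iteratedFDerivWithin_of_isOpen (n - i) hU hx]

/-- In the Leibniz rule the binomial coefficient turns `i! (k - i)!` into `k!`, and `m i * m (k - i)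
≤ m k`. All `k + 1` terms thus have the same bound, and `k + 1 ≤ 2 ^ k` accounts for the factor `2`
in `2 * h`. -/
theorem bilinear {f : E → F} {g : E → G} (hm : IsRegularWeightSequence m)
    (hf : IsUltradifferentiableOn m f U) (hg : IsUltradifferentiableOn m g U) (hU : IsOpen U)
    (B : F →L[ℝ] G →L[ℝ] H) : IsUltradifferentiableOn m (fun x => B (f x) (g x)) U := by
  refine ⟨(B.isBoundedBilinearMap.contDiff.comp_contDiffOn (hf.1.prodMk hg.1)),
    fun K hK hKc => ?_⟩
  obtain ⟨C, h, hC, hh, hb, hb'⟩ := common_bound hm hf hg hK hKc hK hKc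
  refine ⟨(‖B‖ + 1) * C ^ 2, 2 * h, by positivity, by positivity, fun x hx k => ?_⟩
  refine (norm_iteratedFDeriv_bilinear_le hU hf.1 hg.1 B (hK hx) k).trans ?_
  have hp := (hm.pos k).le
  have h1 : ∑ i ∈ Finset.range (k + 1),
      (k.choose i : ℝ) * ‖iteratedFDeriv ℝ i f x‖ * ‖iteratedFDeriv ℝ (k - i) g x‖ ≤
      ∑ i ∈ Finset.range (k + 1), C ^ 2 * h ^ k * m k * (k ! : ℝ) := by
    refine Finset.sum_le_sum fun i hi => ?_
    have hik : i ≤ k := Nat.lt_succ_iff.1 (Finset.mem_range.1 hi)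
    have hpi := (hm.pos i).le
    have hpk := (hm.pos (k - i)).le
    calc (k.choose i : ℝ) * ‖iteratedFDeriv ℝ i f x‖ * ‖iteratedFDeriv ℝ (k - i) g x‖
        ≤ (k.choose i : ℝ) * (C * h ^ i * m i * (i ! : ℝ)) *
          (C * h ^ (k - i) * m (k - i) * ((k - i)! : ℝ)) := by
          gcongr
          · exact hb x hx i
          · exact hb' x hx (k - i)
      _ = C ^ 2 * (h ^ i * h ^ (k - i)) * (m i * m (k - i)) *
          ((k.choose i : ℝ) * (i ! : ℝ) * ((k - i)! : ℝ)) := by ring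
      _ ≤ C ^ 2 * h ^ k * m k * (k ! : ℝ) := by
          rw [← pow_add, Nat.add_sub_cancel' hik]
          have : m i * m (k - i) ≤ m k := by
            simpa [Nat.add_sub_cancel' hik] using hm.mul_le i (k - i)
          have h5 : (k.choose i : ℝ) * (i ! : ℝ) * ((k - i)! : ℝ) = (k ! : ℝ) := by
            exact_mod_cast Nat.choose_mul_factorial_mul_factorial hik
          rw [h5]
          gcongr
  rw [Finset.sum_const, Finset.card_range, nsmul_eq_mul] at h1
  have h2 : ((k + 1 : ℕ) : ℝ) ≤ 2 ^ k := by exact_mod_cast Nat.lt_two_pow_self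
  calc _ ≤ ‖B‖ * (((k + 1 : ℕ) : ℝ) * (C ^ 2 * h ^ k * m k * (k ! : ℝ))) := by gcongr
    _ ≤ (‖B‖ + 1) * (2 ^ k * (C ^ 2 * h ^ k * m k * (k ! : ℝ))) := by
        gcongr
        linarith
    _ = _ := by rw [mul_pow]; ring

theorem prodMk {f : E → F} {g : E → G} (hm : IsRegularWeightSequence m)
    (hf : IsUltradifferentiableOn m f U) (hg : IsUltradifferentiableOn m g U) (hU : IsOpen U) :
    IsUltradifferentiableOn m (fun x => (f x, g x)) U := by
  have h := (hf.clm_comp hU (ContinuousLinearMap.inl ℝ F G)).add hm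
    (hg.clm_comp hU (ContinuousLinearMap.inr ℝ F G)) hU
  exact h.congr hU fun x _ => by simp

theorem clm_apply {f : E → F →L[ℝ] G} {g : E → F} (hm : IsRegularWeightSequence m)
    (hf : IsUltradifferentiableOn m f U) (hg : IsUltradifferentiableOn m g U) (hU : IsOpen U) :
    IsUltradifferentiableOn m (fun x => f x (g x)) U :=
  hf.bilinear hm hg hU (ContinuousLinearMap.id ℝ (F →L[ℝ] G))

theorem clm_mul {f : E → G →L[ℝ] H} {g : E → F →L[ℝ] G} (hm : IsRegularWeightSequence m)
    (hf : IsUltradifferentiableOn m f U) (hg : IsUltradifferentiableOn m g U) (hU : IsOpen U) :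
    IsUltradifferentiableOn m (fun x => (f x).comp (g x)) U :=
  hf.bilinear hm hg hU (ContinuousLinearMap.compL ℝ F G H)

theorem sub {f g : E → F} (hm : IsRegularWeightSequence m) (hf : IsUltradifferentiableOn m f U)
    (hg : IsUltradifferentiableOn m g U) (hU : IsOpen U) :
    IsUltradifferentiableOn m (fun x => f x - g x) U :=
  (hf.add hm (hg.clm_comp hU (-ContinuousLinearMap.id ℝ F)) hU).congr hU fun x _ => by
    simp [sub_eq_add_neg]

end IsUltradifferentiableOn

/-! ### Total differential equations in the class `{m}` -/

theorem sum_factorial_ratio (j k : ℕ) :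
    (j + 2 : ℝ) * ∑ i ∈ Finset.range (k + 1), ((i + 1 + j)! : ℝ) / (i ! : ℝ) =
      ((k + j + 2)! : ℝ) / (k ! : ℝ) := by
  induction k with
  | zero =>
    simp only [zero_add, Finset.sum_range_one, Nat.factorial_zero, Nat.cast_one, div_one]
    rw [show j + 2 = (1 + j) + 1 by ring, Nat.factorial_succ]
    push_cast; ring
  | succ k ih =>
    rw [Finset.sum_range_succ, mul_add, ih]
    have h1 : ((k + 1 + j + 2)! : ℝ) = (k + j + 3) * ((k + j + 2)! : ℝ) := by
      rw [show k + 1 + j + 2 = (k + j + 2) + 1 by ring, Nat.factorial_succ]; push_cast; ring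
    have h2 : ((k + 1)! : ℝ) = (k + 1) * (k ! : ℝ) := by
      rw [Nat.factorial_succ]; push_cast; ring
    rw [h1, h2, show k + 1 + 1 + j = k + j + 2 by ring]
    have : (k ! : ℝ) ≠ 0 := by positivity
    field_simp
    ring

section TotalDifferential

variable {E F : Type} [NormedAddCommGroup E] [NormedSpace ℝ E]
  [NormedAddCommGroup F] [NormedSpace ℝ F] {m : ℕ → ℝ}

/-- This is one step of differentiating `g ∘ w` when `Dw = Φ ∘ w`, since then `D(g ∘ w) = (Dg · Φ) ∘
w`. The weight index grows by one and the factorial shift by two, but the summation returns a factor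
`1 / (j + 2)`. Without that gain, `n` steps would cost `(2 * n)!` instead of `n!` up to geometric
factors. -/
theorem norm_iteratedFDeriv_bracket_le (hm : IsRegularWeightSequence m) {G : Type}
    [NormedAddCommGroup G] [NormedSpace ℝ G] {Ω : Set F} (hΩ : IsOpen Ω) {Φ : F → E →L[ℝ] F}
    {g : F → G} (hΦ : ContDiffOn ℝ ∞ Φ Ω) (hg : ContDiffOn ℝ ∞ g Ω) {y : F} (hy : y ∈ Ω)
    {A C h : ℝ} (hC : 0 ≤ C) (hA : 0 ≤ A) (hh : 0 ≤ h) (j l : ℕ)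
    (hbΦ : ∀ k : ℕ, ‖iteratedFDeriv ℝ k Φ y‖ ≤ A * h ^ k * m k * (k ! : ℝ))
    (hbg : ∀ k : ℕ, ‖iteratedFDeriv ℝ k g y‖ ≤ C * h ^ k * m (k + l) * ((k + j)! : ℝ)) (k : ℕ) :
    ‖iteratedFDeriv ℝ k (fun z => (fderiv ℝ g z).comp (Φ z)) y‖ ≤
      (C * (A * h) / (j + 2)) * h ^ k * m (k + (l + 1)) * ((k + (j + 2))! : ℝ) := by
  have h0 := IsUltradifferentiableOn.norm_iteratedFDeriv_bilinear_le hΩ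
    (hg.fderiv_of_isOpen hΩ (m := ∞) (by simp)) hΦ (ContinuousLinearMap.compL ℝ E F G) hy k
  simp only [ContinuousLinearMap.compL_apply] at h0
  refine h0.trans ?_
  have hB := ContinuousLinearMap.norm_compL_le ℝ E F G
  have h1 : ∑ i ∈ Finset.range (k + 1), (k.choose i : ℝ) * ‖iteratedFDeriv ℝ i (fderiv ℝ g) y‖ *
      ‖iteratedFDeriv ℝ (k - i) Φ y‖ ≤ ∑ i ∈ Finset.range (k + 1),
        (C * A * h ^ (k + 1) * m (k + (l + 1)) * (k ! : ℝ)) *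
          (((i + 1 + j)! : ℝ) / (i ! : ℝ)) := by
    refine Finset.sum_le_sum fun i hi => ?_
    have hik : i ≤ k := Nat.lt_succ_iff.1 (Finset.mem_range.1 hi)
    rw [norm_iteratedFDeriv_fderiv]
    have hp1 := (hm.pos (i + 1 + l)).le
    have hpk := (hm.pos (k - i)).le
    have h5 : (k.choose i : ℝ) * ((k - i)! : ℝ) = (k ! : ℝ) / (i ! : ℝ) := by
      rw [eq_div_iff (by positivity)]
      rw [mul_right_comm]
      exact_mod_cast Nat.choose_mul_factorial_mul_factorial hik
    have h6 : m (i + 1 + l) * m (k - i) ≤ m (k + (l + 1)) := by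
      have := hm.mul_le (i + 1 + l) (k - i)
      rwa [show i + 1 + l + (k - i) = k + (l + 1) by omega] at this
    calc (k.choose i : ℝ) * ‖iteratedFDeriv ℝ (i + 1) g y‖ * ‖iteratedFDeriv ℝ (k - i) Φ y‖
        ≤ (k.choose i : ℝ) * (C * h ^ (i + 1) * m (i + 1 + l) * ((i + 1 + j)! : ℝ)) *
          (A * h ^ (k - i) * m (k - i) * ((k - i)! : ℝ)) := by
          gcongr
          · exact hbg (i + 1)
          · exact hbΦ (k - i)
      _ = C * A * (h ^ (i + 1) * h ^ (k - i)) * (m (i + 1 + l) * m (k - i)) *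
          (((k.choose i : ℝ) * ((k - i)! : ℝ)) * ((i + 1 + j)! : ℝ)) := by ring
      _ ≤ C * A * h ^ (k + 1) * m (k + (l + 1)) *
          (((k ! : ℝ) / (i ! : ℝ)) * ((i + 1 + j)! : ℝ)) := by
          rw [← pow_add, show i + 1 + (k - i) = k + 1 by omega, h5]
          gcongr
      _ = _ := by ring
  rw [← Finset.mul_sum] at h1
  -- The hockey-stick identity: `(i + 1 + j)! / i!` is `(j + 1)!` times a binomial coefficient with
  -- fixed lower index `j + 1`.
  have h3 := sum_factorial_ratio j k
  have hj : (j + 2 : ℝ) ≠ 0 := by positivity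
  have h4 : ∑ i ∈ Finset.range (k + 1), ((i + 1 + j)! : ℝ) / (i ! : ℝ) =
      ((k + j + 2)! : ℝ) / (k ! : ℝ) / (j + 2) := by
    rw [← h3]; field_simp
  rw [h4] at h1
  have hpos : 0 ≤ ∑ i ∈ Finset.range (k + 1), (k.choose i : ℝ) *
      ‖iteratedFDeriv ℝ i (fderiv ℝ g) y‖ * ‖iteratedFDeriv ℝ (k - i) Φ y‖ :=
    Finset.sum_nonneg fun i _ => by positivity
  refine (mul_le_of_le_one_left hpos hB).trans (h1.trans (le_of_eq ?_))
  have : (k ! : ℝ) ≠ 0 := by positivity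
  rw [← add_assoc k j 2]
  field_simp
  ring

/-- Pointwise bounds for the derivatives of `g ∘ w`, where `w` solves the total differential
equation `Dw = Φ ∘ w`. -/
theorem norm_iteratedFDeriv_comp_total_le (hm : IsRegularWeightSequence m) {Ω : Set F}
    (hΩ : IsOpen Ω) {U : Set E} (hU : IsOpen U) {Φ : F → E →L[ℝ] F} (hΦ : ContDiffOn ℝ ∞ Φ Ω)
    {w : E → F} (hwΩ : ∀ x ∈ U, w x ∈ Ω)
    (hw : ∀ x ∈ U, HasFDerivAt w (Φ (w x)) x) {x : E} (hx : x ∈ U) {A h : ℝ} (hA : 0 ≤ A)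
    (hh : 0 ≤ h) (hbΦ : ∀ k : ℕ, ‖iteratedFDeriv ℝ k Φ (w x)‖ ≤ A * h ^ k * m k * (k ! : ℝ))
    (n : ℕ) : ∀ (G : Type) [NormedAddCommGroup G] [NormedSpace ℝ G] (g : F → G),
      ContDiffOn ℝ ∞ g Ω → ∀ (C : ℝ) (j l : ℕ), 0 ≤ C →
      (∀ k : ℕ, ‖iteratedFDeriv ℝ k g (w x)‖ ≤ C * h ^ k * m (k + l) * ((k + j)! : ℝ)) →
      ‖iteratedFDeriv ℝ n (fun z => g (w z)) x‖ * ∏ i ∈ Finset.range n, (j + 2 * (i + 1) : ℝ) ≤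
        C * (A * h) ^ n * m (n + l) * ((j + 2 * n)! : ℝ) := by
  induction n with
  | zero =>
    intro G _ _ g hg C j l hC hbg
    simpa using hbg 0
  | succ n ih =>
    intro G _ _ g hg C j l hC hbg
    -- One derivative of the composite is traded for replacing `g` by `g₁`, because `D(g ∘ w) = g₁ ∘
    -- w`. The target space changes with it, which is why the induction hypothesis quantifies over
    -- `G`, `C`, `j` and `l`.
    set g₁ : F → E →L[ℝ] G := fun z => (fderiv ℝ g z).comp (Φ z) with hg₁
    have hg₁c : ContDiffOn ℝ ∞ g₁ Ω :=
      (hg.fderiv_of_isOpen hΩ (m := ∞) (by simp)).clm_comp hΦ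
    have hev : fderiv ℝ (fun z => g (w z)) =ᶠ[𝓝 x] fun z => g₁ (w z) := by
      filter_upwards [hU.mem_nhds hx] with z hz
      have h1 : DifferentiableAt ℝ g (w z) :=
        (hg.contDiffAt (hΩ.mem_nhds (hwΩ z hz))).differentiableAt (by simp)
      exact (h1.hasFDerivAt.comp z (hw z hz)).fderiv
    have h1 := ih _ g₁ hg₁c (C * (A * h) / (j + 2)) (j + 2) (l + 1) (by positivity)
      (norm_iteratedFDeriv_bracket_le hm hΩ hΦ hg (hwΩ x hx) hC hA hh j l hbΦ hbg)
    rw [← norm_iteratedFDeriv_fderiv, (hev.iteratedFDeriv ℝ n).eq_of_nhds,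
      Finset.prod_range_succ']
    have hj : (j + 2 : ℝ) ≠ 0 := by positivity
    have h2 : ∏ i ∈ Finset.range n, ((j : ℝ) + 2 * ((i + 1 : ℕ) + 1)) =
        ∏ i ∈ Finset.range n, (((j + 2 : ℕ) : ℝ) + 2 * (i + 1)) := by
      refine Finset.prod_congr rfl fun i _ => ?_
      push_cast; ring
    rw [h2, ← mul_assoc]
    calc _ ≤ (C * (A * h) / (j + 2) * (A * h) ^ n * m (n + (l + 1)) * ((j + 2 + 2 * n)! : ℝ)) *
          (j + 2 * ((0 : ℕ) + 1)) := by gcongr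
      _ = _ := by
        rw [show n + (l + 1) = n + 1 + l by ring, show j + 2 + 2 * n = j + 2 * (n + 1) by ring]
        field_simp
        push_cast; ring

theorem contDiffOn_of_total_differential [CompleteSpace F] {Ω : Set F} {U : Set E}
    (hU : IsOpen U) {Φ : F → E →L[ℝ] F} (hΦ : ContDiffOn ℝ ∞ Φ Ω) {w : E → F}
    (hwΩ : ∀ x ∈ U, w x ∈ Ω) (hw : ∀ x ∈ U, HasFDerivAt w (Φ (w x)) x) :
    ContDiffOn ℝ ∞ w U := by
  rw [contDiffOn_infty]
  intro n
  induction n with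
  | zero =>
    exact contDiffOn_zero.2 fun x hx => (hw x hx).continuousAt.continuousWithinAt
  | succ n ih =>
    push_cast
    rw [contDiffOn_succ_iff_fderiv_of_isOpen hU]
    refine ⟨fun x hx => (hw x hx).differentiableAt.differentiableWithinAt, by simp, ?_⟩
    refine ContDiffOn.congr (f := fun x => Φ (w x)) ?_ fun x hx => (hw x hx).fderiv
    exact (hΦ.of_le (by exact_mod_cast le_top)).comp ih hwΩ

/-- If `w` solves the total differential equation `Dw = Φ ∘ w` with `Φ` of class `{m}`, then
`g ∘ w` is of class `{m}` for every `g` of class `{m}`. -/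
theorem IsUltradifferentiableOn.comp_total [CompleteSpace F] {G : Type} [NormedAddCommGroup G]
    [NormedSpace ℝ G] (hm : IsRegularWeightSequence m) {Ω : Set F} (hΩ : IsOpen Ω) {U : Set E}
    (hU : IsOpen U) {Φ : F → E →L[ℝ] F} (hΦ : IsUltradifferentiableOn m Φ Ω)
    {g : F → G} (hg : IsUltradifferentiableOn m g Ω) {w : E → F} (hwΩ : ∀ x ∈ U, w x ∈ Ω)
    (hw : ∀ x ∈ U, HasFDerivAt w (Φ (w x)) x) :
    IsUltradifferentiableOn m (fun x => g (w x)) U := by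
  have hwc := contDiffOn_of_total_differential hU hΦ.1 hwΩ hw
  refine ⟨hg.1.comp hwc hwΩ, fun K hK hKc => ?_⟩
  have hL : w '' K ⊆ Ω := image_subset_iff.2 fun x hx => hwΩ x (hK hx)
  have hLc : IsCompact (w '' K) := hKc.image_of_continuousOn (hwc.continuousOn.mono hK)
  obtain ⟨C, h, hC, hh, hb, hb'⟩ := common_bound hm hΦ hg hL hLc hL hLc
  refine ⟨C, 2 * (C * h), hC, by positivity, fun x hx n => ?_⟩
  have h1 := norm_iteratedFDeriv_comp_total_le hm hΩ hU hΦ.1 hwΩ hw (hK hx) hC.le hh.le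
    (hb _ (mem_image_of_mem _ hx)) n G g hg.1 C 0 0 hC.le
    (by simpa using hb' _ (mem_image_of_mem _ hx))
  -- Starting from `j = l = 0`, the bound is `C (C h)^n m_n (2n)! / (2^n n!)`. Since `(2n)! ≤ 4^n
  -- (n!)^2`, this is at most `C (2 C h)^n m_n n!`.
  have h2 : ∏ i ∈ Finset.range n, (((0 : ℕ) : ℝ) + 2 * (i + 1)) = 2 ^ n * (n ! : ℝ) := by
    rw [← Finset.prod_range_add_one_eq_factorial]
    push_cast
    simp [Finset.prod_mul_distrib]
  have h3 : ((0 + 2 * n)! : ℝ) ≤ 4 ^ n * (n ! : ℝ) * (n ! : ℝ) := by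
    have h4 : (2 * n)! = n.centralBinom * n ! * n ! := by
      have := Nat.choose_mul_factorial_mul_factorial (n := 2 * n) (k := n) (by omega)
      rw [show 2 * n - n = n by omega] at this
      rw [← this, Nat.centralBinom]
    have h5 : n.centralBinom ≤ 4 ^ n := by
      rcases Nat.eq_zero_or_pos n with rfl | hn
      · simp
      · exact (Nat.centralBinom_lt_four_pow hn.ne').le
    rw [zero_add, h4]
    push_cast
    gcongr
    exact_mod_cast h5
  rw [h2, add_zero] at h1
  have hp := (hm.pos n).le
  have h6 : ‖iteratedFDeriv ℝ n (fun z => g (w z)) x‖ * (2 ^ n * (n ! : ℝ)) ≤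
      (C * (2 * (C * h)) ^ n * m n * (n ! : ℝ)) * (2 ^ n * (n ! : ℝ)) := by
    refine h1.trans ?_
    calc C * (C * h) ^ n * m n * ((0 + 2 * n)! : ℝ)
        ≤ C * (C * h) ^ n * m n * (4 ^ n * (n ! : ℝ) * (n ! : ℝ)) := by gcongr
      _ = _ := by
        rw [mul_pow 2 (C * h), show (4 : ℝ) = 2 * 2 by norm_num, mul_pow 2 2]; ring
  exact le_of_mul_le_mul_right h6 (by positivity)

end TotalDifferential

namespace IsUltradifferentiableOn

variable {E R : Type} [NormedAddCommGroup E] [NormedSpace ℝ E] [NormedRing R]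
  [NormedAlgebra ℝ R] [CompleteSpace R] [CompleteSpace E] {m : ℕ → ℝ} {U : Set E}

/-- The pointwise inverse of a function of class `{m}` with values in the units of a Banach algebra
is of class `{m}`. -/
theorem ringInverse (hm : IsRegularWeightSequence m) {a : E → R}
    (ha : IsUltradifferentiableOn m a U) (hU : IsOpen U) (hunit : ∀ x ∈ U, IsUnit (a x)) :
    IsUltradifferentiableOn m (fun x => Ring.inverse (a x)) U := by
  set Ω : Set (E × R) := U ×ˢ univ with hΩdef
  have hΩ : IsOpen Ω := hU.prod isOpen_univ
  have hda : IsUltradifferentiableOn m (fun z : E × R => _root_.fderiv ℝ a z.1) Ω :=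
    (ha.fderiv hm hU).comp_clm hU (ContinuousLinearMap.fst ℝ E R) fun z hz => hz.1
  have hJ : IsUltradifferentiableOn m (fun z : E × R => z.2) Ω :=
    clm hm (ContinuousLinearMap.snd ℝ E R)
  have hM : IsUltradifferentiableOn m
      (fun z : E × R => ContinuousLinearMap.mulLeftRight ℝ R z.2 z.2) Ω :=
    hJ.bilinear hm hJ hΩ (ContinuousLinearMap.mulLeftRight ℝ R)
  -- From `D(a⁻¹) = -a⁻¹ (Da) a⁻¹`, the map `x ↦ (x, a(x)⁻¹)` solves `Dw = Φ ∘ w`. Carrying `x` as a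
  -- component makes the equation autonomous.
  set Φ : E × R → E →L[ℝ] E × R := fun z =>
    (ContinuousLinearMap.inl ℝ E R) - (ContinuousLinearMap.inr ℝ E R).comp
      ((ContinuousLinearMap.mulLeftRight ℝ R z.2 z.2).comp (_root_.fderiv ℝ a z.1)) with hΦ
  have hΦm : IsUltradifferentiableOn m Φ Ω :=
    (const hm (ContinuousLinearMap.inl ℝ E R)).sub hm
      ((const hm (ContinuousLinearMap.inr ℝ E R)).clm_mul hm (hM.clm_mul hm hda hΩ) hΩ) hΩ
  refine comp_total (w := fun x => (x, Ring.inverse (a x))) (g := fun z : E × R => z.2)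
    hm hΩ hU hΦm hJ (fun x hx => ⟨hx, mem_univ _⟩) fun x hx => ?_
  obtain ⟨u, hu⟩ := hunit x hx
  have h1 : HasFDerivAt a (_root_.fderiv ℝ a x) x :=
    ((ha.contDiffAt hU hx).differentiableAt (by simp)).hasFDerivAt
  have h2 := hasFDerivAt_ringInverse (𝕜 := ℝ) u
  rw [hu] at h2
  have h3 : HasFDerivAt (fun x => Ring.inverse (a x)) _ x := h2.comp x h1
  have h4 := (hasFDerivAt_id (𝕜 := ℝ) x).prodMk h3
  refine h4.congr_fderiv ?_
  have h5 : Ring.inverse (a x) = ↑u⁻¹ := by rw [← hu, Ring.inverse_unit]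
  ext v
  · simp [hΦ]
  · simp [hΦ, h5]

end IsUltradifferentiableOn

/-! ### The Denjoy–Carleman theorem by Bang's method -/

section DenjoyCarleman

variable {E : Type*} [NormedAddCommGroup E] [NormedSpace ℝ E]

/-- Propagation of Bang's bounds: if all derivatives are bounded by `b e^j M_j` at `x` and
`e^{-n} ≤ b`, then the bounds hold at nearby points `x + t` with `b exp(e t M_n / M_{n-1})`. -/
theorem bang_step {M : ℕ → ℝ} (hM : ∀ k, 0 < M k)
    (hlc : Monotone fun k => M (k + 1) / M k) {F : ℕ → ℝ → E} {a c : ℝ}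
    (hF : ∀ k, ∀ x ∈ Icc a c, HasDerivWithinAt (F k) (F (k + 1) x) (Icc a c) x)
    (hb : ∀ k, ∀ x ∈ Icc a c, ‖F k x‖ ≤ M k) {b : ℝ} (n : ℕ)
    (hn : Real.exp (-(n + 1 : ℕ)) ≤ b) (ha : ∀ k, ‖F k a‖ ≤ b * Real.exp k * M k)
    {x : ℝ} (hx : x ∈ Icc a c) (k : ℕ) :
    ‖F k x‖ ≤ b * Real.exp (Real.exp 1 * (M (n + 1) / M n) * (x - a)) * Real.exp k * M k := by
  have hb0 : 0 < b := (Real.exp_pos _).trans_le hn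
  set μ := M (n + 1) / M n with hμ
  have hμ0 : 0 < μ := div_pos (hM _) (hM _)
  -- For orders at least `n + 1` the factor `b * exp k` is at least `1`, so the a priori bound
  -- already suffices.
  have hlarge : ∀ k, n + 1 ≤ k → ∀ x ∈ Icc a c,
      ‖F k x‖ ≤ b * Real.exp (Real.exp 1 * μ * (x - a)) * Real.exp k * M k := by
    intro k hk x hx
    have h1 : 1 ≤ b * Real.exp k := by
      calc (1 : ℝ) = Real.exp (-(n + 1 : ℕ)) * Real.exp ((n + 1 : ℕ)) := by
            rw [← Real.exp_add]; simp
        _ ≤ b * Real.exp k := by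
            gcongr
    have h2 : 1 ≤ Real.exp (Real.exp 1 * μ * (x - a)) := by
      apply Real.one_le_exp
      have := hx.1
      have := (Real.exp_pos 1).le
      apply mul_nonneg (by positivity) (by linarith)
    calc ‖F k x‖ ≤ M k := hb k x hx
      _ ≤ (b * Real.exp k) * Real.exp (Real.exp 1 * μ * (x - a)) * M k :=
        le_mul_of_one_le_left (hM k).le (one_le_mul_of_one_le_of_one_le h1 h2)
      _ = _ := by ring
  -- Descending induction on the order `n + 1 - i`: the bound for order `j + 1` is integrated to one
  -- for order `j`. As `j ≤ n`, log-convexity gives `M (j + 1) ≤ μ * M j`, so a single exponential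
  -- rate `e μ` serves all orders.
  suffices H : ∀ i, i ≤ n + 1 → ∀ x ∈ Icc a c, ‖F (n + 1 - i) x‖ ≤
      b * Real.exp (Real.exp 1 * μ * (x - a)) * Real.exp (n + 1 - i : ℕ) * M (n + 1 - i) by
    rcases le_or_gt (n + 1) k with h | h
    · exact hlarge k h x hx
    · have := H (n + 1 - k) (by omega) x hx
      rwa [show n + 1 - (n + 1 - k) = k by omega] at this
  intro i
  induction i with
  | zero => exact fun _ x hx => hlarge (n + 1) le_rfl x hx
  | succ i ih =>
    intro hi x hx
    set j := n + 1 - (i + 1) with hj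
    have hj1 : n + 1 - i = j + 1 := by omega
    rw [hj1] at ih
    have ih := ih (by omega)
    have hjn : M (j + 1) ≤ μ * M j := by
      rw [← div_le_iff₀ (hM j)]
      exact hlc (show j ≤ n by omega)
    have hcont : ContinuousOn (F j) (Icc a c) := fun y hy => (hF j y hy).continuousWithinAt
    refine image_norm_le_of_norm_deriv_right_le_deriv_boundary (f := F j) (f' := F (j + 1))
      (B := fun x => b * Real.exp (Real.exp 1 * μ * (x - a)) * Real.exp j * M j)
      (B' := fun x => b * (Real.exp (Real.exp 1 * μ * (x - a)) * (Real.exp 1 * μ)) *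
        Real.exp j * M j) hcont ?_ ?_ ?_ ?_ hx
    · intro y hy
      exact ((hF j y (Ico_subset_Icc_self hy)).mono_of_mem_nhdsWithin
        (Icc_mem_nhdsGE_of_mem hy))
    · simpa using ha j
    · intro y
      have h1 : HasDerivAt (fun x => Real.exp 1 * μ * (x - a)) (Real.exp 1 * μ) y := by
        simpa using ((hasDerivAt_id y).sub_const a).const_mul (Real.exp 1 * μ)
      exact ((h1.exp.const_mul b).mul_const _).mul_const _
    · intro y hy
      refine (ih y (Ico_subset_Icc_self hy)).trans ?_
      calc b * Real.exp (Real.exp 1 * μ * (y - a)) * Real.exp ((j + 1 : ℕ)) * M (j + 1)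
          ≤ b * Real.exp (Real.exp 1 * μ * (y - a)) * Real.exp ((j + 1 : ℕ)) * (μ * M j) := by
            gcongr
        _ = _ := by
            push_cast
            rw [Real.exp_add]; ring

/-- **Denjoy–Carleman theorem** (sufficiency), for a chain `F` of successive derivatives. -/
theorem denjoyCarleman {M : ℕ → ℝ} (hM : ∀ k, 0 < M k)
    (hlc : Monotone fun k => M (k + 1) / M k) (hdiv : ¬ Summable fun k => M k / M (k + 1))
    {F : ℕ → ℝ → E} {c : ℝ}
    (hF : ∀ k, ∀ x ∈ Icc 0 c, HasDerivWithinAt (F k) (F (k + 1) x) (Icc 0 c) x)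
    (hb : ∀ k, ∀ x ∈ Icc 0 c, ‖F k x‖ ≤ M k) (h0 : ∀ k, F k 0 = 0) {x : ℝ} (hx : x ∈ Icc 0 c) :
    F 0 x = 0 := by
  -- Over a length of `(e M (n + 1) / M n)⁻¹`, `bang_step` enlarges the factor `exp (-(n + 1))` to
  -- at most `exp (-n)`. Adding these lengths over `i` consecutive indices, `s n i` is a distance up
  -- to which the bounds with `exp (-n)` persist, all derivatives being zero at the origin.
  set s : ℕ → ℕ → ℝ := fun n i =>
    ∑ k ∈ Finset.Ico n (n + i), (Real.exp 1)⁻¹ * (M k / M (k + 1)) with hs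
  have key : ∀ i n, ∀ x ∈ Icc 0 c, x ≤ s n i → ∀ k,
      ‖F k x‖ ≤ Real.exp (-(n : ℕ)) * Real.exp k * M k := by
    intro i
    induction i with
    | zero =>
      intro n x hx hxs k
      have : x = 0 := le_antisymm (by simpa [hs] using hxs) hx.1
      rw [this, h0 k, norm_zero]
      have := (hM k).le
      positivity
    | succ i ih =>
      intro n x hx hxs k
      have hsum : s n (i + 1) = (Real.exp 1)⁻¹ * (M n / M (n + 1)) + s (n + 1) i := by
        simp only [hs]
        rw [Finset.sum_eq_sum_Ico_succ_bot (by omega), show n + (i + 1) = n + 1 + i by ring]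
      have hs0 : 0 ≤ s (n + 1) i := Finset.sum_nonneg fun k _ => by
        have := hM k
        have := hM (k + 1)
        positivity
      set y := min x (s (n + 1) i) with hy
      have hyc : y ∈ Icc 0 c := ⟨le_min hx.1 hs0, (min_le_left _ _).trans hx.2⟩
      have h1 := ih (n + 1) y hyc (min_le_right _ _)
      have hsub : Icc y c ⊆ Icc 0 c := Icc_subset_Icc_left hyc.1
      have h2 := bang_step hM hlc (F := F) (a := y) (c := c)
        (fun k z hz => (hF k z (hsub hz)).mono hsub) (fun k z hz => hb k z (hsub hz)) n le_rfl h1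
        (x := x) ⟨min_le_left _ _, hx.2⟩ k
      refine h2.trans ?_
      have h3 : Real.exp 1 * (M (n + 1) / M n) * (x - y) ≤ 1 := by
        have h4 : x - y ≤ (Real.exp 1)⁻¹ * (M n / M (n + 1)) := by
          rcases min_choice x (s (n + 1) i) with h | h
          · rw [hy, h, sub_self]
            have := hM n
            have := hM (n + 1)
            positivity
          · rw [hy, h]; linarith
        have h5 := hM n
        have h6 := hM (n + 1)
        calc Real.exp 1 * (M (n + 1) / M n) * (x - y)
            ≤ Real.exp 1 * (M (n + 1) / M n) * ((Real.exp 1)⁻¹ * (M n / M (n + 1))) := by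
              gcongr
          _ = 1 := by field_simp
      have h7 : Real.exp (-(n + 1 : ℕ)) * Real.exp (Real.exp 1 * (M (n + 1) / M n) * (x - y)) ≤
          Real.exp (-(n : ℕ)) := by
        rw [← Real.exp_add]
        apply Real.exp_le_exp.2
        push_cast
        linarith
      have := (hM k).le
      gcongr
  -- Divergence of the series makes every `x` reachable from every starting level `n`. Hence `‖F 0
  -- x‖ ≤ exp (-n) * M 0` for all `n`.
  have hunb : ∀ n, ∃ i, x ≤ s n i := by
    intro n
    have hpos : ∀ k, 0 ≤ M k / M (k + 1) := fun k => (div_pos (hM k) (hM (k + 1))).le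
    have h1 : ¬ Summable fun k => (Real.exp 1)⁻¹ * (M (n + k) / M (n + k + 1)) := by
      intro h
      apply hdiv
      have h2 := (summable_mul_left_iff (by positivity)).1 h
      refine (summable_nat_add_iff n).1 (h2.congr fun k => ?_)
      rw [add_comm n k]
    have h2 := (not_summable_iff_tendsto_nat_atTop_of_nonneg (fun k => by
      have := hpos (n + k)
      positivity)).1 h1
    obtain ⟨i, hi⟩ := (h2.eventually_ge_atTop x).exists
    refine ⟨i, hi.trans (le_of_eq ?_)⟩
    simp only [hs]
    rw [Finset.sum_Ico_eq_sum_range]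
    simp
  have hle : ∀ n : ℕ, ‖F 0 x‖ ≤ Real.exp (-(n : ℕ)) * (Real.exp (0 : ℕ) * M 0) := by
    intro n
    obtain ⟨i, hi⟩ := hunb n
    rw [← mul_assoc]
    exact key i n x hx hi 0
  have hlim : Tendsto (fun n : ℕ => Real.exp (-(n : ℕ)) * (Real.exp (0 : ℕ) * M 0)) atTop
      (𝓝 (0 * (Real.exp (0 : ℕ) * M 0))) :=
    ((Real.tendsto_exp_neg_atTop_nhds_zero.comp tendsto_natCast_atTop_atTop)).mul_const _
  rw [zero_mul] at hlim
  exact norm_le_zero_iff.1 (ge_of_tendsto' hlim hle)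

/-- A curve of quasianalytic class `{m}` that is flat at `0` vanishes. -/
theorem IsUltradifferentiableOn.eq_zero_of_flat {E : Type} [NormedAddCommGroup E]
    [NormedSpace ℝ E] {m : ℕ → ℝ} (hm : IsRegularWeightSequence m)
    (hq : IsQuasianalyticSequence m) {I : Set ℝ} (hI : IsOpen I) {f : ℝ → E}
    (hf : IsUltradifferentiableOn m f I) {c : ℝ} (hc : Icc 0 c ⊆ I)
    (h0 : ∀ k, iteratedDeriv k f 0 = 0) {x : ℝ} (hx : x ∈ Icc 0 c) : f x = 0 := by
  obtain ⟨C, h, hC, hh, hb⟩ := hf.2 _ hc isCompact_Icc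
  -- The reciprocals of these ratios are `h⁻¹` times the terms of the series in the definition of
  -- quasianalyticity.
  have hr : ∀ k, (C * h ^ (k + 1) * m (k + 1) * ((k + 1)! : ℝ)) / (C * h ^ k * m k * (k ! : ℝ)) =
      h * (m (k + 1) / m k) * (k + 1) := by
    intro k
    have := (hm.pos k).ne'
    have : (k ! : ℝ) ≠ 0 := by positivity
    rw [Nat.factorial_succ]
    push_cast
    field_simp
    ring
  have hpos : ∀ k, 0 < C * h ^ k * m k * (k ! : ℝ) := fun k => by
    have := hm.pos k
    positivity
  refine denjoyCarleman (M := fun k => C * h ^ k * m k * (k ! : ℝ)) hpos ?_ ?_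
    (F := fun k => iteratedDeriv k f) (c := c) ?_ ?_ h0 hx
  · intro a b hab
    simp only [hr]
    have := hm.ratio_monotone hab
    have h1 : 0 < m (a + 1) / m a := div_pos (hm.pos _) (hm.pos _)
    have h2 : 0 < m (b + 1) / m b := div_pos (hm.pos _) (hm.pos _)
    simp only at this
    gcongr
  · intro hs
    apply hq
    refine (summable_mul_left_iff (inv_pos.2 hh).ne').1 (hs.congr fun k => ?_)
    have h1 := hr k
    rw [← inv_div, h1]
    have := (hm.pos k).ne'
    have := (hm.pos (k + 1)).ne'
    field_simp
  · intro k y hy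
    have h1 : ContDiffAt ℝ (k + 1 : ℕ) f y :=
      (hf.contDiffAt hI (hc hy)).of_le (by exact_mod_cast le_top)
    have h2 : DifferentiableAt ℝ (iteratedDeriv k f) y :=
      (ContinuousMultilinearMap.apply ℝ (fun _ : Fin k => ℝ) E fun _ => 1).differentiableAt.comp y
        (h1.differentiableAt_iteratedFDeriv (by exact_mod_cast Nat.lt_succ_self k))
    show HasDerivWithinAt (iteratedDeriv k f) (iteratedDeriv (k + 1) f y) _ _
    rw [iteratedDeriv_succ]
    exact h2.hasDerivAt.hasDerivWithinAt
  · intro k y hy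
    show ‖iteratedDeriv k f y‖ ≤ _
    rw [← norm_iteratedFDeriv_eq_norm_iteratedDeriv]
    exact hb y hy k

end DenjoyCarleman

/-! ### Cutoffs and tools for ordinary differential equations -/

section Cutoff

variable {E F : Type*} [NormedAddCommGroup E] [NormedSpace ℝ E]
  [NormedAddCommGroup F] [NormedSpace ℝ F]

theorem exists_cutoff [FiniteDimensional ℝ E] (p : E) {R : ℝ} (hR : 0 < R) :
    ∃ χ : E → ℝ, ContDiff ℝ ∞ χ ∧ HasCompactSupport χ ∧
      tsupport χ ⊆ Metric.closedBall p (2 * R) ∧ ∀ x ∈ Metric.closedBall p R, χ x = 1 := by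
  let b : ContDiffBump p := ⟨R, 2 * R, hR, by linarith⟩
  exact ⟨b, b.contDiff, b.hasCompactSupport, b.tsupport_eq.subset, fun x hx =>
    b.one_of_mem_closedBall hx⟩

theorem contDiff_cutoff_smul {χ : E → ℝ} (hχ : ContDiff ℝ ∞ χ) {U : Set E} (hU : IsOpen U)
    (hs : tsupport χ ⊆ U) {f : E → F} (hf : ContDiffOn ℝ ∞ f U) :
    ContDiff ℝ ∞ fun x => χ x • f x := by
  refine contDiff_iff_contDiffAt.2 fun x => ?_
  by_cases hx : x ∈ tsupport χ
  · exact hχ.contDiffAt.smul (hf.contDiffAt (hU.mem_nhds (hs hx)))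
  · have h0 : (fun x => χ x • f x) =ᶠ[𝓝 x] fun _ => 0 := by
      filter_upwards [notMem_tsupport_iff_eventuallyEq.1 hx] with y hy
      simp [hy]
    exact contDiffAt_const.congr_of_eventuallyEq h0

/-- A smooth map agrees near a point with one that is globally Lipschitz and bounded together with
its derivative. -/
theorem exists_global_bounds {f : E → F} (hf : ContDiff ℝ ∞ f) (hc : HasCompactSupport f) :
    ∃ K : NNReal, LipschitzWith K f ∧ LipschitzWith K (fderiv ℝ f) ∧ (∀ x, ‖f x‖ ≤ K) ∧
      ∀ x, ‖fderiv ℝ f x‖ ≤ K := by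
  have hf' : ContDiff ℝ ∞ (fderiv ℝ f) := hf.fderiv_right (by simp)
  obtain ⟨K₁, h₁⟩ := hf.lipschitzWith_of_hasCompactSupport hc (by simp)
  obtain ⟨K₂, h₂⟩ := hf'.lipschitzWith_of_hasCompactSupport (hc.fderiv ℝ) (by simp)
  obtain ⟨L, hL⟩ := hc.exists_bound_of_continuous hf.continuous
  have hL0 : 0 ≤ L := (norm_nonneg _).trans (hL 0)
  lift L to NNReal using hL0
  refine ⟨max (max K₁ K₂) L, h₁.weaken ((le_max_left _ _).trans (le_max_left _ _)),
    h₂.weaken ((le_max_right _ _).trans (le_max_left _ _)),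
    fun x => (hL x).trans (NNReal.coe_le_coe.2 (le_max_right _ _)), fun x => ?_⟩
  exact (norm_fderiv_le_of_lipschitz ℝ h₁).trans
    (NNReal.coe_le_coe.2 ((le_max_left _ _).trans (le_max_left _ _)))

end Cutoff

section ODETools

variable {E F : Type*} [NormedAddCommGroup E] [NormedSpace ℝ E]
  [NormedAddCommGroup F] [NormedSpace ℝ F]

theorem norm_sub_sub_le_of_lipschitz_fderiv {f : E → F} (hf : Differentiable ℝ f) {K : NNReal}
    (hK : LipschitzWith K (fderiv ℝ f)) (a b c : E) :
    ‖f a - f b - fderiv ℝ f c (a - b)‖ ≤ K * max ‖a - c‖ ‖b - c‖ * ‖a - b‖ := by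
  set ρ := max ‖a - c‖ ‖b - c‖
  refine Convex.norm_image_sub_le_of_norm_fderiv_le' (s := Metric.closedBall c ρ)
    (fun x _ => hf x) (fun x hx => ?_) (convex_closedBall c ρ) ?_ ?_
  · refine (hK.norm_sub_le x c).trans ?_
    gcongr
    simpa [dist_eq_norm] using hx
  · simp [dist_eq_norm, ρ]
  · simp [dist_eq_norm, ρ]

/-- Global existence on bounded time intervals for bounded Lipschitz vector fields. -/
theorem exists_solution_of_lipschitz [CompleteSpace E] {f : E → E} {K L : NNReal}
    (hK : LipschitzWith K f) (hL : ∀ x, ‖f x‖ ≤ L) (T : NNReal) (x : E) :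
    ∃ γ : ℝ → E, γ 0 = x ∧ ∀ t ∈ Ioo (-(T : ℝ)) T, HasDerivAt γ (f (γ t)) t := by
  have hpl : IsPicardLindelof (fun _ => f) (tmin := -(T : ℝ)) (tmax := T) ⟨0, by simp⟩ x
      (L * T) 0 L K :=
    IsPicardLindelof.of_time_independent (fun x _ => hL x) hK.lipschitzOnWith (by simp)
  obtain ⟨γ, h0, h⟩ := hpl.exists_eq_forall_mem_Icc_hasDerivWithinAt₀
  exact ⟨γ, h0, fun t ht => (h t (Ioo_subset_Icc_self ht)).hasDerivAt (Icc_mem_nhds ht.1 ht.2)⟩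

theorem gronwallBound_zero_left (K ε x : ℝ) :
    gronwallBound 0 K ε x = ε * gronwallBound 0 K 1 x := by
  by_cases hK : K = 0
  · simp [hK, gronwallBound_K0]
  · simp only [gronwallBound_of_K_ne_0 hK]; ring

/-- Mean value inequality for curves through a point, in both time directions. -/
theorem norm_curve_sub_le {γ γ' : ℝ → E} {T C : ℝ}
    (h : ∀ t ∈ Ioo (-T) T, HasDerivAt γ (γ' t) t) (hC : ∀ t ∈ Ioo (-T) T, ‖γ' t‖ ≤ C)
    {s t : ℝ} (hs : s ∈ Ioo (-T) T) (ht : t ∈ Ioo (-T) T) : ‖γ t - γ s‖ ≤ C * |t - s| :=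
  Convex.norm_image_sub_le_of_norm_hasDerivWithin_le (fun u hu => (h u hu).hasDerivWithinAt) hC
    (convex_Ioo _ _) hs ht

end ODETools

/-! ### Integration of `Dw = Z ∘ w` along rays -/

section Leaf

variable {E T : Type*} [NormedAddCommGroup E] [NormedSpace ℝ E] [FiniteDimensional ℝ E]
  [NormedAddCommGroup T] [NormedSpace ℝ T]

/-- **Frobenius theorem along rays**: the total differential equation `Dw = Z ∘ w` is solvable if
the integrability condition holds along the integral curves of the fields `Z v` through `p`. -/
theorem exists_total_solution {U : Set E} (hU : IsOpen U) {p : E} (hp : p ∈ U)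
    {Z : E → T →L[ℝ] E} (hZ : ContDiffOn ℝ ∞ Z U)
    (hcurv : ∀ (v : T) (γ : ℝ → E), γ 0 = p →
      (∀ s ∈ Ioo (-2 : ℝ) 2, γ s ∈ U ∧ HasDerivAt γ (Z (γ s) v) s) →
      ∀ s ∈ Icc (0 : ℝ) 1, ∀ a b : T,
        fderiv ℝ Z (γ s) (Z (γ s) a) b = fderiv ℝ Z (γ s) (Z (γ s) b) a) :
    ∃ r : ℝ, 0 < r ∧ ∃ w : T → E, w 0 = p ∧ ∀ v ∈ Metric.ball (0 : T) r,
      HasFDerivAt w (Z (w v)) v ∧ ∃ γ : ℝ → E, γ 0 = p ∧ γ 1 = w v ∧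
        ∀ s ∈ Ioo (-2 : ℝ) 2, γ s ∈ U ∧ HasDerivAt γ (Z (γ s) v) s := by
  have : CompleteSpace E := FiniteDimensional.complete ℝ E
  obtain ⟨R, hR, hRU⟩ : ∃ R > 0, Metric.closedBall p (2 * R) ⊆ U := by
    obtain ⟨R, hR, hRU⟩ := Metric.nhds_basis_closedBall.mem_iff.1 (hU.mem_nhds hp)
    exact ⟨R / 2, by positivity, by rwa [mul_div_cancel₀ _ two_ne_zero]⟩
  -- The cut-off field is bounded and globally Lipschitz, so all its integral curves exist on `(-2,
  -- 2)`. For small `v` they stay where the cutoff is `1`.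
  obtain ⟨χ, hχ, hχc, hχs, hχ1⟩ := exists_cutoff p hR
  set Y : E → T →L[ℝ] E := fun x => χ x • Z x with hY
  have hYc : ContDiff ℝ ∞ Y := contDiff_cutoff_smul hχ hU (hχs.trans hRU) hZ
  have hYs : HasCompactSupport Y := hχc.smul_right
  obtain ⟨K, hK1, hK2, hK3, hK4⟩ := exists_global_bounds hYc hYs
  have hYZ : ∀ x ∈ Metric.ball p R, Y x = Z x := fun x hx => by
    simp [hY, hχ1 x (Metric.ball_subset_closedBall hx)]
  have hdYZ : ∀ x ∈ Metric.ball p R, fderiv ℝ Y x = fderiv ℝ Z x := fun x hx => by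
    apply Filter.EventuallyEq.fderiv_eq
    filter_upwards [Metric.isOpen_ball.mem_nhds hx] with y hy using hYZ y hy
  have hsol : ∀ v : T, ∃ γ : ℝ → E, γ 0 = p ∧
      ∀ s ∈ Ioo (-2 : ℝ) 2, HasDerivAt γ (Y (γ s) v) s := by
    intro v
    refine exists_solution_of_lipschitz (f := fun x => Y x v) (K := K * ‖v‖₊) (L := K * ‖v‖₊)
      (LipschitzWith.of_dist_le_mul fun x y => ?_) (fun x => ?_) 2 p
    · rw [dist_eq_norm, ← sub_apply]
      refine (ContinuousLinearMap.le_opNorm _ _).trans ?_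
      have := hK1.norm_sub_le x y
      rw [dist_eq_norm]
      push_cast
      calc ‖Y x - Y y‖ * ‖v‖ ≤ (K * ‖x - y‖) * ‖v‖ := by gcongr
        _ = _ := by ring
    · refine (ContinuousLinearMap.le_opNorm _ _).trans ?_
      push_cast
      gcongr
      exact hK3 x
  choose γ hγ0 hγ using hsol
  -- The speed is at most `K * ‖v‖` and time is at most `2`, so `2 (K + 1) ‖v‖ < R` keeps curves in
  -- the ball. The bound by `1` later disposes of the factor `‖v + h‖`.
  set r : ℝ := min 1 (R / (2 * (K + 1))) with hr
  have hr0 : 0 < r := lt_min one_pos (by positivity)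
  have hmem : ∀ v ∈ Metric.ball (0 : T) r, ∀ s ∈ Ioo (-2 : ℝ) 2, γ v s ∈ Metric.ball p R := by
    intro v hv s hs
    have hv' : ‖v‖ < R / (2 * (K + 1)) := (mem_ball_zero_iff.1 hv).trans_le (min_le_right _ _)
    have h1 := norm_curve_sub_le (hγ v) (C := K * ‖v‖) (fun t _ =>
      (ContinuousLinearMap.le_opNorm _ _).trans (by gcongr; exact hK3 _))
      (s := 0) (by norm_num) hs
    rw [hγ0, sub_zero] at h1
    rw [mem_ball_iff_norm]
    have h2 : |s| ≤ 2 := (abs_lt.2 hs).le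
    rw [lt_div_iff₀ (by positivity)] at hv'
    calc ‖γ v s - p‖ ≤ K * ‖v‖ * 2 := h1.trans (by gcongr)
      _ ≤ ‖v‖ * (2 * (K + 1)) := by nlinarith [norm_nonneg v]
      _ < R := hv'
  have hγU : ∀ v ∈ Metric.ball (0 : T) r, ∀ s ∈ Ioo (-2 : ℝ) 2,
      γ v s ∈ U ∧ HasDerivAt (γ v) (Z (γ v s) v) s := by
    intro v hv s hs
    have hb := hmem v hv s hs
    refine ⟨hRU (Metric.closedBall_subset_closedBall (by linarith)
      (Metric.ball_subset_closedBall hb)), ?_⟩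
    rw [← hYZ _ hb]
    exact hγ v s hs
  have hcY : ∀ v ∈ Metric.ball (0 : T) r, ∀ s ∈ Icc (0 : ℝ) 1, ∀ a b : T,
      fderiv ℝ Y (γ v s) (Y (γ v s) a) b = fderiv ℝ Y (γ v s) (Y (γ v s) b) a := by
    intro v hv s hs a b
    have hb := hmem v hv s ⟨by linarith [hs.1], by linarith [hs.2]⟩
    rw [hdYZ _ hb, hYZ _ hb]
    exact hcurv v (γ v) (hγ0 v) (hγU v hv) s hs a b
  refine ⟨r, hr0, fun v => γ v 1, ?_, fun v hv => ⟨?_, γ v, hγ0 v, rfl, hγU v hv⟩⟩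
  · have h1 := norm_curve_sub_le (hγ 0) (C := 0) (fun t _ => by simp)
      (s := 0) (t := 1) (by norm_num) (by norm_num)
    rw [hγ0, zero_mul] at h1
    exact sub_eq_zero.1 (norm_le_zero_iff.1 h1)
  · rw [← hYZ _ (hmem v hv 1 (by norm_num)), hasFDerivAt_iff_isLittleO_nhds_zero]
    set C : ℝ := gronwallBound 0 K 1 1 with hC
    have hbound : ∀ᶠ h in 𝓝 (0 : T),
        ‖γ (v + h) 1 - γ v 1 - Y (γ v 1) h‖ ≤ ((K * K ^ 2 + K * K) * C) * ‖‖h‖ ^ 2‖ := by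
      have hev : ∀ᶠ h in 𝓝 (0 : T), v + h ∈ Metric.ball (0 : T) r := by
        have : Tendsto (fun h : T => v + h) (𝓝 0) (𝓝 v) := by
          simpa using (continuous_const_add v).tendsto (0 : T)
        exact this.eventually (Metric.isOpen_ball.mem_nhds hv)
      filter_upwards [hev] with h hvh
      have hvh1 : ‖v + h‖ ≤ 1 :=
        ((mem_ball_zero_iff.1 hvh).trans_le (min_le_left _ _)).le
      set A : ℝ → E := γ v
      set B : ℝ → E := γ (v + h)
      -- The first-order guess for the curve with parameter `v + h`. Its error will be `O(‖h‖ ^ 2)`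
      -- by Gronwall, and at `s = 1` this is differentiability of `w` with derivative `Y (A 1)`.
      set η : ℝ → E := fun s => A s + s • Y (A s) h with hη
      have hηd : ∀ s ∈ Ioo (-2 : ℝ) 2, HasDerivAt η
          (Y (A s) v + (s • fderiv ℝ Y (A s) (Y (A s) v) h + Y (A s) h)) s := by
        intro s hs
        have h1 := hγ v s hs
        have h2 : HasDerivAt (fun s => Y (A s)) (fderiv ℝ Y (A s) (Y (A s) v)) s :=
          (hYc.differentiable (by simp) (A s)).hasFDerivAt.comp_hasDerivAt s h1
        have h3 : HasDerivAt (fun s => Y (A s) h) (fderiv ℝ Y (A s) (Y (A s) v) h) s := by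
          simpa using h2.clm_apply (hasDerivAt_const s h)
        have h4 := (hasDerivAt_id s).smul h3
        convert! h1.add h4 using 1
        simp [A]
      have hδd : ∀ s ∈ Ioo (-2 : ℝ) 2, HasDerivAt (fun s => B s - η s) (Y (B s) (v + h) -
          (Y (A s) v + (s • fderiv ℝ Y (A s) (Y (A s) v) h + Y (A s) h))) s := fun s hs =>
        (hγ (v + h) s hs).sub (hηd s hs)
      have hsub : Icc (0 : ℝ) 1 ⊆ Ioo (-2) 2 := fun s hs =>
        ⟨by linarith [hs.1], by linarith [hs.2]⟩
      have hG := norm_le_gronwallBound_of_norm_deriv_right_le (δ := 0) (K := K)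
        (ε := (K * K ^ 2 + K * K) * ‖h‖ ^ 2)
        (fun s hs => (hδd s (hsub hs)).continuousAt.continuousWithinAt)
        (fun s hs => (hδd s (hsub (Ico_subset_Icc_self hs))).hasDerivWithinAt)
        (by simp [hη, A, B, hγ0]) (fun s hs => ?_) 1 (right_mem_Icc.2 zero_le_one)
      · rw [sub_zero, gronwallBound_zero_left, ← hC] at hG
        have : B 1 - η 1 = B 1 - A 1 - Y (A 1) h := by simp [hη, sub_sub]
        rw [this] at hG
        refine hG.trans (le_of_eq ?_)
        rw [norm_pow, norm_norm]
        ring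
      · have hs' : s ∈ Icc (0 : ℝ) 1 := Ico_subset_Icc_self hs
        -- The integrability condition exchanges `v` and `h`. The exchanged term belongs to the
        -- Taylor expansion of `Y` at `A s` in the direction `η s - A s`; without the exchange a
        -- remainder linear in `h` would survive.
        have hc := hcY v hv s hs' v h
        change fderiv ℝ Y (A s) (Y (A s) v) h = fderiv ℝ Y (A s) (Y (A s) h) v at hc
        rw [hc]
        have hdec : Y (B s) (v + h) -
            (Y (A s) v + (s • fderiv ℝ Y (A s) (Y (A s) h) v + Y (A s) h)) =
            (Y (B s) - Y (η s)) (v + h) +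
            (Y (η s) - Y (A s) - fderiv ℝ Y (A s) (η s - A s)) (v + h) +
            s • fderiv ℝ Y (A s) (Y (A s) h) h := by
          simp only [hη, add_sub_cancel_left, sub_apply, map_add, map_smul,
            smul_apply]
          abel
        rw [hdec]
        have hηA : ‖η s - A s‖ ≤ K * ‖h‖ := by
          simp only [hη, add_sub_cancel_left, norm_smul]
          calc ‖s‖ * ‖Y (A s) h‖ ≤ 1 * (K * ‖h‖) := by
                gcongr
                · rw [Real.norm_eq_abs, abs_of_nonneg hs'.1]; exact hs'.2
                · exact (ContinuousLinearMap.le_opNorm _ _).trans (by gcongr; exact hK3 _)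
            _ = _ := one_mul _
        have e1 : ‖(Y (B s) - Y (η s)) (v + h)‖ ≤ K * ‖B s - η s‖ := by
          calc _ ≤ ‖Y (B s) - Y (η s)‖ * ‖v + h‖ := ContinuousLinearMap.le_opNorm _ _
            _ ≤ (K * ‖B s - η s‖) * 1 := by
              gcongr
              exact hK1.norm_sub_le _ _
            _ = _ := mul_one _
        have e2 : ‖(Y (η s) - Y (A s) - fderiv ℝ Y (A s) (η s - A s)) (v + h)‖ ≤
            K * K ^ 2 * ‖h‖ ^ 2 := by
          have e3 := norm_sub_sub_le_of_lipschitz_fderiv (hYc.differentiable (by simp)) hK2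
            (η s) (A s) (A s)
          rw [sub_self, norm_zero, max_eq_left (norm_nonneg _)] at e3
          calc _ ≤ ‖Y (η s) - Y (A s) - fderiv ℝ Y (A s) (η s - A s)‖ * ‖v + h‖ :=
                ContinuousLinearMap.le_opNorm _ _
            _ ≤ (K * ‖η s - A s‖ * ‖η s - A s‖) * 1 := by gcongr
            _ ≤ (K * (K * ‖h‖) * (K * ‖h‖)) * 1 := by gcongr
            _ = _ := by ring
        have e4 : ‖s • fderiv ℝ Y (A s) (Y (A s) h) h‖ ≤ K * K * ‖h‖ ^ 2 := by
          rw [norm_smul]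
          calc ‖s‖ * ‖fderiv ℝ Y (A s) (Y (A s) h) h‖ ≤ 1 * ((K * (K * ‖h‖)) * ‖h‖) := by
                gcongr
                · rw [Real.norm_eq_abs, abs_of_nonneg hs'.1]; exact hs'.2
                · refine (ContinuousLinearMap.le_opNorm _ _).trans ?_
                  gcongr
                  refine (ContinuousLinearMap.le_opNorm _ _).trans ?_
                  gcongr
                  · exact hK4 _
                  · exact (ContinuousLinearMap.le_opNorm _ _).trans (by gcongr; exact hK3 _)
            _ = _ := by ring
        refine (norm_add₃_le).trans ?_
        linarith
    exact (Asymptotics.IsBigO.of_bound _ hbound).trans_isLittleO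
      (Asymptotics.isLittleO_norm_pow_id one_lt_two)

end Leaf

/-! ### Nagano's theorem in a quasianalytic class -/

section Nagano

variable {E : Type} [NormedAddCommGroup E] [NormedSpace ℝ E]

/-- The module over the smooth functions on `V` generated by a set `L` of vector fields. -/
inductive InFieldModule (L : Set (E → E)) (V : Set E) : (E → E) → Prop
  | zero : InFieldModule L V fun _ => 0
  | smul (f : E → ℝ) (X : E → E) : ContDiffOn ℝ ∞ f V → X ∈ L →
      InFieldModule L V fun x => f x • X x
  | add (X Y : E → E) : InFieldModule L V X → InFieldModule L V Y →
      InFieldModule L V fun x => X x + Y x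
  | congr (X Y : E → E) : InFieldModule L V X → (∀ x ∈ V, Y x = X x) → InFieldModule L V Y

namespace InFieldModule

variable {L : Set (E → E)} {V : Set E}

theorem contDiffOn (hL : ∀ X ∈ L, ContDiffOn ℝ ∞ X V) {X : E → E} (hX : InFieldModule L V X) :
    ContDiffOn ℝ ∞ X V := by
  induction hX with
  | zero => exact contDiffOn_const
  | smul f X hf hX => exact hf.smul (hL X hX)
  | add X Y _ _ ihX ihY => exact ihX.add ihY
  | congr X Y _ h ih => exact ih.congr h

theorem mem {X : E → E} (hX : InFieldModule L V X) {p : E} (hp : p ∈ V) {T : Submodule ℝ E}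
    (hT : ∀ X ∈ L, X p ∈ T) : X p ∈ T := by
  induction hX with
  | zero => exact T.zero_mem
  | smul f X hf hX => exact T.smul_mem _ (hT X hX)
  | add X Y _ _ ihX ihY => exact T.add_mem ihX ihY
  | congr X Y _ h ih => rw [h p hp]; exact ih

theorem sum {ι : Type*} (s : Finset ι) {X : ι → E → E} (hX : ∀ i ∈ s, InFieldModule L V (X i)) :
    InFieldModule L V fun x => ∑ i ∈ s, X i x := by
  classical
  induction s using Finset.induction_on with
  | empty => simpa using zero
  | insert i s hi ih =>
    simp only [Finset.sum_insert hi]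
    exact add _ _ (hX i (Finset.mem_insert_self i s))
      (ih fun j hj => hX j (Finset.mem_insert_of_mem hj))

theorem smul' {X : E → E} (hX : InFieldModule L V X) {f : E → ℝ} (hf : ContDiffOn ℝ ∞ f V) :
    InFieldModule L V fun x => f x • X x := by
  induction hX with
  | zero => simpa using zero
  | smul g X hg hX => simpa only [smul_smul] using smul _ X (hf.mul hg) hX
  | add X Y _ _ ihX ihY => simpa only [smul_add] using add _ _ ihX ihY
  | congr X Y _ h ih => exact congr _ _ ih fun x hx => by rw [h x hx]

/-- By induction this reduces to `[f X, g Y] = f g [X, Y] + f X(g) Y - g Y(f) X`. Smooth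
coefficients are enough here, because class `{m}` regularity is needed only for the particular
fields to which Denjoy–Carleman is applied. -/
theorem lieBracket (hV : IsOpen V) (hL : ∀ X ∈ L, ContDiffOn ℝ ∞ X V)
    (hLL : ∀ X ∈ L, ∀ Y ∈ L, VectorField.lieBracket ℝ X Y ∈ L) {X Y : E → E}
    (hX : InFieldModule L V X) (hY : InFieldModule L V Y) :
    InFieldModule L V (VectorField.lieBracket ℝ X Y) := by
  have hd : ∀ {F : Type} [NormedAddCommGroup F] [NormedSpace ℝ F] {f : E → F},
      ContDiffOn ℝ ∞ f V → ∀ x ∈ V, DifferentiableAt ℝ f x := fun hf x hx =>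
    (hf.contDiffAt (hV.mem_nhds hx)).differentiableAt (by simp)
  have hev : ∀ {X X' : E → E}, (∀ x ∈ V, X' x = X x) → ∀ x ∈ V, X' =ᶠ[𝓝 x] X :=
    fun h x hx => by filter_upwards [hV.mem_nhds hx] with y hy using h y hy
  have hdir : ∀ {f : E → ℝ} {X : E → E}, ContDiffOn ℝ ∞ f V → ContDiffOn ℝ ∞ X V →
      ContDiffOn ℝ ∞ (fun x => fderiv ℝ f x (X x)) V := fun hf hX =>
    (hf.fderiv_of_isOpen hV (m := ∞) (by simp)).clm_apply hX
  induction hX with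
  | zero =>
    refine congr _ _ zero fun x _ => ?_
    have : (fun _ : E => (0 : E)) = 0 := rfl
    rw [this, VectorField.lieBracket_zero_left]; rfl
  | add X X' hX hX' ih ih' =>
    refine congr _ _ (add _ _ ih ih') fun x hx => ?_
    exact VectorField.lieBracket_add_left (hd (hX.contDiffOn hL) x hx)
      (hd (hX'.contDiffOn hL) x hx)
  | congr X X' _ h ih =>
    refine congr _ _ ih fun x hx => ?_
    exact (hev h x hx).lieBracket_vectorField_eq EventuallyEq.rfl
  | smul f X hf hX =>
    induction hY with
    | zero =>
      refine congr _ _ zero fun x _ => ?_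
      have : (fun _ : E => (0 : E)) = 0 := rfl
      rw [this, VectorField.lieBracket_zero_right]; rfl
    | add Y Y' hY hY' ih ih' =>
      refine congr _ _ (add _ _ ih ih') fun x hx => ?_
      exact VectorField.lieBracket_add_right (hd (hY.contDiffOn hL) x hx)
        (hd (hY'.contDiffOn hL) x hx)
    | congr Y Y' _ h ih =>
      refine congr _ _ ih fun x hx => ?_
      exact EventuallyEq.rfl.lieBracket_vectorField_eq (hev h x hx)
    | smul g Y hg hY =>
      have hfX : ContDiffOn ℝ ∞ (fun x => f x • X x) V := hf.smul (hL X hX)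
      refine congr _ _ (add _ _ (smul _ Y (hdir hg hfX) hY)
        (smul' (add _ _ (smul (fun x => -fderiv ℝ f x (Y x)) X (hdir hf (hL Y hY)).neg hX)
          (smul f _ hf (hLL X hX Y hY))) hg)) fun x hx => ?_
      rw [VectorField.lieBracket_smul_right (hd hg x hx) (hd (hL Y hY) x hx),
        VectorField.lieBracket_smul_left (hd hf x hx) (hd (hL X hX) x hx)]

end InFieldModule

/-- If a field `Y` of the module satisfies `π Y = 0`, then `Y` is flat along the integral curves
through `p` of a field `X` of the module with `π X` constant. -/
theorem InFieldModule.iteratedFDeriv_comp_curve_eq_zero {L : Set (E → E)} {V : Set E}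
    (hV : IsOpen V) (hL : ∀ X ∈ L, ContDiffOn ℝ ∞ X V)
    (hLL : ∀ X ∈ L, ∀ Y ∈ L, VectorField.lieBracket ℝ X Y ∈ L) {p : E} {T : Submodule ℝ E}
    (hT : ∀ X ∈ L, X p ∈ T) {π : E →L[ℝ] T} (hπ : ∀ v : T, π v = v)
    {X : E → E} (hX : InFieldModule L V X) {v : T} (hXv : ∀ x ∈ V, π (X x) = v) {γ : ℝ → E}
    (hγ0 : γ 0 = p) (hγ : ∀ s ∈ Ioo (-2 : ℝ) 2, γ s ∈ V ∧ HasDerivAt γ (X (γ s)) s)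
    (n : ℕ) : ∀ Y : E → E, InFieldModule L V Y → (∀ x ∈ V, π (Y x) = 0) →
      iteratedFDeriv ℝ n (fun s => Y (γ s)) 0 = 0 := by
  have h0 : (0 : ℝ) ∈ Ioo (-2 : ℝ) 2 := by norm_num
  have hpV : p ∈ V := hγ0 ▸ (hγ 0 h0).1
  have hXc := hX.contDiffOn hL
  have hγc : ContDiffOn ℝ ∞ γ (Ioo (-2 : ℝ) 2) := by
    rw [contDiffOn_infty]
    intro n
    induction n with
    | zero => exact contDiffOn_zero.2 fun s hs => (hγ s hs).2.continuousAt.continuousWithinAt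
    | succ n ih =>
      push_cast
      rw [contDiffOn_succ_iff_deriv_of_isOpen isOpen_Ioo]
      refine ⟨fun s hs => (hγ s hs).2.differentiableAt.differentiableWithinAt, by simp, ?_⟩
      refine ContDiffOn.congr (f := fun s => X (γ s)) ?_ fun s hs => (hγ s hs).2.deriv
      exact (hXc.of_le (by exact_mod_cast le_top)).comp ih fun s hs => (hγ s hs).1
  induction n using Nat.strong_induction_on with
  | _ n ih =>
    intro Y hY hπY
    have hYc := hY.contDiffOn hL
    rcases n with _ | n
    -- Order zero: the value at `p` lies in `T`, where `π` is the identity, so `π Y = 0` forces `Y p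
    -- = 0`.
    · have h1 : Y p ∈ T := hY.mem hpV hT
      have h2 : Y p = 0 := by
        have h3 := hπ ⟨Y p, h1⟩
        rw [hπY p hpV] at h3
        exact (congrArg Subtype.val h3).symm
      ext
      simp [hγ0, h2]
    · set W := VectorField.lieBracket ℝ X Y with hW
      have hWm : InFieldModule L V W := hX.lieBracket hV hL hLL hY
      have hdY : ∀ x ∈ V, HasFDerivAt Y (fderiv ℝ Y x) x := fun x hx =>
        ((hYc.contDiffAt (hV.mem_nhds hx)).differentiableAt (by simp)).hasFDerivAt
      have hdX : ∀ x ∈ V, HasFDerivAt X (fderiv ℝ X x) x := fun x hx =>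
        ((hXc.contDiffAt (hV.mem_nhds hx)).differentiableAt (by simp)).hasFDerivAt
      -- Both `π X` and `π Y` are constant, so `π` annihilates both terms of the bracket.
      have hWπ : ∀ x ∈ V, π (W x) = 0 := by
        intro x hx
        have h1 : HasFDerivAt (fun y => π (Y y)) (π.comp (fderiv ℝ Y x)) x :=
          π.hasFDerivAt.comp x (hdY x hx)
        have h2 : HasFDerivAt (fun y => π (Y y)) (0 : E →L[ℝ] T) x :=
          (hasFDerivAt_const (0 : T) x).congr_of_eventuallyEq
            (by filter_upwards [hV.mem_nhds hx] with y hy using hπY y hy)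
        have h3 : HasFDerivAt (fun y => π (X y)) (π.comp (fderiv ℝ X x)) x :=
          π.hasFDerivAt.comp x (hdX x hx)
        have h4 : HasFDerivAt (fun y => π (X y)) (0 : E →L[ℝ] T) x :=
          (hasFDerivAt_const v x).congr_of_eventuallyEq
            (by filter_upwards [hV.mem_nhds hx] with y hy using hXv y hy)
        have h5 : π (fderiv ℝ Y x (X x)) = 0 := by
          simpa using congrArg (fun A : E →L[ℝ] T => A (X x)) (h1.unique h2)
        have h6 : π (fderiv ℝ X x (Y x)) = 0 := by
          simpa using congrArg (fun A : E →L[ℝ] T => A (Y x)) (h3.unique h4)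
        rw [hW, VectorField.lieBracket_eq]
        simp [h5, h6]
      set B : ℝ → E →L[ℝ] E := fun s => fderiv ℝ X (γ s) with hB
      have hBc : ContDiffOn ℝ ∞ B (Ioo (-2 : ℝ) 2) :=
        (hXc.fderiv_of_isOpen hV (m := ∞) (by simp)).comp hγc fun s hs => (hγ s hs).1
      have hfc : ContDiffOn ℝ ∞ (fun s => Y (γ s)) (Ioo (-2 : ℝ) 2) :=
        hYc.comp hγc fun s hs => (hγ s hs).1
      have hgc : ContDiffOn ℝ ∞ (fun s => W (γ s)) (Ioo (-2 : ℝ) 2) :=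
        (hWm.contDiffOn hL).comp hγc fun s hs => (hγ s hs).1
      -- Along the curve, `(Y ∘ γ)' = [X, Y] ∘ γ + (DX ∘ γ) (Y ∘ γ)`. The first term is covered by
      -- the induction hypothesis for the field `W`, the second by that for `Y` at all lower orders
      -- through the Leibniz rule.
      have hder : deriv (fun s => Y (γ s)) =ᶠ[𝓝 0]
          (fun s => W (γ s)) + fun s => B s (Y (γ s)) := by
        filter_upwards [isOpen_Ioo.mem_nhds h0] with s hs
        have h1 : HasDerivAt (fun s => Y (γ s)) (fderiv ℝ Y (γ s) (X (γ s))) s :=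
          (hdY _ (hγ s hs).1).comp_hasDerivAt s (hγ s hs).2
        rw [h1.deriv, Pi.add_apply, hW, VectorField.lieBracket_eq]
        simp [hB]
      rw [← norm_eq_zero, norm_iteratedFDeriv_eq_norm_iteratedDeriv, iteratedDeriv_succ',
        ← norm_iteratedFDeriv_eq_norm_iteratedDeriv, (hder.iteratedFDeriv ℝ n).eq_of_nhds]
      have hnhds := isOpen_Ioo.mem_nhds h0
      rw [iteratedFDeriv_add_apply
        ((hgc.contDiffAt hnhds).of_le (by exact_mod_cast le_top))
        (((hBc.clm_apply hfc).contDiffAt hnhds).of_le (by exact_mod_cast le_top)),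
        ih n (Nat.lt_succ_self n) W hWm hWπ, zero_add]
      refine le_antisymm ?_ (norm_nonneg _)
      refine (IsUltradifferentiableOn.norm_iteratedFDeriv_bilinear_le isOpen_Ioo hBc hfc
        (ContinuousLinearMap.id ℝ (E →L[ℝ] E)) h0 n).trans (le_of_eq ?_)
      rw [Finset.sum_eq_zero, mul_zero]
      intro i _
      rw [ih (n - i) (by omega) Y hY hπY, norm_zero, mul_zero]

end Nagano

namespace IsUltradifferentiableOn

theorem sum {E F : Type} [NormedAddCommGroup E] [NormedSpace ℝ E] [NormedAddCommGroup F]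
    [NormedSpace ℝ F] {m : ℕ → ℝ} {U : Set E} (hm : IsRegularWeightSequence m) (hU : IsOpen U)
    {ι : Type*} (s : Finset ι) {f : ι → E → F}
    (hf : ∀ i ∈ s, IsUltradifferentiableOn m (f i) U) :
    IsUltradifferentiableOn m (fun x => ∑ i ∈ s, f i x) U := by
  classical
  induction s using Finset.induction_on with
  | empty => simpa using const hm (0 : F)
  | insert i s hi ih =>
    simp only [Finset.sum_insert hi]
    exact (hf i (Finset.mem_insert_self i s)).add hm
      (ih fun j hj => hf j (Finset.mem_insert_of_mem hj)) hU

end IsUltradifferentiableOn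

section Nagano

variable {E : Type} [NormedAddCommGroup E] [NormedSpace ℝ E] [FiniteDimensional ℝ E]

/-- Fields of class `{m}` and of the module generated by `L` that are normalized by `π Z = id`. -/
theorem exists_normalized_frame {m : ℕ → ℝ} (hm : IsRegularWeightSequence m) {U : Set E}
    (hU : IsOpen U) {p : E} (hp : p ∈ U) {L : Set (E → E)}
    (hL : ∀ X ∈ L, IsUltradifferentiableOn m X U) {T : Submodule ℝ E}
    (hTL : ∀ v ∈ T, ∃ X ∈ L, X p = v) {π : E →L[ℝ] T} (hπ : ∀ v : T, π v = v) :
    ∃ V : Set E, IsOpen V ∧ p ∈ V ∧ V ⊆ U ∧ ∃ Z : E → T →L[ℝ] E,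
      IsUltradifferentiableOn m Z V ∧ (∀ x ∈ V, ∀ v, π (Z x v) = v) ∧
      (∀ c : E → T, ContDiffOn ℝ ∞ c V → InFieldModule L V fun x => Z x (c x)) ∧
      ∀ x ∈ V, ∀ v, Z x v ∈ Submodule.span ℝ {y | ∃ X ∈ L, X x = y} := by
  have : CompleteSpace E := FiniteDimensional.complete ℝ E
  have : CompleteSpace T := FiniteDimensional.complete ℝ T
  let b := Module.finBasis ℝ T
  choose X hXL hXp using fun i => hTL (b i) (b i).2
  let κ : Fin (Module.finrank ℝ T) → T →L[ℝ] ℝ := fun i => (b.coord i).toContinuousLinearMap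
  set Z₀ : E → T →L[ℝ] E := fun x => ∑ i, (κ i).smulRight (X i x) with hZ₀
  have hZ₀m : IsUltradifferentiableOn m Z₀ U :=
    IsUltradifferentiableOn.sum hm hU _ fun i _ =>
      (hL _ (hXL i)).clm_comp hU (ContinuousLinearMap.smulRightL ℝ T E (κ i))
  set a : E → T →L[ℝ] T := fun x => π.comp (Z₀ x) with ha
  have ham : IsUltradifferentiableOn m a U :=
    hZ₀m.clm_comp hU (ContinuousLinearMap.compL ℝ T E T π)
  have hap : a p = 1 := by
    ext v
    have h1 : Z₀ p v = v := by
      simp only [hZ₀, sum_apply, ContinuousLinearMap.smulRight_apply, κ,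
        LinearMap.coe_toContinuousLinearMap', Module.Basis.coord_apply, hXp]
      have := congrArg Subtype.val (b.sum_repr v)
      rw [AddSubmonoidClass.coe_finsetSum] at this
      exact this
    simp [ha, h1, hπ]
  -- The matrix `a = π Z₀` is the identity at `p`. Where it is invertible, `Z₀ a⁻¹` is the
  -- normalized frame.
  set V : Set E := U ∩ a ⁻¹' {u | IsUnit u} with hV
  have hVo : IsOpen V := ham.1.continuousOn.isOpen_inter_preimage hU
    (Units.isOpen (R := T →L[ℝ] T))
  have hVU : V ⊆ U := inter_subset_left
  have hinv : IsUltradifferentiableOn m (fun x => Ring.inverse (a x)) V :=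
    IsUltradifferentiableOn.ringInverse (R := T →L[ℝ] T) (a := a) hm (ham.mono hVU) hVo
      fun x hx => hx.2
  refine ⟨V, hVo, ⟨hp, by simp [hap]⟩, hVU, fun x => (Z₀ x).comp (Ring.inverse (a x)),
    (hZ₀m.mono hVU).clm_mul hm hinv hVo, fun x hx v => ?_, fun c hc => ?_, fun x hx v => ?_⟩
  · have h1 : a x * Ring.inverse (a x) = 1 := Ring.mul_inverse_cancel _ hx.2
    exact congrArg (fun A : T →L[ℝ] T => A v) h1
  · have h1 : ∀ i, InFieldModule L V fun x => κ i (Ring.inverse (a x) (c x)) • X i x := fun i =>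
      InFieldModule.smul _ _ ((κ i).contDiff.comp_contDiffOn (hinv.1.clm_apply hc)) (hXL i)
    refine InFieldModule.congr _ _ (InFieldModule.sum Finset.univ fun i _ => h1 i) fun x _ => ?_
    simp [hZ₀]
  · simp only [hZ₀, ContinuousLinearMap.comp_apply, sum_apply,
      ContinuousLinearMap.smulRight_apply]
    exact Submodule.sum_mem _ fun i _ =>
      Submodule.smul_mem _ _ (Submodule.subset_span ⟨X i, hXL i, rfl⟩)

/-- **Nagano's theorem** in a quasianalytic class: a Lie algebra `L` of vector fields of class
`{m}` has an integral manifold through `p` whose dimension is that of `T = L(p)`, parametrized by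
a solution `w` of a total differential equation of class `{m}`. -/
theorem exists_nagano_leaf {m : ℕ → ℝ} (hm : IsRegularWeightSequence m)
    (hq : IsQuasianalyticSequence m) {U : Set E} (hU : IsOpen U) {p : E} (hp : p ∈ U)
    {L : Set (E → E)} (hL : ∀ X ∈ L, IsUltradifferentiableOn m X U)
    (hLL : ∀ X ∈ L, ∀ Y ∈ L, VectorField.lieBracket ℝ X Y ∈ L) {T : Submodule ℝ E}
    (hT : ∀ X ∈ L, X p ∈ T) (hTL : ∀ v ∈ T, ∃ X ∈ L, X p = v) {π : E →L[ℝ] T}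
    (hπ : ∀ v : T, π v = v) :
    ∃ V : Set E, IsOpen V ∧ p ∈ V ∧ V ⊆ U ∧ ∃ Z : E → T →L[ℝ] E,
      IsUltradifferentiableOn m Z V ∧ (∀ x ∈ V, ∀ v, π (Z x v) = v) ∧
      (∀ x ∈ V, ∀ v, Z x v ∈ Submodule.span ℝ {y | ∃ X ∈ L, X x = y}) ∧
      ∃ r : ℝ, 0 < r ∧ ∃ w : T → E, w 0 = p ∧ ∀ v ∈ Metric.ball (0 : T) r,
        w v ∈ V ∧ HasFDerivAt w (Z (w v)) v ∧ ∀ X ∈ L, Z (w v) (π (X (w v))) = X (w v) := by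
  obtain ⟨V, hV, hpV, hVU, Z, hZ, hπZ, hZL, hZs⟩ := exists_normalized_frame hm hU hp hL hTL hπ
  have : CompleteSpace E := FiniteDimensional.complete ℝ E
  have hLc : ∀ X ∈ L, ContDiffOn ℝ ∞ X V := fun X hX => ((hL X hX).mono hVU).1
  -- The crux: a field of the module that `π` annihilates is flat at `p` along the curve, and if it
  -- is also of class `{m}` then so is its restriction to the curve, which must vanish.
  have hvanish : ∀ (v : T) (γ : ℝ → E), γ 0 = p →
      (∀ s ∈ Ioo (-2 : ℝ) 2, γ s ∈ V ∧ HasDerivAt γ (Z (γ s) v) s) →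
      ∀ Y : E → E, InFieldModule L V Y → IsUltradifferentiableOn m Y V →
      (∀ x ∈ V, π (Y x) = 0) → ∀ s ∈ Icc (0 : ℝ) 1, Y (γ s) = 0 := by
    intro v γ hγ0 hγ Y hY hYm hYπ s hs
    have hX := hZL (fun _ => v) contDiffOn_const
    have hXm : IsUltradifferentiableOn m (fun x => Z x v) V :=
      hZ.clm_apply hm (IsUltradifferentiableOn.const hm v) hV
    have hΦ := hXm.clm_comp hV (ContinuousLinearMap.smulRightL ℝ ℝ E (1 : ℝ →L[ℝ] ℝ))
    have hf : IsUltradifferentiableOn m (fun s => Y (γ s)) (Ioo (-2 : ℝ) 2) := by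
      refine IsUltradifferentiableOn.comp_total hm hV isOpen_Ioo hΦ hYm
        (fun s hs => (hγ s hs).1) fun s hs => ?_
      refine ((hγ s hs).2.hasFDerivAt).congr_fderiv ?_
      ext
      simp
    refine hf.eq_zero_of_flat hm hq isOpen_Ioo (c := 1)
      (fun s hs => ⟨by linarith [hs.1], by linarith [hs.2]⟩) (fun k => ?_) hs
    rw [← norm_eq_zero, ← norm_iteratedFDeriv_eq_norm_iteratedDeriv, norm_eq_zero]
    exact hX.iteratedFDeriv_comp_curve_eq_zero hV hLc hLL hT hπ (fun x hx => hπZ x hx v) hγ0 hγ k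
      Y hY hYπ
  have hdZ : ∀ x ∈ V, ∀ a u, fderiv ℝ (fun y => Z y a) x u = fderiv ℝ Z x u a := by
    intro x hx a u
    have h1 : HasFDerivAt Z (fderiv ℝ Z x) x :=
      ((hZ.contDiffAt hV hx).differentiableAt (by simp)).hasFDerivAt
    rw [(h1.clm_apply (hasFDerivAt_const a x)).fderiv]
    simp
  obtain ⟨r, hr, w, hw0, hw⟩ := exists_total_solution hV hpV hZ.1 (by
    intro v γ hγ0 hγ s hs a b
    -- The curvature of the frame. As `π Z a = a` and `π Z b = b` are constant, `π` annihilates it,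
    -- so it vanishes along the rays.
    set Y : E → E := VectorField.lieBracket ℝ (fun x => Z x a) (fun x => Z x b) with hYdef
    have hYeq : ∀ x ∈ V, Y x = fderiv ℝ Z x (Z x a) b - fderiv ℝ Z x (Z x b) a := by
      intro x hx
      rw [hYdef, VectorField.lieBracket_eq]
      simp only [hdZ x hx]
    have hYm : IsUltradifferentiableOn m Y V := by
      have hc : ∀ a : T, IsUltradifferentiableOn m (fun x => Z x a) V := fun a =>
        hZ.clm_apply hm (IsUltradifferentiableOn.const hm a) hV
      refine IsUltradifferentiableOn.congr (f := fun x => fderiv ℝ Z x (Z x a) b -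
        fderiv ℝ Z x (Z x b) a) ?_ hV hYeq
      exact (((hZ.fderiv hm hV).clm_apply hm (hc a) hV).clm_apply hm
        (IsUltradifferentiableOn.const hm b) hV).sub hm (((hZ.fderiv hm hV).clm_apply hm (hc b)
        hV).clm_apply hm (IsUltradifferentiableOn.const hm a) hV) hV
    have hYL : InFieldModule L V Y := (hZL (fun _ => a) contDiffOn_const).lieBracket hV hLc hLL
      (hZL (fun _ => b) contDiffOn_const)
    have hdπ : ∀ x ∈ V, ∀ u c, π (fderiv ℝ Z x u c) = 0 := by
      intro x hx u c
      have h1 : HasFDerivAt (fun y => Z y c) (fderiv ℝ (fun y => Z y c) x) x :=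
        (((hZ.clm_apply hm (IsUltradifferentiableOn.const hm c) hV).contDiffAt hV
          hx).differentiableAt (by simp)).hasFDerivAt
      have h2 : HasFDerivAt (fun y => π (Z y c)) (π.comp (fderiv ℝ (fun y => Z y c) x)) x :=
        π.hasFDerivAt.comp x h1
      have h3 : HasFDerivAt (fun y => π (Z y c)) (0 : E →L[ℝ] T) x :=
        (hasFDerivAt_const c x).congr_of_eventuallyEq
          (by filter_upwards [hV.mem_nhds hx] with y hy using hπZ y hy c)
      have h4 := congrArg (fun A : E →L[ℝ] T => A u) (h2.unique h3)
      simpa [hdZ x hx] using h4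
    have hx := (hγ s ⟨by linarith [hs.1], by linarith [hs.2]⟩).1
    have h0 := hvanish v γ hγ0 hγ Y hYL hYm
      (fun x hx => by rw [hYeq x hx, map_sub, hdπ x hx, hdπ x hx, sub_zero]) s hs
    rw [hYeq _ hx] at h0
    exact sub_eq_zero.1 h0)
  refine ⟨V, hV, hpV, hVU, Z, hZ, hπZ, hZs, r, hr, w, hw0, fun v hv => ?_⟩
  obtain ⟨hwd, γ, hγ0, hγ1, hγ⟩ := hw v hv
  have hwV : w v ∈ V := hγ1 ▸ (hγ 1 (by norm_num)).1
  refine ⟨hwV, hwd, fun X hX => ?_⟩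
  have hXm := (hL X hX).mono hVU
  have hpX : IsUltradifferentiableOn m (fun x => π (X x)) V := hXm.clm_comp hV π
  -- The same argument applied to the defect of tangency of `X` to the leaf, which `π` annihilates
  -- by normalization.
  have hYm : IsUltradifferentiableOn m (fun x => Z x (π (X x)) - X x) V :=
    (hZ.clm_apply hm hpX hV).sub hm hXm hV
  have hYL : InFieldModule L V fun x => Z x (π (X x)) - X x :=
    InFieldModule.congr _ _ (InFieldModule.add _ _ (hZL _ hpX.1)
      (InFieldModule.smul (fun _ => -1) X contDiffOn_const hX)) fun x _ => by
      simp [sub_eq_add_neg]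
  have h0 := hvanish v γ hγ0 hγ _ hYL hYm (fun x hx => by rw [map_sub, hπZ x hx, sub_self]) 1
    (by norm_num)
  rw [hγ1] at h0
  exact sub_eq_zero.1 h0

end Nagano

/-- Complex Euclidean space, regarded as a real normed space. -/
abbrev CSpace (N : ℕ) := EuclideanSpace ℂ (Fin N)

/-- `ρ` is a smooth defining function of `S` on the open set `U`. -/
structure IsDefiningFunction {N c : ℕ} (S U : Set (CSpace N))
    (ρ : CSpace N → EuclideanSpace ℝ (Fin c)) : Prop where
  isOpen : IsOpen U
  contDiffOn : ContDiffOn ℝ ∞ ρ U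
  surjective : ∀ x ∈ U, Function.Surjective (fderiv ℝ ρ x)
  inter_eq : S ∩ U = {x ∈ U | ρ x = 0}

theorem finrank_real_cspace (N : ℕ) : Module.finrank ℝ (CSpace N) = 2 * N := by
  rw [finrank_real_of_complex, finrank_euclideanSpace_fin]

theorem IsUltradifferentiableSubmanifold.isSmoothSubmanifold {N : ℕ} {m : ℕ → ℝ}
    {S : Set (CSpace N)} {d : ℕ} (hS : IsUltradifferentiableSubmanifold m S d) :
    IsSmoothSubmanifold S d := by
  intro p hp
  obtain ⟨c, U, ρ, h1, h2, h3, h4, h5⟩ := hS p hp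
  exact ⟨c, U, ρ, h1, h2, h3, h4.1, h5⟩

theorem IsSmoothSubmanifold.exists_definingFunction {N : ℕ} {S : Set (CSpace N)} {d : ℕ}
    (hS : IsSmoothSubmanifold S d) {p : CSpace N} (hp : p ∈ S) :
    ∃ (c : ℕ) (U : Set (CSpace N)) (ρ : CSpace N → EuclideanSpace ℝ (Fin c)),
      d + c = 2 * N ∧ p ∈ U ∧ IsDefiningFunction S U ρ := by
  obtain ⟨c, U, ρ, h1, h2, h3, h4, h5, h6⟩ := hS p hp
  exact ⟨c, U, ρ, h1, h3, h2, h4, h5, h6⟩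

/-! ### Tangent spaces and defining functions -/

section Tangent

variable {N : ℕ} {S : Set (CSpace N)} {p : CSpace N}

theorem fderiv_eq_zero_of_mem_realTangentSpace {F : Type*} [NormedAddCommGroup F]
    [NormedSpace ℝ F] {h : CSpace N → F} (hd : DifferentiableAt ℝ h p)
    (h0 : ∀ᶠ x in 𝓝 p, x ∈ S → h x = 0) {v : CSpace N}
    (hv : v ∈ realTangentSpace S p) : fderiv ℝ h p v = 0 := by
  refine Submodule.span_induction (p := fun v _ => fderiv ℝ h p v = 0) ?_ (by simp)
    (fun a b _ _ ha hb => by rw [map_add, ha, hb, add_zero])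
    (fun r a _ ha => by rw [map_smul, ha, smul_zero]) hv
  rintro w ⟨γ, hγ0, hγS, hγ⟩
  subst hγ0
  have e1 : HasDerivAt (h ∘ γ) (fderiv ℝ h (γ 0) w) 0 := hd.hasFDerivAt.comp_hasDerivAt 0 hγ
  have e2 : HasDerivAt (h ∘ γ) 0 0 := by
    refine (hasDerivAt_const (0 : ℝ) (0 : F)).congr_of_eventuallyEq ?_
    filter_upwards [hγS, hγ.continuousAt.eventually h0] with t h1 h2 using h2 h1
  exact e1.unique e2

namespace IsDefiningFunction

variable {c : ℕ} {U : Set (CSpace N)} {ρ : CSpace N → EuclideanSpace ℝ (Fin c)}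

theorem eq_zero (h : IsDefiningFunction S U ρ) {x : CSpace N} (hx : x ∈ S) (hxU : x ∈ U) :
    ρ x = 0 :=
  (h.inter_eq.subset ⟨hx, hxU⟩).2

theorem mem (h : IsDefiningFunction S U ρ) {x : CSpace N} (hxU : x ∈ U) (hx : ρ x = 0) : x ∈ S :=
  (h.inter_eq.superset ⟨hxU, hx⟩).1

theorem contDiffAt (h : IsDefiningFunction S U ρ) {x : CSpace N} (hxU : x ∈ U) :
    ContDiffAt ℝ ∞ ρ x :=
  h.contDiffOn.contDiffAt (h.isOpen.mem_nhds hxU)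

theorem hasStrictFDerivAt (h : IsDefiningFunction S U ρ) {x : CSpace N} (hxU : x ∈ U) :
    HasStrictFDerivAt ρ (fderiv ℝ ρ x) x :=
  (h.contDiffAt hxU).hasStrictFDerivAt (by simp)

/-- A submanifold is locally parametrized by its tangent space. -/
theorem exists_parametrization (h : IsDefiningFunction S U ρ) (hp : p ∈ S) (hpU : p ∈ U) :
    ∃ G : LinearMap.ker (fderiv ℝ ρ p : CSpace N →ₗ[ℝ] EuclideanSpace ℝ (Fin c)) → CSpace N,
      G 0 = p ∧ (∀ᶠ s in 𝓝 0, G s ∈ S) ∧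
      HasStrictFDerivAt G (Submodule.subtypeL _) 0 := by
  have hs := h.hasStrictFDerivAt hpU
  have hr : (fderiv ℝ ρ p : CSpace N →ₗ[ℝ] EuclideanSpace ℝ (Fin c)).range = ⊤ :=
    LinearMap.range_eq_top.2 (h.surjective p hpU)
  set G := hs.implicitFunction ρ (fderiv ℝ ρ p) hr (ρ p) with hG
  have hG' := hs.to_implicitFunction hr
  have hG0 : G 0 = p := hs.implicitFunction_apply_image hr
  refine ⟨G, hG0, ?_, hG'⟩
  have h1 := (hs.map_implicitFunction_eq hr)
  have h2 : ∀ᶠ s in 𝓝 (0 : LinearMap.ker (fderiv ℝ ρ p : CSpace N →ₗ[ℝ] EuclideanSpace ℝ (Fin c))),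
      ρ (G s) = ρ p := by
    have h3 : Tendsto (fun s : LinearMap.ker (fderiv ℝ ρ p : CSpace N →ₗ[ℝ] EuclideanSpace ℝ (Fin c)) =>
        ((ρ p, s) : _ × _)) (𝓝 0) (𝓝 (ρ p, 0)) :=
      (Continuous.prodMk_right (ρ p)).tendsto 0
    exact h3.eventually h1
  have h4 : ∀ᶠ s in 𝓝 (0 : LinearMap.ker (fderiv ℝ ρ p : CSpace N →ₗ[ℝ] EuclideanSpace ℝ (Fin c))), G s ∈ U :=
    hG'.continuousAt.eventually (by
      change ∀ᶠ y in 𝓝 (G 0), y ∈ U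
      rw [hG0]
      exact h.isOpen.mem_nhds hpU)
  filter_upwards [h2, h4] with s h5 h6
  exact h.mem h6 (by rw [h5, h.eq_zero hp hpU])

theorem mem_realTangentSpace_iff (h : IsDefiningFunction S U ρ) (hp : p ∈ S) (hpU : p ∈ U)
    {v : CSpace N} : v ∈ realTangentSpace S p ↔ fderiv ℝ ρ p v = 0 := by
  constructor
  · intro hv
    refine fderiv_eq_zero_of_mem_realTangentSpace
      ((h.contDiffAt hpU).differentiableAt (by simp)) ?_ hv
    filter_upwards [h.isOpen.mem_nhds hpU] with x hxU hx using h.eq_zero hx hxU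
  · intro hv
    obtain ⟨G, hG0, hGS, hG⟩ := h.exists_parametrization hp hpU
    let k : LinearMap.ker (fderiv ℝ ρ p : CSpace N →ₗ[ℝ] EuclideanSpace ℝ (Fin c)) := ⟨v, hv⟩
    refine Submodule.subset_span ⟨fun t : ℝ => G (t • k), by simp [hG0], ?_, ?_⟩
    · have h1 : Tendsto (fun t : ℝ => t • k) (𝓝 0) (𝓝 0) := by
        have : Continuous fun t : ℝ => t • k := by fun_prop
        simpa using this.tendsto 0
      exact h1.eventually hGS
    · have h1 : HasDerivAt (fun t : ℝ => t • k) k 0 := by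
        simpa using (hasDerivAt_id (0 : ℝ)).smul_const k
      have h2 : HasFDerivAt G (Submodule.subtypeL _) ((0 : ℝ) • k) := by
        rw [zero_smul]; exact hG.hasFDerivAt
      exact h2.comp_hasDerivAt 0 h1

theorem realTangentSpace_eq (h : IsDefiningFunction S U ρ) (hp : p ∈ S) (hpU : p ∈ U) :
    realTangentSpace S p =
      LinearMap.ker (fderiv ℝ ρ p : CSpace N →ₗ[ℝ] EuclideanSpace ℝ (Fin c)) :=
  Submodule.ext fun _ => h.mem_realTangentSpace_iff hp hpU

theorem finrank_realTangentSpace (h : IsDefiningFunction S U ρ) (hp : p ∈ S) (hpU : p ∈ U)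
    {d : ℕ} (hd : d + c = 2 * N) : Module.finrank ℝ (realTangentSpace S p) = d := by
  rw [h.realTangentSpace_eq hp hpU]
  have h1 : _ + Module.finrank ℝ
      (LinearMap.ker (fderiv ℝ ρ p : CSpace N →ₗ[ℝ] EuclideanSpace ℝ (Fin c))) = _ :=
    LinearMap.finrank_range_add_finrank_ker _
  rw [LinearMap.range_eq_top.2 (h.surjective p hpU), finrank_top, finrank_euclideanSpace_fin,
    finrank_real_cspace] at h1
  change Module.finrank ℝ
    (LinearMap.ker (fderiv ℝ ρ p : CSpace N →ₗ[ℝ] EuclideanSpace ℝ (Fin c))) = d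
  omega

/-- The bracket of vector fields tangent to `S` is tangent to `S`. -/
theorem lieBracket_mem (h : IsDefiningFunction S U ρ) (hp : p ∈ S) (hpU : p ∈ U)
    {X Y : CSpace N → CSpace N} (hX : ContDiffAt ℝ ∞ X p) (hY : ContDiffAt ℝ ∞ Y p)
    (hXt : ∀ᶠ x in 𝓝 p, x ∈ S → X x ∈ realTangentSpace S x)
    (hYt : ∀ᶠ x in 𝓝 p, x ∈ S → Y x ∈ realTangentSpace S x) :
    VectorField.lieBracket ℝ X Y p ∈ realTangentSpace S p := by
  have hρ' : HasFDerivAt (fderiv ℝ ρ) (fderiv ℝ (fderiv ℝ ρ) p) p :=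
    (((h.contDiffAt hpU).fderiv_right (m := ∞) (by simp)).differentiableAt (by simp)).hasFDerivAt
  -- The relation `dρ(X) = 0` on `S` is differentiated in a tangent direction. In the bracket the
  -- second derivatives of `ρ` cancel by symmetry.
  have key : ∀ {X : CSpace N → CSpace N}, ContDiffAt ℝ ∞ X p →
      (∀ᶠ x in 𝓝 p, x ∈ S → X x ∈ realTangentSpace S x) → ∀ v ∈ realTangentSpace S p,
      fderiv ℝ ρ p (fderiv ℝ X p v) + fderiv ℝ (fderiv ℝ ρ) p v (X p) = 0 := by
    intro X hX hXt v hv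
    have h1 : HasFDerivAt X (fderiv ℝ X p) p := (hX.differentiableAt (by simp)).hasFDerivAt
    have h2 := hρ'.clm_apply h1
    have h3 := fderiv_eq_zero_of_mem_realTangentSpace (S := S) h2.differentiableAt (by
      filter_upwards [hXt, h.isOpen.mem_nhds hpU] with x hx hxU hxS
      exact (h.mem_realTangentSpace_iff hxS hxU).1 (hx hxS)) hv
    rw [h2.fderiv] at h3
    simpa using h3
  rw [h.mem_realTangentSpace_iff hp hpU, VectorField.lieBracket_eq]
  have h1 := key hX hXt (Y p) (hYt.self_of_nhds hp)
  have h2 := key hY hYt (X p) (hXt.self_of_nhds hp)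
  have hsymm : fderiv ℝ (fderiv ℝ ρ) p (Y p) (X p) = fderiv ℝ (fderiv ℝ ρ) p (X p) (Y p) :=
    ((h.contDiffAt hpU).isSymmSndFDerivAt (by simp; exact ENat.LEInfty.out)) (Y p) (X p)
  rw [hsymm] at h1
  simp only [map_sub]
  rw [sub_eq_zero, ← add_left_inj (fderiv ℝ (fderiv ℝ ρ) p (X p) (Y p)), h1, h2]

/-- A map into `S` whose differential is onto the tangent space is locally onto `S`. -/
theorem eventually_mem_image (h : IsDefiningFunction S U ρ) (hp : p ∈ S) (hpU : p ∈ U)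
    {F : Type*} [NormedAddCommGroup F] [NormedSpace ℝ F] [CompleteSpace F] {G : F → CSpace N}
    {G' : F →L[ℝ] CSpace N} (hG0 : G 0 = p) (hG : HasStrictFDerivAt G G' 0)
    (hGS : ∀ᶠ s in 𝓝 0, G s ∈ S)
    (hrange : realTangentSpace S p ≤ LinearMap.range (G' : F →ₗ[ℝ] CSpace N)) {A : Set F}
    (hA : A ∈ 𝓝 (0 : F)) : ∀ᶠ x in 𝓝 p, x ∈ S → x ∈ G '' A := by
  set K := LinearMap.ker (fderiv ℝ ρ p : CSpace N →ₗ[ℝ] EuclideanSpace ℝ (Fin c)) with hK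
  obtain ⟨π, hπ⟩ : ∃ π : CSpace N →L[ℝ] K, ∀ v : K, π v = v :=
    Submodule.ClosedComplemented.of_finiteDimensional K
  set e : CSpace N → EuclideanSpace ℝ (Fin c) × K := fun x => (ρ x, π x) with he
  have he' : HasStrictFDerivAt e ((fderiv ℝ ρ p).prod π) p :=
    (h.hasStrictFDerivAt hpU).prodMk π.hasStrictFDerivAt
  have hinj : LinearMap.ker ((fderiv ℝ ρ p).prod π).toLinearMap = ⊥ := by
    refine LinearMap.ker_eq_bot'.2 fun v hv => ?_
    have h1 : fderiv ℝ ρ p v = 0 := congrArg Prod.fst hv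
    have h2 : π v = 0 := congrArg Prod.snd hv
    have h3 := hπ ⟨v, h1⟩
    rw [h2] at h3
    exact (congrArg Subtype.val h3).symm
  obtain ⟨κ, hκ0, hκ⟩ := LinearMap.exists_antilipschitzWith _ hinj
  obtain ⟨O, hO, hOi⟩ : ∃ O ∈ 𝓝 p, InjOn e O := by
    obtain ⟨O, hO, hap⟩ := he'.approximates_deriv_on_nhds (c := κ⁻¹ / 2)
      (Or.inr (by positivity))
    refine ⟨O, hO, fun x hx y hy hxy => ?_⟩
    have h1 := hap x hx y hy
    rw [hxy, sub_self, zero_sub, norm_neg] at h1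
    have h2 := hκ.le_mul_dist x y
    simp only [dist_eq_norm] at h2
    have h2' : ‖x - y‖ ≤ κ * ‖(fderiv ℝ ρ p).prod π (x - y)‖ := by
      rw [map_sub]; exact h2
    have h3 : ‖x - y‖ ≤ κ * ((κ⁻¹ / 2 : NNReal) * ‖x - y‖) := h2'.trans (by gcongr)
    have h4 : (κ : ℝ) * ((κ⁻¹ / 2 : NNReal) * ‖x - y‖) = ‖x - y‖ / 2 := by
      have : (κ : ℝ) ≠ 0 := by exact_mod_cast hκ0.ne'
      push_cast
      field_simp
    rw [h4] at h3
    have : ‖x - y‖ = 0 := le_antisymm (by linarith) (norm_nonneg _)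
    exact sub_eq_zero.1 (norm_eq_zero.1 this)
  have hπG : HasStrictFDerivAt (fun s => π (G s)) (π.comp G') 0 :=
    π.hasStrictFDerivAt.comp 0 hG
  have hsurj : LinearMap.range ((π.comp G' : F →L[ℝ] K) : F →ₗ[ℝ] K) = ⊤ := by
    refine LinearMap.range_eq_top.2 fun v => ?_
    obtain ⟨s, hs⟩ := hrange ((h.mem_realTangentSpace_iff hp hpU).2 v.2)
    exact ⟨s, (congrArg π hs).trans (hπ v)⟩
  have hmap := hπG.map_nhds_eq_of_surj hsurj
  have hA' : A ∩ {s | G s ∈ S ∧ G s ∈ O ∧ G s ∈ U} ∈ 𝓝 (0 : F) := by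
    have hc : Tendsto G (𝓝 0) (𝓝 p) := hG0 ▸ hG.continuousAt
    exact inter_mem hA (hGS.and ((hc.eventually hO).and
      (hc.eventually (h.isOpen.mem_nhds hpU))))
  have h1 := Filter.image_mem_map (m := fun s => π (G s)) hA'
  rw [hmap, hG0] at h1
  filter_upwards [π.continuous.continuousAt.eventually h1, hO, h.isOpen.mem_nhds hpU]
    with x hx hxO hxU hxS
  obtain ⟨s, ⟨hsA, hsS, hsO, hsU⟩, hs⟩ := hx
  refine ⟨s, hsA, hOi hsO hxO ?_⟩
  simp only [he, Prod.mk.injEq]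
  exact ⟨by rw [h.eq_zero hxS hxU, h.eq_zero hsS hsU], hs⟩

end IsDefiningFunction

end Tangent

/-! ### Projections onto kernels -/

section KernelProjection

variable {H H' : Type} [NormedAddCommGroup H] [InnerProductSpace ℝ H] [CompleteSpace H]
  [NormedAddCommGroup H'] [InnerProductSpace ℝ H'] [CompleteSpace H']

/-- The real adjoint as a continuous linear map. -/
noncomputable def realAdjoint : (H →L[ℝ] H') →L[ℝ] (H' →L[ℝ] H) :=
  LinearMap.mkContinuous
    { toFun := fun A => ContinuousLinearMap.adjoint A
      map_add' := fun A B => map_add _ A B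
      map_smul' := fun r A => by simp } 1 fun A => by simp

theorem realAdjoint_apply (A : H →L[ℝ] H') : realAdjoint A = ContinuousLinearMap.adjoint A := rfl

theorem isUnit_comp_realAdjoint [FiniteDimensional ℝ H'] {B : H →L[ℝ] H'} (hB : Function.Surjective B) :
    IsUnit (B.comp (realAdjoint B)) := by
  rw [ContinuousLinearMap.isUnit_iff_bijective]
  have hinj : Function.Injective (B.comp (realAdjoint B)) := by
    refine (injective_iff_map_eq_zero _).2 fun y hy => ?_
    have h1 : realAdjoint B y = 0 := by
      rw [← inner_self_eq_zero (𝕜 := ℝ), realAdjoint_apply, ContinuousLinearMap.adjoint_inner_left]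
      have : B (ContinuousLinearMap.adjoint B y) = 0 := hy
      rw [this, inner_zero_right]
    obtain ⟨x, rfl⟩ := hB y
    rw [← inner_self_eq_zero (𝕜 := ℝ), ← ContinuousLinearMap.adjoint_inner_left,
      ← realAdjoint_apply, h1, inner_zero_left]
  exact ⟨hinj, LinearMap.injective_iff_surjective
    (f := ((B.comp (realAdjoint B) : H' →L[ℝ] H') : H' →ₗ[ℝ] H')).1 hinj⟩

/-- The formula `1 - B* (B B*)⁻¹ B` uses only composition, adjoints and inversion, which all
preserve the class `{m}`. -/
theorem starProjection_ker_eq [FiniteDimensional ℝ H] {B : H →L[ℝ] H'} (hB : IsUnit (B.comp (realAdjoint B))) (u : H) :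
    (LinearMap.ker (B : H →ₗ[ℝ] H')).starProjection u =
      u - realAdjoint B (Ring.inverse (B.comp (realAdjoint B)) (B u)) := by
  have h1 : (B.comp (realAdjoint B)) * Ring.inverse (B.comp (realAdjoint B)) = 1 :=
    Ring.mul_inverse_cancel _ hB
  have h2 : ∀ y, B (realAdjoint B (Ring.inverse (B.comp (realAdjoint B)) y)) = y := fun y =>
    congrArg (fun A : H' →L[ℝ] H' => A y) h1
  refine Submodule.eq_starProjection_of_mem_of_inner_eq_zero ?_ fun w hw => ?_
  · change B _ = 0
    rw [map_sub, h2, sub_self]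
  · have hw' : B w = 0 := hw
    rw [sub_sub_cancel, realAdjoint_apply, ContinuousLinearMap.adjoint_inner_left, hw',
      inner_zero_right]

/-- Orthogonal projections onto the kernels of a family of surjective maps of class `{m}` form a
family of class `{m}`. -/
theorem IsUltradifferentiableOn.exists_starProjection_ker [FiniteDimensional ℝ H]
    [FiniteDimensional ℝ H'] {E : Type} [NormedAddCommGroup E]
    [NormedSpace ℝ E] [CompleteSpace E] {m : ℕ → ℝ} (hm : IsRegularWeightSequence m) {U : Set E}
    (hU : IsOpen U) {B : E → H →L[ℝ] H'} (hB : IsUltradifferentiableOn m B U) {p : E} (hp : p ∈ U)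
    (hsurj : Function.Surjective (B p)) :
    ∃ V : Set E, IsOpen V ∧ p ∈ V ∧ V ⊆ U ∧ (∀ x ∈ V, Function.Surjective (B x)) ∧
      ∃ P : E → H →L[ℝ] H, IsUltradifferentiableOn m P V ∧
        ∀ x ∈ V, ∀ u, P x u = (LinearMap.ker (B x : H →ₗ[ℝ] H')).starProjection u := by
  set a : E → H' →L[ℝ] H' := fun x => (B x).comp (realAdjoint (B x)) with ha
  have hadj : IsUltradifferentiableOn m (fun x => realAdjoint (B x)) U :=
    hB.clm_comp hU realAdjoint
  have ham : IsUltradifferentiableOn m a U := hB.clm_mul hm hadj hU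
  set V : Set E := U ∩ a ⁻¹' {u | IsUnit u} with hV
  have hVo : IsOpen V := ham.1.continuousOn.isOpen_inter_preimage hU
    (Units.isOpen (R := H' →L[ℝ] H'))
  have hVU : V ⊆ U := inter_subset_left
  have hinv : IsUltradifferentiableOn m (fun x => Ring.inverse (a x)) V :=
    IsUltradifferentiableOn.ringInverse (R := H' →L[ℝ] H') (a := a) hm (ham.mono hVU) hVo
      fun x hx => hx.2
  refine ⟨V, hVo, ⟨hp, isUnit_comp_realAdjoint hsurj⟩, hVU, fun x hx => ?_, fun x =>
    ContinuousLinearMap.id ℝ H - (realAdjoint (B x)).comp ((Ring.inverse (a x)).comp (B x)), ?_,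
    fun x hx u => ?_⟩
  · intro y
    obtain ⟨z, hz⟩ := (ContinuousLinearMap.isUnit_iff_bijective.1 hx.2).2 y
    exact ⟨_, hz⟩
  · exact (IsUltradifferentiableOn.const hm _).sub hm ((hadj.mono hVU).clm_mul hm
      (hinv.clm_mul hm (hB.mono hVU) hVo) hVo) hVo
  · rw [starProjection_ker_eq hx.2]
    rfl

end KernelProjection

/-- A fixed real isomorphism of `ℂ^N` with a Euclidean space. -/
noncomputable def cspaceEquiv (N : ℕ) : CSpace N ≃L[ℝ] EuclideanSpace ℝ (Fin (2 * N)) :=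
  ContinuousLinearEquiv.ofFinrankEq (by rw [finrank_real_cspace, finrank_euclideanSpace_fin])

/-- Multiplication by `i` as a real linear map. -/
noncomputable def mulI (N : ℕ) : CSpace N →L[ℝ] CSpace N :=
  (ContinuousLinearMap.lsmul ℂ ℂ Complex.I : CSpace N →L[ℂ] CSpace N).restrictScalars ℝ

/-! ### Sections of the complex tangent bundle -/

section Sections

variable {N : ℕ} {m : ℕ → ℝ} {M : Set (CSpace N)} {p : CSpace N}

/-- The complex tangent space, transported to Euclidean space. -/
noncomputable def complexTangentImage (M : Set (CSpace N)) (p : CSpace N) :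
    Submodule ℝ (EuclideanSpace ℝ (Fin (2 * N))) :=
  ((complexTangentSpace M p).restrictScalars ℝ).map (cspaceEquiv N).toLinearMap

theorem mem_complexTangentImage_iff {u : EuclideanSpace ℝ (Fin (2 * N))} :
    u ∈ complexTangentImage M p ↔ (cspaceEquiv N).symm u ∈ complexTangentSpace M p := by
  constructor
  · rintro ⟨v, hv, rfl⟩
    simpa using hv
  · intro h
    exact ⟨_, h, by simp⟩

theorem finrank_complexTangentImage : Module.finrank ℝ (complexTangentImage M p) =
    2 * Module.finrank ℂ (complexTangentSpace M p) := by
  rw [← finrank_real_of_complex]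
  exact LinearEquiv.finrank_map_eq (cspaceEquiv N).toLinearEquiv
    ((complexTangentSpace M p).restrictScalars ℝ)

/-- The orthogonal projection of a basis vector to the complex tangent spaces. -/
noncomputable def canonicalSection (M : Set (CSpace N)) (j : Fin (2 * N)) (p : CSpace N) :
    CSpace N :=
  (cspaceEquiv N).symm ((complexTangentImage M p).starProjection (EuclideanSpace.single j 1))

theorem canonicalSection_mem (j : Fin (2 * N)) :
    canonicalSection M j p ∈ complexTangentSpace M p :=
  mem_complexTangentImage_iff.1 (Submodule.starProjection_apply_mem _ _)

theorem mem_span_canonicalSection {v : CSpace N} (hv : v ∈ complexTangentSpace M p) :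
    v ∈ Submodule.span ℝ (range fun j => canonicalSection M j p) := by
  set u := cspaceEquiv N v with hu
  have huT : u ∈ complexTangentImage M p :=
    mem_complexTangentImage_iff.2 (by simpa [hu] using hv)
  have h1 : u = ∑ j, u j • EuclideanSpace.single j (1 : ℝ) := by
    ext i
    simp [Pi.single_apply]
  have h2 : v = ∑ j, u j • canonicalSection M j p := by
    have h3 := congrArg ((complexTangentImage M p).starProjection) h1
    rw [Submodule.starProjection_eq_self_iff.2 huT] at h3
    have h4 := congrArg (cspaceEquiv N).symm h3
    simpa [hu, canonicalSection] using h4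
  rw [h2]
  exact Submodule.sum_mem _ fun j _ => Submodule.smul_mem _ _ (Submodule.subset_span ⟨j, rfl⟩)

theorem exists_definingFunction_ultra {d : ℕ} (hS : IsUltradifferentiableSubmanifold m M d)
    (hp : p ∈ M) : ∃ (c : ℕ) (U : Set (CSpace N)) (ρ : CSpace N → EuclideanSpace ℝ (Fin c)),
      d + c = 2 * N ∧ p ∈ U ∧ IsDefiningFunction M U ρ ∧ IsUltradifferentiableOn m ρ U := by
  obtain ⟨c, U, ρ, h1, h2, h3, h4, h5, h6⟩ := hS p hp
  exact ⟨c, U, ρ, h1, h3, ⟨h2, h4.1, h5, h6⟩, h4⟩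

/-- On `M` the complex tangent space is the kernel of `C = (dρ, dρ ∘ i)`. This need not be onto, so
`B` is `C` followed by a projection to its range at `p`, which makes `B p` surjective with the same
kernel. Near `p` the kernel of `B` has constant dimension and at points of `M` contains the complex
tangent space; constancy of the CR dimension forces equality, and the projection formula applies. -/
theorem isComplexTangentSection_canonicalSection (hm : IsRegularWeightSequence m) {d n : ℕ}
    (hM : IsUltradifferentiableCRSubmanifold m M d n) (j : Fin (2 * N)) :
    IsComplexTangentSection m M (canonicalSection M j) := by
  refine ⟨fun p _ => canonicalSection_mem j, fun p hp => ?_⟩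
  obtain ⟨c, U, ρ, -, hpU, hρ, hρm⟩ := exists_definingFunction_ultra hM.submanifold hp
  let Θ := (cspaceEquiv N).symm.toContinuousLinearMap
  let C : CSpace N → EuclideanSpace ℝ (Fin (2 * N)) →L[ℝ]
      EuclideanSpace ℝ (Fin c) × EuclideanSpace ℝ (Fin c) := fun x =>
    ((ContinuousLinearMap.inl ℝ _ _).comp (fderiv ℝ ρ x) +
      (ContinuousLinearMap.inr ℝ _ _).comp ((fderiv ℝ ρ x).comp (mulI N))).comp Θ
  have hCapp : ∀ x u, C x u = (fderiv ℝ ρ x (Θ u), fderiv ℝ ρ x (mulI N (Θ u))) := by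
    intro x u
    simp [C]
  have hCm : IsUltradifferentiableOn m C U := by
    have hA := hρm.fderiv hm hρ.isOpen
    have hc : ∀ {A B : Type} [NormedAddCommGroup A] [NormedSpace ℝ A] [NormedAddCommGroup B]
        [NormedSpace ℝ B] (L : A →L[ℝ] B), IsUltradifferentiableOn m (fun _ : CSpace N => L) U :=
      fun L => IsUltradifferentiableOn.const hm L
    exact (((hc _).clm_mul hm hA hρ.isOpen).add hm ((hc _).clm_mul hm (hA.clm_mul hm (hc _)
      hρ.isOpen) hρ.isOpen) hρ.isOpen).clm_mul hm (hc _) hρ.isOpen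
  let R := LinearMap.range (C p : EuclideanSpace ℝ (Fin (2 * N)) →ₗ[ℝ]
    EuclideanSpace ℝ (Fin c) × EuclideanSpace ℝ (Fin c))
  obtain ⟨pr, hpr⟩ : ∃ pr : (EuclideanSpace ℝ (Fin c) × EuclideanSpace ℝ (Fin c)) →L[ℝ] R,
      ∀ v : R, pr v = v := Submodule.ClosedComplemented.of_finiteDimensional R
  let e : R ≃L[ℝ] EuclideanSpace ℝ (Fin (Module.finrank ℝ R)) :=
    ContinuousLinearEquiv.ofFinrankEq (by rw [finrank_euclideanSpace_fin])
  let B : CSpace N → EuclideanSpace ℝ (Fin (2 * N)) →L[ℝ]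
      EuclideanSpace ℝ (Fin (Module.finrank ℝ R)) := fun x =>
    (e.toContinuousLinearMap.comp pr).comp (C x)
  have hBm : IsUltradifferentiableOn m B U :=
    (IsUltradifferentiableOn.const hm _).clm_mul hm hCm hρ.isOpen
  have hBp : Function.Surjective (B p) := by
    intro y
    obtain ⟨u, hu⟩ := (e.symm y).2
    refine ⟨u, ?_⟩
    have hu' : C p u = e.symm y := hu
    simp [B, hu', hpr]
  have hle : ∀ x ∈ M ∩ U, complexTangentImage M x ≤
      LinearMap.ker (B x : EuclideanSpace ℝ (Fin (2 * N)) →ₗ[ℝ] EuclideanSpace ℝ (Fin (Module.finrank ℝ R))) := by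
    rintro x ⟨hxM, hxU⟩ u hu
    obtain ⟨h1, h2⟩ := mem_complexTangentImage_iff.1 hu
    have h3 : C x u = 0 := by
      rw [hCapp, Prod.mk_eq_zero]
      exact ⟨(hρ.mem_realTangentSpace_iff hxM hxU).1 h1,
        (hρ.mem_realTangentSpace_iff hxM hxU).1 h2⟩
    change B x u = 0
    simp [B, h3]
  have hker : LinearMap.ker (B p : EuclideanSpace ℝ (Fin (2 * N)) →ₗ[ℝ] EuclideanSpace ℝ (Fin (Module.finrank ℝ R))) ≤
      complexTangentImage M p := by
    intro u hu
    have hu' : B p u = 0 := hu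
    have h1 : pr (C p u) = 0 := e.injective (by simpa [B] using hu')
    have h2 := hpr ⟨C p u, u, rfl⟩
    have h3 : C p u = 0 := by
      rw [h1] at h2
      exact (congrArg Subtype.val h2).symm
    rw [hCapp, Prod.mk_eq_zero] at h3
    exact mem_complexTangentImage_iff.2 ⟨(hρ.mem_realTangentSpace_iff hp hpU).2 h3.1,
      (hρ.mem_realTangentSpace_iff hp hpU).2 h3.2⟩
  obtain ⟨V, hV, hpV, hVU, hBs, P, hPm, hP⟩ :=
    hBm.exists_starProjection_ker hm hρ.isOpen hpU hBp
  have hfr : ∀ x ∈ V, Module.finrank ℝ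
      (LinearMap.ker (B x : EuclideanSpace ℝ (Fin (2 * N)) →ₗ[ℝ]
        EuclideanSpace ℝ (Fin (Module.finrank ℝ R)))) = 2 * N - Module.finrank ℝ R := by
    intro x hx
    have h1 := LinearMap.finrank_range_add_finrank_ker
      (B x : EuclideanSpace ℝ (Fin (2 * N)) →ₗ[ℝ] EuclideanSpace ℝ (Fin (Module.finrank ℝ R)))
    rw [LinearMap.range_eq_top.2 (hBs x hx), finrank_top, finrank_euclideanSpace_fin,
      finrank_euclideanSpace_fin] at h1
    omega
  have heq : ∀ x ∈ M ∩ V, complexTangentImage M x =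
      LinearMap.ker (B x : EuclideanSpace ℝ (Fin (2 * N)) →ₗ[ℝ]
        EuclideanSpace ℝ (Fin (Module.finrank ℝ R))) := by
    rintro x ⟨hxM, hxV⟩
    refine Submodule.eq_of_le_of_finrank_eq (hle x ⟨hxM, hVU hxV⟩) ?_
    rw [hfr x hxV, ← hfr p hpV, finrank_complexTangentImage,
      hM.finrank_complexTangentSpace x hxM, ← hM.finrank_complexTangentSpace p hp,
      ← finrank_complexTangentImage, le_antisymm (hle p ⟨hp, hpU⟩) hker]
  refine ⟨V, fun x => Θ (P x (EuclideanSpace.single j 1)), hV, hpV, ?_, fun x hx => ?_⟩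
  · exact (hPm.clm_apply hm (IsUltradifferentiableOn.const hm _) hV).clm_comp hV Θ
  · simp only [canonicalSection]
    rw [hP x hx.2]
    simp only [heq x hx]
    rfl

/-- Sections of the complex tangent bundle have local extensions that are tangent to all level
sets of a given defining function. -/
theorem IsComplexTangentSection.exists_tangent_extension (hm : IsRegularWeightSequence m)
    {X : CSpace N → CSpace N} (hX : IsComplexTangentSection m M X) {c : ℕ} {U : Set (CSpace N)}
    {ρ : CSpace N → EuclideanSpace ℝ (Fin c)} (hρ : IsDefiningFunction M U ρ)
    (hρm : IsUltradifferentiableOn m ρ U) (hp : p ∈ M) (hpU : p ∈ U) :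
    ∃ (V : Set (CSpace N)) (Y : CSpace N → CSpace N), IsOpen V ∧ p ∈ V ∧ V ⊆ U ∧
      IsUltradifferentiableOn m Y V ∧ (∀ x ∈ M ∩ V, X x = Y x) ∧
      ∀ x ∈ V, fderiv ℝ ρ x (Y x) = 0 := by
  obtain ⟨U', Y, hU', hpU', hY, hXY⟩ := hX.2 p hp
  let Θ := (cspaceEquiv N).symm.toContinuousLinearMap
  have hBm : IsUltradifferentiableOn m (fun x => (fderiv ℝ ρ x).comp Θ) U :=
    (hρm.fderiv hm hρ.isOpen).clm_mul hm (IsUltradifferentiableOn.const hm _) hρ.isOpen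
  obtain ⟨V, hV, hpV, hVU, hBs, P, hPm, hP⟩ := hBm.exists_starProjection_ker hm hρ.isOpen hpU
    ((hρ.surjective p hpU).comp (cspaceEquiv N).symm.surjective)
  have hVU' : IsOpen (V ∩ U') := hV.inter hU'
  -- An arbitrary extension is projected to `ker dρ`. On `M` nothing changes, since the section is
  -- already tangent there.
  refine ⟨V ∩ U', fun x => Θ (P x (cspaceEquiv N (Y x))), hVU', ⟨hpV, hpU'⟩,
    inter_subset_left.trans hVU, ?_, ?_, ?_⟩
  · exact ((hPm.mono inter_subset_left).clm_apply hm ((hY.mono inter_subset_right).clm_comp hVU'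
      (cspaceEquiv N).toContinuousLinearMap) hVU').clm_comp hVU' Θ
  · rintro x ⟨hxM, hxV, hxU'⟩
    have h1 := (hρ.mem_realTangentSpace_iff hxM (hVU hxV)).1 (hX.1 x hxM).1
    rw [hXY x ⟨hxM, hxU'⟩] at h1 ⊢
    change Y x = Θ (P x (cspaceEquiv N (Y x)))
    rw [hP x hxV, Submodule.starProjection_eq_self_iff.2]
    · simp [Θ]
    · change fderiv ℝ ρ x (Θ (cspaceEquiv N (Y x))) = 0
      simpa [Θ] using h1
  · rintro x ⟨hxV, -⟩
    change fderiv ℝ ρ x (Θ (P x (cspaceEquiv N (Y x)))) = 0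
    rw [hP x hxV]
    exact Submodule.starProjection_apply_mem (LinearMap.ker ((((fderiv ℝ ρ x).comp Θ) :
      EuclideanSpace ℝ (Fin (2 * N)) →L[ℝ] EuclideanSpace ℝ (Fin c)) :
      EuclideanSpace ℝ (Fin (2 * N)) →ₗ[ℝ] EuclideanSpace ℝ (Fin c))) (cspaceEquiv N (Y x))

end Sections

theorem IsUltradifferentiableOn.lieBracket {E : Type} [NormedAddCommGroup E] [NormedSpace ℝ E]
    {m : ℕ → ℝ} (hm : IsRegularWeightSequence m) {U : Set E} {X Y : E → E}
    (hX : IsUltradifferentiableOn m X U) (hY : IsUltradifferentiableOn m Y U) (hU : IsOpen U) :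
    IsUltradifferentiableOn m (VectorField.lieBracket ℝ X Y) U :=
  ((hY.fderiv hm hU).clm_apply hm hX hU).sub hm ((hX.fderiv hm hU).clm_apply hm hY hU) hU

/-! ### Lie algebras of tangent extensions -/

section Extensions

variable {N : ℕ} {m : ℕ → ℝ} {M : Set (CSpace N)} {p : CSpace N} {c : ℕ} {U V : Set (CSpace N)}
  {ρ : CSpace N → EuclideanSpace ℝ (Fin c)} {ι : Type*} {X Y : ι → CSpace N → CSpace N}

/-- `Y` is a family of fields of class `{m}` on `V` which extends `X` and annihilates `ρ`. -/
structure IsTangentExtension (m : ℕ → ℝ) (M V : Set (CSpace N))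
    (ρ : CSpace N → EuclideanSpace ℝ (Fin c)) (X Y : ι → CSpace N → CSpace N) : Prop where
  isOpen : IsOpen V
  ultra : ∀ j, IsUltradifferentiableOn m (Y j) V
  eq : ∀ j, ∀ x ∈ M ∩ V, X j x = Y j x
  tangent : ∀ j, ∀ x ∈ V, fderiv ℝ ρ x (Y j x) = 0

theorem exists_isTangentExtension [Finite ι] (hm : IsRegularWeightSequence m)
    (hX : ∀ j, IsComplexTangentSection m M (X j)) (hρ : IsDefiningFunction M U ρ)
    (hρm : IsUltradifferentiableOn m ρ U) (hp : p ∈ M) (hpU : p ∈ U) :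
    ∃ (V : Set (CSpace N)) (Y : ι → CSpace N → CSpace N), p ∈ V ∧ V ⊆ U ∧
      IsTangentExtension m M V ρ X Y := by
  choose V Y hV hpV _ hYm hXY hρY using fun j =>
    (hX j).exists_tangent_extension hm hρ hρm hp hpU
  have hs : ∀ j, U ∩ ⋂ i, V i ⊆ V j := fun j => inter_subset_right.trans (iInter_subset _ j)
  exact ⟨U ∩ ⋂ j, V j, Y, ⟨hpU, mem_iInter.2 hpV⟩, inter_subset_left,
    hρ.isOpen.inter (isOpen_iInter_of_finite hV), fun j => (hYm j).mono (hs j),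
    fun j x hx => hXY j x ⟨hx.1, hs j hx.2⟩, fun j x hx => hρY j x (hs j hx)⟩

theorem fderiv_lieBracket_eq_zero {A B : CSpace N → CSpace N} {x : CSpace N}
    (hρ : ContDiffAt ℝ ∞ ρ x) (hA : DifferentiableAt ℝ A x) (hB : DifferentiableAt ℝ B x)
    (hA0 : ∀ᶠ y in 𝓝 x, fderiv ℝ ρ y (A y) = 0) (hB0 : ∀ᶠ y in 𝓝 x, fderiv ℝ ρ y (B y) = 0) :
    fderiv ℝ ρ x (VectorField.lieBracket ℝ A B x) = 0 := by
  have hρ' : HasFDerivAt (fderiv ℝ ρ) (fderiv ℝ (fderiv ℝ ρ) x) x :=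
    ((hρ.fderiv_right (m := ∞) (by simp)).differentiableAt (by simp)).hasFDerivAt
  have key : ∀ {A : CSpace N → CSpace N}, DifferentiableAt ℝ A x →
      (∀ᶠ y in 𝓝 x, fderiv ℝ ρ y (A y) = 0) → ∀ v,
      fderiv ℝ ρ x (fderiv ℝ A x v) + fderiv ℝ (fderiv ℝ ρ) x v (A x) = 0 := by
    intro A hA hA0 v
    have h2 := hρ'.clm_apply hA.hasFDerivAt
    have h3 : HasFDerivAt (fun y => fderiv ℝ ρ y (A y))
        (0 : CSpace N →L[ℝ] EuclideanSpace ℝ (Fin c)) x :=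
      (hasFDerivAt_const (0 : EuclideanSpace ℝ (Fin c)) x).congr_of_eventuallyEq hA0
    simpa using congrArg (fun L : CSpace N →L[ℝ] EuclideanSpace ℝ (Fin c) => L v) (h2.unique h3)
  have hsymm : IsSymmSndFDerivAt ℝ ρ x := hρ.isSymmSndFDerivAt (by simp; exact ENat.LEInfty.out)
  have h1 := key hB hB0 (A x)
  have h2 := key hA hA0 (B x)
  rw [hsymm.eq (B x) (A x)] at h2
  rw [VectorField.lieBracket, map_sub, sub_eq_zero]
  exact add_right_cancel (h1.trans h2.symm)

namespace IsTangentExtension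

variable {Z : CSpace N → CSpace N}

theorem ultra_of_inGenerated (h : IsTangentExtension m M V ρ X Y) (hm : IsRegularWeightSequence m)
    (hZ : InGeneratedLieAlgebra univ (range Y) Z) : IsUltradifferentiableOn m Z V := by
  induction hZ with
  | base Z hZ => obtain ⟨j, rfl⟩ := hZ; exact h.ultra j
  | zero => exact IsUltradifferentiableOn.const hm 0
  | add A B _ _ hA hB => exact hA.add hm hB h.isOpen
  | smul r A _ hA =>
    exact (hA.clm_comp h.isOpen (r • ContinuousLinearMap.id ℝ (CSpace N))).congr h.isOpen
      fun x _ => by simp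
  | bracket A B _ _ hA hB =>
    rw [VectorField.lieBracketWithin_univ]
    exact hA.lieBracket hm hB h.isOpen

theorem fderiv_of_inGenerated (h : IsTangentExtension m M V ρ X Y)
    (hm : IsRegularWeightSequence m) (hρ : IsDefiningFunction M U ρ) (hVU : V ⊆ U)
    (hZ : InGeneratedLieAlgebra univ (range Y) Z) : ∀ x ∈ V, fderiv ℝ ρ x (Z x) = 0 := by
  induction hZ with
  | base Z hZ => obtain ⟨j, rfl⟩ := hZ; exact h.tangent j
  | zero => intro x _; simp
  | add A B _ _ hA hB => intro x hx; simp [hA x hx, hB x hx]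
  | smul r A _ hA => intro x hx; simp [hA x hx]
  | bracket A B hA' hB' hA hB =>
    intro x hx
    rw [VectorField.lieBracketWithin_univ]
    have hd : ∀ {A}, InGeneratedLieAlgebra univ (range Y) A → DifferentiableAt ℝ A x := fun hA =>
      ((h.ultra_of_inGenerated hm hA).contDiffAt h.isOpen hx).differentiableAt (by simp)
    exact fderiv_lieBracket_eq_zero (hρ.contDiffAt (hVU hx)) (hd hA') (hd hB')
      (eventually_of_mem (h.isOpen.mem_nhds hx) hA) (eventually_of_mem (h.isOpen.mem_nhds hx) hB)

/-- Generated fields annihilate `dρ`, so they are tangent to `M` and brackets along `M` may be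
computed in the ambient space. This transfers the Lie algebra on `M` to one of fields on an open
set, where Nagano's theorem and flows are available. -/
theorem lieBracketWithin_eq (h : IsTangentExtension m M V ρ X Y)
    (hm : IsRegularWeightSequence m) (hρ : IsDefiningFunction M U ρ) (hVU : V ⊆ U)
    {A B A' B' : CSpace N → CSpace N} (hA : InGeneratedLieAlgebra univ (range Y) A)
    (hB : InGeneratedLieAlgebra univ (range Y) B) (hAA : ∀ x ∈ M ∩ V, A' x = A x)
    (hBB : ∀ x ∈ M ∩ V, B' x = B x) : ∀ x ∈ M ∩ V,
    VectorField.lieBracketWithin ℝ A' B' M x = VectorField.lieBracketWithin ℝ A B univ x := by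
  rintro x ⟨hxM, hx⟩
  have hd : ∀ {A}, InGeneratedLieAlgebra univ (range Y) A → DifferentiableAt ℝ A x := fun hA =>
    ((h.ultra_of_inGenerated hm hA).contDiffAt h.isOpen hx).differentiableAt (by simp)
  rw [VectorField.lieBracketWithin_univ]
  refine lieBracketWithin_eq_of_extension h.isOpen hx hxM (hd hA) (hd hB) hAA hBB ?_ ?_
  · rw [hAA x ⟨hxM, hx⟩, hρ.mem_realTangentSpace_iff hxM (hVU hx)]
    exact h.fderiv_of_inGenerated hm hρ hVU hA x hx
  · rw [hBB x ⟨hxM, hx⟩, hρ.mem_realTangentSpace_iff hxM (hVU hx)]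
    exact h.fderiv_of_inGenerated hm hρ hVU hB x hx

theorem exists_restriction (h : IsTangentExtension m M V ρ X Y)
    (hm : IsRegularWeightSequence m) (hρ : IsDefiningFunction M U ρ) (hVU : V ⊆ U)
    (hZ : InGeneratedLieAlgebra univ (range Y) Z) :
    ∃ Z', InGeneratedLieAlgebra M (range X) Z' ∧ ∀ x ∈ M ∩ V, Z' x = Z x := by
  induction hZ with
  | base Z hZ => obtain ⟨j, rfl⟩ := hZ; exact ⟨X j, .base _ ⟨j, rfl⟩, h.eq j⟩
  | zero => exact ⟨0, .zero, fun _ _ => rfl⟩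
  | add A B _ _ hA hB =>
    obtain ⟨A', hA', hAA⟩ := hA
    obtain ⟨B', hB', hBB⟩ := hB
    exact ⟨A' + B', .add _ _ hA' hB', fun x hx => by simp [hAA x hx, hBB x hx]⟩
  | smul r A _ hA =>
    obtain ⟨A', hA', hAA⟩ := hA
    exact ⟨r • A', .smul _ _ hA', fun x hx => by simp [hAA x hx]⟩
  | bracket A B hA0 hB0 hA hB =>
    obtain ⟨A', hA', hAA⟩ := hA
    obtain ⟨B', hB', hBB⟩ := hB
    exact ⟨_, .bracket _ _ hA' hB', h.lieBracketWithin_eq hm hρ hVU hA0 hB0 hAA hBB⟩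

theorem exists_extension (h : IsTangentExtension m M V ρ X Y)
    (hm : IsRegularWeightSequence m) (hρ : IsDefiningFunction M U ρ) (hVU : V ⊆ U)
    (hZ : InGeneratedLieAlgebra M (range X) Z) :
    ∃ Z', InGeneratedLieAlgebra univ (range Y) Z' ∧ ∀ x ∈ M ∩ V, Z x = Z' x := by
  induction hZ with
  | base Z hZ => obtain ⟨j, rfl⟩ := hZ; exact ⟨Y j, .base _ ⟨j, rfl⟩, h.eq j⟩
  | zero => exact ⟨0, .zero, fun _ _ => rfl⟩
  | add A B _ _ hA hB =>
    obtain ⟨A', hA', hAA⟩ := hA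
    obtain ⟨B', hB', hBB⟩ := hB
    exact ⟨A' + B', .add _ _ hA' hB', fun x hx => by simp [hAA x hx, hBB x hx]⟩
  | smul r A _ hA =>
    obtain ⟨A', hA', hAA⟩ := hA
    exact ⟨r • A', .smul _ _ hA', fun x hx => by simp [hAA x hx]⟩
  | bracket A B _ _ hA hB =>
    obtain ⟨A', hA', hAA⟩ := hA
    obtain ⟨B', hB', hBB⟩ := hB
    exact ⟨_, .bracket _ _ hA' hB', h.lieBracketWithin_eq hm hρ hVU hA' hB' hAA hBB⟩

end IsTangentExtension

/-- The values at a point of the Lie algebra of vector fields generated by `D`. -/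
def generatedValues (D : Set (CSpace N → CSpace N)) (p : CSpace N) : Submodule ℝ (CSpace N) where
  carrier := {v | ∃ Z, InGeneratedLieAlgebra univ D Z ∧ Z p = v}
  zero_mem' := ⟨0, .zero, rfl⟩
  add_mem' := by
    rintro _ _ ⟨A, hA, rfl⟩ ⟨B, hB, rfl⟩
    exact ⟨_, .add _ _ hA hB, rfl⟩
  smul_mem' := by
    rintro r _ ⟨A, hA, rfl⟩
    exact ⟨_, .smul r _ hA, rfl⟩

theorem IsTangentExtension.generatedValues_eq (h : IsTangentExtension m M V ρ X Y)
    (hm : IsRegularWeightSequence m) (hρ : IsDefiningFunction M U ρ) (hVU : V ⊆ U) (hp : p ∈ M)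
    (hpV : p ∈ V) : (generatedValues (range Y) p : Set (CSpace N)) =
      {v | ∃ Z, InGeneratedLieAlgebra M (range X) Z ∧ Z p = v} := by
  ext v
  constructor
  · rintro ⟨Z, hZ, rfl⟩
    obtain ⟨Z', hZ', h'⟩ := h.exists_restriction hm hρ hVU hZ
    exact ⟨Z', hZ', h' p ⟨hp, hpV⟩⟩
  · rintro ⟨Z, hZ, rfl⟩
    obtain ⟨Z', hZ', h'⟩ := h.exists_extension hm hρ hVU hZ
    exact ⟨Z', hZ', (h' p ⟨hp, hpV⟩).symm⟩

theorem IsTangentExtension.generatedValues_le (h : IsTangentExtension m M V ρ X Y)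
    (hm : IsRegularWeightSequence m) (hρ : IsDefiningFunction M U ρ) (hVU : V ⊆ U) (hp : p ∈ M)
    (hpV : p ∈ V) : generatedValues (range Y) p ≤ realTangentSpace M p := by
  rintro _ ⟨Z, hZ, rfl⟩
  rw [hρ.mem_realTangentSpace_iff hp (hVU hpV)]
  exact h.fderiv_of_inGenerated hm hρ hVU hZ p hpV

end Extensions

/-! ### The leaf as a submanifold -/

section Graph

variable {N : ℕ} {m : ℕ → ℝ} {p : CSpace N}

/-- The image of a solution of a total differential equation of class `{m}` is a submanifold. -/
theorem isUltradifferentiableSubmanifold_image (hm : IsRegularWeightSequence m)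
    {V : Set (CSpace N)} (hV : IsOpen V) {T : Submodule ℝ (CSpace N)} {π : CSpace N →L[ℝ] T}
    (hπ : ∀ v : T, π v = v) {Z : CSpace N → T →L[ℝ] CSpace N} (hZ : IsUltradifferentiableOn m Z V)
    (hπZ : ∀ x ∈ V, ∀ v, π (Z x v) = v) {r : ℝ} (hr : 0 < r) {w : T → CSpace N} (hw0 : w 0 = p)
    (hw : ∀ v ∈ Metric.ball (0 : T) r, w v ∈ V ∧ HasFDerivAt w (Z (w v)) v) :
    IsUltradifferentiableSubmanifold m (w '' Metric.ball (0 : T) r) (Module.finrank ℝ T) := by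
  have h0 : (0 : T) ∈ Metric.ball (0 : T) r := Metric.mem_ball_self hr
  -- The derivative of `π ∘ w` is the identity, so the image of `w` is a graph over a ball in `T`.
  have hπw : ∀ v ∈ Metric.ball (0 : T) r, π (w v) - v = π p := by
    intro v hv
    have h1 := Convex.is_const_of_fderivWithin_eq_zero (𝕜 := ℝ) (convex_ball (0 : T) r)
      (f := fun v => π (w v) - v) (x := v) (y := 0) ?_ ?_ hv h0
    · simpa [hw0] using h1
    · intro v hv
      exact (((π.hasFDerivAt.comp v (hw v hv).2).sub (hasFDerivAt_id v))).differentiableAt.differentiableWithinAt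
    · intro v hv
      have h2 := (π.hasFDerivAt.comp v (hw v hv).2).sub (hasFDerivAt_id v)
      rw [fderivWithin_of_isOpen Metric.isOpen_ball hv]
      refine h2.fderiv.trans ?_
      ext a
      simp [hπZ _ (hw v hv).1]
  obtain ⟨q, hq, hqT⟩ : ∃ q : CSpace N →L[ℝ] EuclideanSpace ℝ (Fin (2 * N - Module.finrank ℝ T)),
      Function.Surjective q ∧ ∀ v, q v = 0 ↔ v ∈ T := by
    have h1 := Submodule.finrank_quotient_add_finrank T
    rw [finrank_real_cspace] at h1
    let e : (CSpace N ⧸ T) ≃ₗ[ℝ] EuclideanSpace ℝ (Fin (2 * N - Module.finrank ℝ T)) :=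
      LinearEquiv.ofFinrankEq _ _ (by rw [finrank_euclideanSpace_fin]; omega)
    refine ⟨LinearMap.toContinuousLinearMap (e.toLinearMap.comp T.mkQ),
      e.surjective.comp T.mkQ_surjective, fun v => ?_⟩
    simp
  have hTle : Module.finrank ℝ T ≤ 2 * N := by
    rw [← finrank_real_cspace]
    exact T.finrank_le
  set U : Set (CSpace N) := {x | π x - π p ∈ Metric.ball (0 : T) r} with hU
  have hUo : IsOpen U := Metric.isOpen_ball.preimage (by fun_prop)
  -- `W x` is the point of the graph with the same `π`-coordinate as `x`. It solves `DW = Z(W) ∘ π`,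
  -- hence is of class `{m}`, and the graph is cut out by `x - W x = 0` modulo `T`.
  set W : CSpace N → CSpace N := fun x => w (π x - π p) with hW
  have hWd : ∀ x ∈ U, HasFDerivAt W ((Z (W x)).comp π) x := fun x hx =>
    (hw _ hx).2.comp x (π.hasFDerivAt.sub_const (π p))
  have hWm : IsUltradifferentiableOn m W U :=
    IsUltradifferentiableOn.comp_total (Φ := fun y => (Z y).comp π) (g := fun y => y) hm hV hUo
      (hZ.clm_mul hm (IsUltradifferentiableOn.const hm π) hV)
      (IsUltradifferentiableOn.clm hm (ContinuousLinearMap.id ℝ (CSpace N)))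
      (fun x hx => (hw _ hx).1) hWd
  have hρm : IsUltradifferentiableOn m (fun x => q (x - W x)) U :=
    ((IsUltradifferentiableOn.clm hm (ContinuousLinearMap.id ℝ (CSpace N))).sub hm hWm
      hUo).clm_comp hUo q
  have hwU : ∀ v ∈ Metric.ball (0 : T) r, π (w v) - π p = v := fun v hv => by
    rw [← hπw v hv, sub_sub_cancel]
  rintro _ ⟨v, hv, rfl⟩
  refine ⟨_, U, fun x => q (x - W x), by omega, hUo, ?_, hρm, fun x hx y => ?_, ?_⟩
  · change π (w v) - π p ∈ Metric.ball (0 : T) r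
    rwa [hwU v hv]
  · obtain ⟨u, rfl⟩ := hq y
    have h1 : HasFDerivAt (fun x => q (x - W x))
        (q.comp (ContinuousLinearMap.id ℝ _ - (Z (W x)).comp π)) x :=
      q.hasFDerivAt.comp x ((hasFDerivAt_id x).sub (hWd x hx))
    refine ⟨u - π u, ?_⟩
    have h2 : q (π u) = 0 := (hqT _).2 (π u).2
    rw [h1.fderiv]
    simp [hπ, h2]
  · ext x
    constructor
    · rintro ⟨⟨v, hv, rfl⟩, hx⟩
      refine ⟨hx, ?_⟩
      simp [hW, hwU v hv]
    · rintro ⟨hx, h1⟩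
      -- The difference lies in `T` and `π` annihilates it, so it is zero.
      have h2 : x - W x ∈ T := (hqT _).1 h1
      have h3 : π (x - W x) = ⟨x - W x, h2⟩ := hπ ⟨x - W x, h2⟩
      have h4 : π (x - W x) = 0 := by
        have := hπw _ hx
        rw [map_sub]
        rw [sub_sub_eq_add_sub, sub_eq_iff_eq_add, add_comm (π p)] at this
        rw [sub_eq_zero]
        exact (add_right_cancel this).symm
      have h5 : x - W x = 0 := by
        rw [h4] at h3
        exact (congrArg Subtype.val h3).symm
      exact ⟨⟨_, hx, (sub_eq_zero.1 h5).symm⟩, hx⟩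

end Graph

/-- If `M` is minimal at `p` within the quasianalytic class `{m}`, then it is of finite type. -/
theorem isFiniteTypeAt_of_isMinimalAt {N : ℕ} {m : ℕ → ℝ} (hm : IsRegularWeightSequence m)
    (hq : IsQuasianalyticSequence m) {d n : ℕ} {M : Set (CSpace N)}
    (hM : IsUltradifferentiableCRSubmanifold m M d n) {p : CSpace N} (hp : p ∈ M)
    (hmin : IsMinimalAt (IsUltradifferentiableSubmanifold m) M d p) : IsFiniteTypeAt m M p := by
  have hX := isComplexTangentSection_canonicalSection hm hM
  obtain ⟨c, U, ρ, hd, hpU, hρ, hρm⟩ := exists_definingFunction_ultra hM.submanifold hp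
  obtain ⟨V, Y, hpV, hVU, h⟩ := exists_isTangentExtension hm hX hρ hρm hp hpU
  refine ⟨2 * N, canonicalSection M, hX, ?_⟩
  rw [← h.generatedValues_eq hm hρ hVU hp hpV]
  by_contra hne
  refine hmin ?_
  set T := generatedValues (range Y) p with hT
  have hTle : T ≤ realTangentSpace M p := h.generatedValues_le hm hρ hVU hp hpV
  have hTlt : Module.finrank ℝ T < d := by
    rw [← hρ.finrank_realTangentSpace hp hpU hd]
    refine Submodule.finrank_lt_finrank_of_lt (lt_of_le_of_ne hTle fun h => hne ?_)
    rw [h]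
  obtain ⟨π, hπ⟩ : ∃ π : CSpace N →L[ℝ] T, ∀ v : T, π v = v :=
    Submodule.ClosedComplemented.of_finiteDimensional T
  obtain ⟨V', hV', hpV', hV'V, Z, hZ, hπZ, hZs, r, hr, w, hw0, hw⟩ :=
    exists_nagano_leaf hm hq h.isOpen hpV (L := {Z | InGeneratedLieAlgebra univ (range Y) Z})
      (fun Z hZ => h.ultra_of_inGenerated hm hZ)
      (fun A hA B hB => by
        have := InGeneratedLieAlgebra.bracket A B hA hB
        rwa [VectorField.lieBracketWithin_univ] at this)
      (T := T) (fun Z hZ => ⟨Z, hZ, rfl⟩) (fun v hv => hv) hπ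
  have h0 : (0 : T) ∈ Metric.ball (0 : T) r := Metric.mem_ball_self hr
  -- The leaf stays in `M`: its tangent directions are spanned by values of generated fields, all of
  -- which annihilate `dρ`.
  have hρw : ∀ v ∈ Metric.ball (0 : T) r, ρ (w v) = 0 := by
    intro v hv
    have hder : ∀ v ∈ Metric.ball (0 : T) r, HasFDerivAt (fun v => ρ (w v)) (0 : T →L[ℝ] _) v := by
      intro v hv
      obtain ⟨hwV, hwd, -⟩ := hw v hv
      have h1 := ((hρ.contDiffAt (hVU (hV'V hwV))).differentiableAt
        (by simp)).hasFDerivAt.comp v hwd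
      refine h1.congr_fderiv ?_
      ext1 a
      have h2 : Submodule.span ℝ {y | ∃ A, InGeneratedLieAlgebra univ (range Y) A ∧ A (w v) = y} ≤
          LinearMap.ker (fderiv ℝ ρ (w v) : CSpace N →ₗ[ℝ] EuclideanSpace ℝ (Fin c)) := by
        rw [Submodule.span_le]
        rintro _ ⟨A, hA, rfl⟩
        exact h.fderiv_of_inGenerated hm hρ hVU hA _ (hV'V hwV)
      exact h2 (hZs _ hwV a)
    have h1 := Convex.is_const_of_fderivWithin_eq_zero (𝕜 := ℝ) (convex_ball (0 : T) r)
      (f := fun v => ρ (w v)) (x := v) (y := 0)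
      (fun v hv => (hder v hv).differentiableAt.differentiableWithinAt)
      (fun v hv => by
        rw [fderivWithin_of_isOpen Metric.isOpen_ball hv]
        exact (hder v hv).fderiv) hv h0
    rw [h1, hw0]
    exact hρ.eq_zero hp hpU
  have hwM : ∀ v ∈ Metric.ball (0 : T) r, w v ∈ M := fun v hv =>
    hρ.mem (hVU (hV'V (hw v hv).1)) (hρw v hv)
  refine ⟨w '' Metric.ball (0 : T) r, _, isUltradifferentiableSubmanifold_image hm hV' hπ hZ hπZ hr
    hw0 fun v hv => ⟨(hw v hv).1, (hw v hv).2.1⟩, image_subset_iff.2 hwM, ⟨0, h0, hw0⟩, hTlt, ?_⟩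
  rintro _ ⟨v, hv, rfl⟩ u hu
  obtain ⟨hwV, hwd, hwZ⟩ := hw v hv
  refine (Submodule.span_le.2 ?_) (mem_span_canonicalSection hu)
  rintro _ ⟨j, rfl⟩
  change canonicalSection M j (w v) ∈ _
  rw [h.eq j (w v) ⟨hwM v hv, hV'V hwV⟩, ← hwZ (Y j) (.base _ ⟨j, rfl⟩)]
  -- The curve `t ↦ w (v + t a)` on the leaf has velocity `Z (w v) a = Y j (w v)`.
  set a := π (Y j (w v)) with ha
  have hc : HasDerivAt (fun t : ℝ => v + t • a) a 0 := by
    simpa using ((hasDerivAt_id (0 : ℝ)).smul_const a).const_add v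
  refine Submodule.subset_span ⟨fun t => w (v + t • a), by simp, ?_, ?_⟩
  · have h1 : ∀ᶠ t : ℝ in 𝓝 0, v + t • a ∈ Metric.ball (0 : T) r :=
      hc.continuousAt.eventually_mem (Metric.isOpen_ball.mem_nhds (by simpa using hv))
    filter_upwards [h1] with t ht using ⟨_, ht, rfl⟩
  · have h1 : HasFDerivAt w (Z (w v)) (v + (0 : ℝ) • a) := by simpa using hwd
    exact h1.comp_hasDerivAt (0 : ℝ) hc

/-! ### Flows and their differentials -/

section Flow

variable {E F : Type*} [NormedAddCommGroup E] [NormedSpace ℝ E] [NormedAddCommGroup F]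
  [NormedSpace ℝ F]

/-- Gronwall's inequality in both time directions. -/
theorem norm_le_gronwallBound_abs {η η' : ℝ → E} {T δ K ε : ℝ}
    (h : ∀ t ∈ Ioo (-T) T, HasDerivAt η (η' t) t)
    (hb : ∀ t ∈ Ioo (-T) T, ‖η' t‖ ≤ K * ‖η t‖ + ε) (h0 : ‖η 0‖ ≤ δ) {t : ℝ}
    (ht : t ∈ Ioo (-T) T) : ‖η t‖ ≤ gronwallBound δ K ε |t| := by
  have key : ∀ {η η' : ℝ → E}, (∀ t ∈ Ioo (-T) T, HasDerivAt η (η' t) t) →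
      (∀ t ∈ Ioo (-T) T, ‖η' t‖ ≤ K * ‖η t‖ + ε) → ‖η 0‖ ≤ δ → ∀ t ∈ Ico 0 T,
      ‖η t‖ ≤ gronwallBound δ K ε t := by
    intro η η' h hb h0 t ht
    have hs : Icc 0 t ⊆ Ioo (-T) T := fun s hs =>
      ⟨by linarith [hs.1, ht.1, ht.2], by linarith [hs.2, ht.2]⟩
    simpa using norm_le_gronwallBound_of_norm_deriv_right_le (a := 0) (b := t)
      (fun s hs' => (h s (hs hs')).continuousAt.continuousWithinAt)
      (fun s hs' => (h s (hs (Ico_subset_Icc_self hs'))).hasDerivWithinAt) h0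
      (fun s hs' => hb s (hs (Ico_subset_Icc_self hs'))) t ⟨ht.1, le_rfl⟩
  rcases le_total 0 t with h1 | h1
  · rw [abs_of_nonneg h1]
    exact key h hb h0 t ⟨h1, ht.2⟩
  · rw [abs_of_nonpos h1]
    have hneg : ∀ {s}, s ∈ Ioo (-T) T → -s ∈ Ioo (-T) T := fun hs =>
      ⟨by linarith [hs.2], by linarith [hs.1]⟩
    have := key (η := fun s => η (-s)) (η' := fun s => -η' (-s))
      (fun s hs => by
        simpa [Function.comp_def] using (h (-s) (hneg hs)).scomp s (hasDerivAt_neg s))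
      (fun s hs => by simpa using hb (-s) (hneg hs)) (by simpa using h0) (-t)
      ⟨by linarith, by linarith [ht.1]⟩
    simpa using this

/-- `θ` is the flow of `f` on the time interval `(-1, 1)`. -/
structure IsUnitTimeFlow (f : E → E) (θ : ℝ → E → E) : Prop where
  zero : ∀ x, θ 0 x = x
  hasDerivAt : ∀ x, ∀ t ∈ Ioo (-1 : ℝ) 1, HasDerivAt (fun t => θ t x) (f (θ t x)) t

theorem exists_isUnitTimeFlow [CompleteSpace E] {f : E → E} {K : NNReal} (hK : LipschitzWith K f)
    (hb : ∀ x, ‖f x‖ ≤ K) : ∃ θ, IsUnitTimeFlow f θ := by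
  choose γ h0 h using exists_solution_of_lipschitz hK hb 1
  exact ⟨fun t x => γ x t, h0, fun x t ht => h x t (by simpa using ht)⟩

/-- Strict differentiability from a quadratic bound. -/
theorem hasStrictFDerivAt_of_quadratic_bound {f : E → F} {f' : E →L[ℝ] F} {x : E} {C : ℝ}
    {s : Set E} (hs : s ∈ 𝓝 x)
    (h : ∀ a ∈ s, ∀ b ∈ s, ‖f a - f b - f' (a - b)‖ ≤ C * max ‖a - x‖ ‖b - x‖ * ‖a - b‖) :
    HasStrictFDerivAt f f' x := by
  rw [hasStrictFDerivAt_iff_isLittleO, Asymptotics.isLittleO_iff]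
  intro ε hε
  have h1 : Tendsto (fun z : E × E => C * max ‖z.1 - x‖ ‖z.2 - x‖) (𝓝 (x, x)) (𝓝 0) := by
    have : Continuous fun z : E × E => C * max ‖z.1 - x‖ ‖z.2 - x‖ := by fun_prop
    simpa using this.tendsto (x, x)
  filter_upwards [h1.eventually_lt_const hε, prod_mem_nhds hs hs] with z hz1 hz2
  exact (h _ hz2.1 _ hz2.2).trans (by gcongr)

theorem eq_of_solutions {f : E → E} {K : NNReal} (hK : LipschitzWith K f) {α β : ℝ → E} {T : ℝ}
    (hα : ∀ t ∈ Ioo (-T) T, HasDerivAt α (f (α t)) t)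
    (hβ : ∀ t ∈ Ioo (-T) T, HasDerivAt β (f (β t)) t) (h0 : α 0 = β 0) {t : ℝ}
    (ht : t ∈ Ioo (-T) T) : α t = β t := by
  have := norm_le_gronwallBound_abs (δ := 0) (K := K) (ε := 0)
    (fun s hs => (hα s hs).sub (hβ s hs)) (fun s _ => by simpa using hK.norm_sub_le _ _)
    (by simp [h0]) ht
  rw [gronwallBound_ε0_δ0] at this
  exact sub_eq_zero.1 (norm_le_zero_iff.1 this)

namespace IsUnitTimeFlow

variable {f : E → E} {θ : ℝ → E → E} {K : NNReal}

theorem norm_sub_le (h : IsUnitTimeFlow f θ) (hK : LipschitzWith K f) {t : ℝ}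
    (ht : t ∈ Ioo (-1 : ℝ) 1) (a b : E) : ‖θ t a - θ t b‖ ≤ Real.exp K * ‖a - b‖ := by
  have := norm_le_gronwallBound_abs (δ := ‖a - b‖) (K := K) (ε := 0)
    (fun s hs => (h.hasDerivAt a s hs).sub (h.hasDerivAt b s hs))
    (fun s _ => by simpa using hK.norm_sub_le _ _) (by simp [h.zero]) ht
  rw [gronwallBound_ε0] at this
  refine this.trans ?_
  rw [mul_comm]
  gcongr
  have := abs_lt.2 ht
  exact mul_le_of_le_one_right K.2 this.le

theorem norm_time_sub_le (h : IsUnitTimeFlow f θ) (hb : ∀ x, ‖f x‖ ≤ K) {s t : ℝ}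
    (hs : s ∈ Ioo (-1 : ℝ) 1) (ht : t ∈ Ioo (-1 : ℝ) 1) (x : E) :
    ‖θ t x - θ s x‖ ≤ K * |t - s| :=
  norm_curve_sub_le (h.hasDerivAt x) (fun _ _ => hb _) hs ht

theorem norm_sub_self_le (h : IsUnitTimeFlow f θ) (hb : ∀ x, ‖f x‖ ≤ K) {t : ℝ}
    (ht : t ∈ Ioo (-1 : ℝ) 1) (x : E) : ‖θ t x - x‖ ≤ K * |t| := by
  simpa [h.zero] using h.norm_time_sub_le hb (s := 0) (by norm_num) ht x

theorem neg_apply (h : IsUnitTimeFlow f θ) (hK : LipschitzWith K f) {t : ℝ}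
    (ht : t ∈ Ioo (-(1 / 2) : ℝ) (1 / 2)) (x : E) : θ (-t) (θ t x) = x := by
  have h1 := eq_of_solutions hK (α := fun s => θ (t + s) x) (β := fun s => θ s (θ t x))
    (T := 1 / 2) (t := -t) (fun s hs => ?_) (fun s hs => ?_) (by simp [h.zero])
    ⟨by linarith [ht.2], by linarith [ht.1]⟩
  · simpa [h.zero] using h1.symm
  · have := h.hasDerivAt x (t + s) ⟨by linarith [hs.1, ht.1], by linarith [hs.2, ht.2]⟩
    exact this.comp_const_add t s
  · exact h.hasDerivAt _ s ⟨by linarith [hs.1], by linarith [hs.2]⟩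

/-- The flow is strictly differentiable in time and space at time zero. -/
theorem hasStrictFDerivAt_zero (h : IsUnitTimeFlow f θ) (hK : LipschitzWith K f)
    (hb : ∀ x, ‖f x‖ ≤ K) (x : E) :
    HasStrictFDerivAt (fun z : ℝ × E => θ z.1 z.2)
      ((ContinuousLinearMap.fst ℝ ℝ E).smulRight (f x) + ContinuousLinearMap.snd ℝ ℝ E)
      (0, x) := by
  have hs : Ioo (-1 : ℝ) 1 ×ˢ univ ∈ 𝓝 ((0 : ℝ), x) :=
    prod_mem_nhds (Ioo_mem_nhds (by norm_num) (by norm_num)) univ_mem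
  refine hasStrictFDerivAt_of_quadratic_bound
    (C := K * Real.exp K + K * (K + 1)) hs ?_
  rintro ⟨s, a⟩ ⟨hs, -⟩ ⟨t, b⟩ ⟨ht, -⟩
  simp only at hs ht
  set m := max ‖((s, a) : ℝ × E) - (0, x)‖ ‖((t, b) : ℝ × E) - (0, x)‖ with hm
  set D := ‖((s, a) : ℝ × E) - (t, b)‖ with hD
  have hsm : |s| ≤ m := by
    refine le_trans ?_ (le_max_left _ _)
    simp
  have htm : |t| ≤ m := by
    refine le_trans ?_ (le_max_right _ _)
    simp
  have hbm : ‖b - x‖ ≤ m := by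
    refine le_trans ?_ (le_max_right _ _)
    simp
  have hDst : |s - t| ≤ D := norm_fst_le (((s, a) : ℝ × E) - (t, b))
  have hDab : ‖a - b‖ ≤ D := norm_snd_le (((s, a) : ℝ × E) - (t, b))
  -- The increment is split into a change of starting point at fixed time and, in `h2`, a change of
  -- time at fixed starting point.
  have h1 : ‖θ s a - θ s b - (a - b)‖ ≤ K * (Real.exp K * ‖a - b‖) * |s| := by
    have := norm_curve_sub_le (T := 1) (fun u hu => (h.hasDerivAt a u hu).sub (h.hasDerivAt b u hu))
      (C := K * (Real.exp K * ‖a - b‖)) (fun u hu => (hK.norm_sub_le _ _).trans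
        (by gcongr; exact h.norm_sub_le hK hu a b)) (s := 0) (by norm_num) hs
    simpa [h.zero] using this
  have h2 : ‖θ s b - θ t b - (s - t) • f x‖ ≤ K * ((K + 1) * m) * |s - t| := by
    have hsub : ∀ u ∈ Icc (-m) m ∩ Ioo (-1 : ℝ) 1, HasDerivWithinAt (fun u => θ u b - u • f x)
        (f (θ u b) - f x) (Icc (-m) m ∩ Ioo (-1 : ℝ) 1) u := fun u hu => by
      simpa [Pi.sub_def] using ((h.hasDerivAt b u hu.2).sub ((hasDerivAt_id u).smul_const (f x))).hasDerivWithinAt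
    have := Convex.norm_image_sub_le_of_norm_hasDerivWithin_le (C := K * ((K + 1) * m)) hsub
      (fun u hu => ?_) ((convex_Icc _ _).inter (convex_Ioo _ _)) ⟨abs_le.1 htm, ht⟩
      ⟨abs_le.1 hsm, hs⟩
    · rw [Real.norm_eq_abs] at this
      convert this using 2
      rw [sub_smul]; abel
    · refine (hK.norm_sub_le _ _).trans ?_
      gcongr
      calc ‖θ u b - x‖ ≤ ‖θ u b - b‖ + ‖b - x‖ := norm_sub_le_norm_sub_add_norm_sub _ _ _
        _ ≤ K * m + m := by
            gcongr
            exact (h.norm_sub_self_le hb hu.2 b).trans (by gcongr; exact abs_le.2 hu.1)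
        _ = (K + 1) * m := by ring
  have hm0 : 0 ≤ m := (abs_nonneg _).trans hsm
  calc _ = ‖(θ s a - θ s b - (a - b)) + (θ s b - θ t b - (s - t) • f x)‖ := by
        congr 1
        simp
        abel
    _ ≤ K * (Real.exp K * ‖a - b‖) * |s| + K * ((K + 1) * m) * |s - t| :=
        (norm_add_le _ _).trans (add_le_add h1 h2)
    _ ≤ K * (Real.exp K * D) * m + K * ((K + 1) * m) * D := by gcongr
    _ = _ := by ring

/-- The linearized flow along an orbit is the derivative of the flow. -/
theorem hasStrictFDerivAt_of_variational (h : IsUnitTimeFlow f θ) (hf : Differentiable ℝ f)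
    (hK : LipschitzWith K f) (hK' : LipschitzWith K (fderiv ℝ f))
    (hb : ∀ x, ‖fderiv ℝ f x‖ ≤ K) {x : E} {B : ℝ → E →L[ℝ] E}
    {δ : ℝ} (hδ : δ ≤ 1) (hB0 : B 0 = ContinuousLinearMap.id ℝ E)
    (hB : ∀ t ∈ Ioo (-δ) δ, HasDerivAt B ((fderiv ℝ f (θ t x)).comp (B t)) t) {t : ℝ}
    (ht : t ∈ Ioo (-δ) δ) : HasStrictFDerivAt (θ t) (B t) x := by
  refine hasStrictFDerivAt_of_quadratic_bound
    (C := K * Real.exp K * Real.exp K * gronwallBound 0 K 1 |t|) univ_mem fun a _ b _ => ?_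
  have hsub : Ioo (-δ) δ ⊆ Ioo (-1 : ℝ) 1 := Ioo_subset_Ioo (by linarith) hδ
  set m := max ‖a - x‖ ‖b - x‖ with hm
  have := norm_le_gronwallBound_abs (δ := 0) (K := K)
    (ε := K * (Real.exp K * m) * (Real.exp K * ‖a - b‖))
    (η := fun s => θ s a - θ s b - B s (a - b))
    (fun s hs => ((h.hasDerivAt a s (hsub hs)).sub (h.hasDerivAt b s (hsub hs))).sub
      ((hB s hs).clm_apply (hasDerivAt_const s (a - b)))) (fun s hs => ?_)
    (by simp [h.zero, hB0]) ht
  · rw [gronwallBound_zero_left] at this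
    refine this.trans (le_of_eq ?_)
    ring
  · have h1 := norm_sub_sub_le_of_lipschitz_fderiv hf hK' (θ s a) (θ s b) (θ s x)
    have h2 := h.norm_sub_le hK (hsub hs)
    calc _ = ‖fderiv ℝ f (θ s x) (θ s a - θ s b - B s (a - b)) +
          (f (θ s a) - f (θ s b) - fderiv ℝ f (θ s x) (θ s a - θ s b))‖ := by
          congr 1
          simp
      _ ≤ K * ‖θ s a - θ s b - B s (a - b)‖ +
          K * max ‖θ s a - θ s x‖ ‖θ s b - θ s x‖ * ‖θ s a - θ s b‖ := by
          refine (norm_add_le _ _).trans (add_le_add ?_ h1)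
          exact (ContinuousLinearMap.le_opNorm _ _).trans (by gcongr; exact hb _)
      _ ≤ _ := by
          gcongr
          · rw [hm, mul_max_of_nonneg _ _ (Real.exp_pos _).le]
            exact max_le_max (h2 a x) (h2 b x)
          · exact h2 a b

/-- Solutions of the variational equation exist for small times. -/
theorem exists_variational [FiniteDimensional ℝ E] (h : IsUnitTimeFlow f θ)
    (hf : ContDiff ℝ ∞ f) (hK : LipschitzWith K f) (x : E) :
    ∃ (B : ℝ → E →L[ℝ] E) (δ : ℝ), 0 < δ ∧ δ ≤ 1 ∧ B 0 = ContinuousLinearMap.id ℝ E ∧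
      ∀ t ∈ Ioo (-δ) δ, HasDerivAt B ((fderiv ℝ f (θ t x)).comp (B t)) t := by
  have : CompleteSpace E := FiniteDimensional.complete ℝ E
  set P : E × (E →L[ℝ] E) → E × (E →L[ℝ] E) := fun z => (f z.1, (fderiv ℝ f z.1).comp z.2) with hP
  have hPc : ContDiff ℝ ∞ P :=
    (hf.comp contDiff_fst).prodMk (((hf.fderiv_right (m := ∞) (by simp)).comp contDiff_fst).clm_comp
      contDiff_snd)
  set z₀ : E × (E →L[ℝ] E) := (x, ContinuousLinearMap.id ℝ E)
  obtain ⟨χ, hχ, hχc, hχs, hχ1⟩ := exists_cutoff z₀ one_pos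
  have hQ : ContDiff ℝ ∞ fun z => χ z • P z := hχ.smul hPc
  obtain ⟨L, hL1, -, hL3, -⟩ := exists_global_bounds hQ (hχc.smul_right (f' := P))
  obtain ⟨γ, hγ0, hγ⟩ := exists_solution_of_lipschitz hL1 hL3 1 z₀
  simp only [NNReal.coe_one] at hγ
  -- The cut-off augmented system has speed at most `L`, so up to time `δ` its solution stays in the
  -- unit ball around `z₀`, where the cutoff is `1`.
  set δ : ℝ := 1 / (L + 1) with hδ
  have hδ0 : 0 < δ := by positivity
  have hδ1 : δ ≤ 1 := by
    rw [hδ, div_le_one (by positivity)]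
    linarith [L.2]
  have hsub : Ioo (-δ) δ ⊆ Ioo (-1 : ℝ) 1 := Ioo_subset_Ioo (by linarith) hδ1
  have hγP : ∀ t ∈ Ioo (-δ) δ, HasDerivAt γ (P (γ t)) t := by
    intro t ht
    have h1 := norm_curve_sub_le hγ (fun t _ => hL3 _) (s := 0) (by norm_num) (hsub ht)
    rw [hγ0, sub_zero] at h1
    have h2 : |t| < 1 / (L + 1) := abs_lt.2 ht
    rw [lt_div_iff₀ (by positivity)] at h2
    have h3 : χ (γ t) = 1 := hχ1 _ (mem_closedBall_iff_norm.2 (h1.trans (by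
      nlinarith [abs_nonneg t])))
    simpa [h3] using hγ t (hsub ht)
  have h1 : ∀ t ∈ Ioo (-δ) δ, HasDerivAt (fun t => (γ t).1) (f (γ t).1) t := fun t ht =>
    (ContinuousLinearMap.fst ℝ E (E →L[ℝ] E)).hasFDerivAt.comp_hasDerivAt t (hγP t ht)
  have h2 : ∀ t ∈ Ioo (-δ) δ, HasDerivAt (fun t => (γ t).2)
      ((fderiv ℝ f (γ t).1).comp (γ t).2) t := fun t ht =>
    (ContinuousLinearMap.snd ℝ E (E →L[ℝ] E)).hasFDerivAt.comp_hasDerivAt t (hγP t ht)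
  refine ⟨fun t => (γ t).2, δ, hδ0, hδ1, by simp [hγ0, z₀], fun t ht => ?_⟩
  rw [← eq_of_solutions hK h1 (fun s hs => h.hasDerivAt x s (hsub hs)) (by simp [h.zero, hγ0, z₀]) ht]
  exact h2 t ht

/-- Derivatives of the flow for small times. -/
theorem exists_derivatives [FiniteDimensional ℝ E] (h : IsUnitTimeFlow f θ)
    (hf : ContDiff ℝ ∞ f) (hK : LipschitzWith K f) (hK' : LipschitzWith K (fderiv ℝ f))
    (hb : ∀ x, ‖fderiv ℝ f x‖ ≤ K) (x : E) :
    ∃ B C : ℝ → E →L[ℝ] E, C 0 = ContinuousLinearMap.id ℝ E ∧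
      HasDerivAt C (-fderiv ℝ f x) 0 ∧ ∀ᶠ t in 𝓝 0,
        HasStrictFDerivAt (θ t) (B t) x ∧ HasStrictFDerivAt (θ (-t)) (C t) (θ t x) := by
  have : CompleteSpace E := FiniteDimensional.complete ℝ E
  obtain ⟨B, δ, hδ0, hδ1, hB0, hB⟩ := h.exists_variational hf hK x
  have h0 : (0 : ℝ) ∈ Ioo (-δ) δ := ⟨by linarith, hδ0⟩
  have hB0' := hB 0 h0
  rw [h.zero, hB0, ContinuousLinearMap.comp_id] at hB0'
  have hu : ((1 : (E →L[ℝ] E)ˣ) : E →L[ℝ] E) = B 0 := hB0.symm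
  have hinv : HasFDerivAt Ring.inverse
      (-ContinuousLinearMap.mulLeftRight ℝ (E →L[ℝ] E) 1 1) (B 0) := by
    have := hasFDerivAt_ringInverse (𝕜 := ℝ) (1 : (E →L[ℝ] E)ˣ)
    rw [hu] at this
    simpa using this
  -- The backward flow inverts the forward one, so its differential is `(B t)⁻¹`, whose derivative
  -- at `0` is `-B'(0)`.
  refine ⟨B, fun t => Ring.inverse (B t), ?_, ?_, ?_⟩
  · simp only [hB0]
    exact Ring.inverse_one _
  · simpa [Function.comp_def] using hinv.comp_hasDerivAt 0 hB0'
  · have hunit : ∀ᶠ t in 𝓝 (0 : ℝ), IsUnit (B t) :=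
      hB0'.continuousAt.eventually_mem (Units.isOpen.mem_nhds (by rw [← hu]; exact Units.isUnit _))
    have hlt : ∀ᶠ t in 𝓝 (0 : ℝ), t ∈ Ioo (-δ) δ := isOpen_Ioo.mem_nhds h0
    have hlt' : ∀ᶠ t in 𝓝 (0 : ℝ), t ∈ Ioo (-(1 / 2) : ℝ) (1 / 2) :=
      Ioo_mem_nhds (by norm_num) (by norm_num)
    filter_upwards [hunit, hlt, hlt'] with t ht1 ht2 ht3
    have hs := h.hasStrictFDerivAt_of_variational (hf.differentiable (by simp)) hK hK' hb hδ1 hB0 hB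
      ht2
    have ht3' : -t ∈ Ioo (-(1 / 2) : ℝ) (1 / 2) := ⟨by linarith [ht3.2], by linarith [ht3.1]⟩
    refine ⟨hs, ?_⟩
    obtain ⟨u, hu⟩ := ht1
    let e : E ≃L[ℝ] E := ContinuousLinearEquiv.unitsEquiv ℝ E u
    have he : (e : E →L[ℝ] E) = B t := by rw [← hu]; rfl
    have he' : (e.symm : E →L[ℝ] E) = Ring.inverse (B t) := by
      rw [← hu, Ring.inverse_unit]; rfl
    rw [← he']
    have hx := h.neg_apply hK ht3 x
    refine HasStrictFDerivAt.of_local_left_inverse (f := θ t) ?_ ?_ (Eventually.of_forall fun y => ?_)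
    · have hlip : LipschitzWith (Real.toNNReal (Real.exp K)) (θ (-t)) :=
        LipschitzWith.of_dist_le_mul fun a b => by
          rw [dist_eq_norm, dist_eq_norm, Real.coe_toNNReal _ (Real.exp_pos _).le]
          exact h.norm_sub_le hK ⟨by linarith [ht3.2], by linarith [ht3.1]⟩ a b
      exact hlip.continuous.continuousAt
    · rw [hx, he]
      exact hs
    · simpa using h.neg_apply hK ht3' y

end IsUnitTimeFlow

end Flow

/-! ### Concatenation of steps -/

section ReachedIn

variable {α : Type*} {r : α → α → Prop} {x y z : α} {I J : ℕ}

/-- `y` is reached from `x` by `J` steps of the relation `r`. -/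
def ReachedIn (r : α → α → Prop) (J : ℕ) (x y : α) : Prop :=
  ∃ q : ℕ → α, q 0 = x ∧ q J = y ∧ ∀ j < J, r (q j) (q (j + 1))

namespace ReachedIn

theorem refl (r : α → α → Prop) (x : α) : ReachedIn r 0 x x := ⟨fun _ => x, rfl, rfl, by simp⟩

theorem single (h : r x y) : ReachedIn r 1 x y :=
  ⟨fun j => if j = 0 then x else y, by simp, by simp, fun j hj => by
    obtain rfl : j = 0 := by omega
    simpa using h⟩

theorem trans (h : ReachedIn r I x y) (h' : ReachedIn r J y z) : ReachedIn r (I + J) x z := by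
  obtain ⟨q, h0, hI, hq⟩ := h
  obtain ⟨q', h0', hJ, hq'⟩ := h'
  have hv : ∀ j, (if I + j ≤ I then q (I + j) else q' (I + j - I)) = q' j := by
    intro j
    rcases Nat.eq_zero_or_pos j with rfl | hj
    · simp [hI, h0']
    · rw [if_neg (by omega), Nat.add_sub_cancel_left]
  refine ⟨fun j => if j ≤ I then q j else q' (j - I), by simp [h0], by simpa [hJ] using hv J,
    fun j hj => ?_⟩
  rcases lt_or_ge j I with h1 | h1
  · have h2 : j + 1 ≤ I := h1
    simpa only [if_pos h1.le, if_pos h2] using hq j h1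
  · obtain ⟨i, rfl⟩ := Nat.exists_eq_add_of_le h1
    have := hq' i (by omega)
    rw [← hv i, ← hv (i + 1)] at this
    exact this

end ReachedIn

end ReachedIn

theorem Submodule.mem_of_hasDerivAt_of_eventually_mem {E : Type*} [NormedAddCommGroup E]
    [NormedSpace ℝ E] [FiniteDimensional ℝ E] {W : Submodule ℝ E} {g : ℝ → E} {g' : E} {t : ℝ}
    (hg : HasDerivAt g g' t) (h : ∀ᶠ s in 𝓝 t, g s ∈ W) : g' ∈ W := by
  obtain ⟨π, hπ⟩ : ∃ π : E →L[ℝ] W, ∀ v : W, π v = v :=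
    Submodule.ClosedComplemented.of_finiteDimensional W
  have h1 : HasDerivAt (fun s => (π (g s) : E)) (π g' : E) t :=
    (W.subtypeL.comp π).hasFDerivAt.comp_hasDerivAt t hg
  have h2 : (fun s => (π (g s) : E)) =ᶠ[𝓝 t] g := by
    filter_upwards [h] with s hs
    exact congrArg Subtype.val (hπ ⟨g s, hs⟩)
  rw [← (h1.congr_of_eventuallyEq h2.symm).unique hg]
  exact (π g').2

/-! ### Chow's theorem for control systems -/

section Chow

variable {E : Type} [NormedAddCommGroup E] [NormedSpace ℝ E] {ι : Type*}

/-- A family of local flows `θ j` of vector fields `f j`, defined near points of `B`, that moves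
points of `M` along the relation `r`. -/
structure IsControlSystem (M B : Set E) (r : E → E → Prop) (f : ι → E → E)
    (θ : ι → ℝ → E → E) : Prop where
  isOpen : IsOpen B
  strict : ∀ j, ∀ x ∈ B, HasStrictFDerivAt (fun z : ℝ × E => θ j z.1 z.2)
    ((ContinuousLinearMap.fst ℝ ℝ E).smulRight (f j x) + ContinuousLinearMap.snd ℝ ℝ E) (0, x)
  zero : ∀ j x, θ j 0 x = x
  inverse : ∀ j, ∀ᶠ t in 𝓝 0, ∀ x, θ j (-t) (θ j t x) = x
  derivatives : ∀ j, ∀ x ∈ B, ∃ b c : ℝ → E →L[ℝ] E, c 0 = ContinuousLinearMap.id ℝ E ∧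
      HasDerivAt c (-fderiv ℝ (f j) x) 0 ∧ ∀ᶠ t in 𝓝 0,
        HasStrictFDerivAt (θ j t) (b t) x ∧ HasStrictFDerivAt (θ j (-t)) (c t) (θ j t x)
  step : ∀ j, ∀ x ∈ B, ∀ᶠ z in 𝓝 ((0 : ℝ), x), z.2 ∈ M → θ j z.1 z.2 ∈ M ∧ r z.2 (θ j z.1 z.2)

/-- `A` is the differential at `q` of a local diffeomorphism that takes `q` to `p` and, together
with its inverse, moves points of `M` along a fixed number of steps of the relation `r`. -/
def IsTransport (M B : Set E) (r : E → E → Prop) (p q : E) (A : E →L[ℝ] E) : Prop :=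
  q ∈ B ∧ ∃ (J : ℕ) (Φ Ψ : E → E) (A' : E →L[ℝ] E), Ψ p = q ∧ Φ q = p ∧
    HasStrictFDerivAt Ψ A' p ∧ HasStrictFDerivAt Φ A q ∧ (∀ᶠ x in 𝓝 p, Φ (Ψ x) = x) ∧
    (∀ᶠ x in 𝓝 p, x ∈ M → Ψ x ∈ M ∧ ReachedIn r J x (Ψ x)) ∧
    ∀ᶠ x in 𝓝 q, x ∈ M → Φ x ∈ M ∧ ReachedIn r J x (Φ x)

/-- `W` consists of velocities at `p` of a map into `M` all of whose values are reached from `p` in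
a fixed number of steps. -/
def IsReachableSubspace (M : Set E) (r : E → E → Prop) (p : E) (W : Submodule ℝ E) : Prop :=
  ∃ (J : ℕ) (F : Type) (_ : NormedAddCommGroup F) (_ : NormedSpace ℝ F) (_ : CompleteSpace F)
    (G : F → E) (G' : F →L[ℝ] E), G 0 = p ∧ HasStrictFDerivAt G G' 0 ∧
    W ≤ LinearMap.range (G' : F →ₗ[ℝ] E) ∧ ∀ᶠ s in 𝓝 0, G s ∈ M ∧ ReachedIn r J p (G s)

/-- The span of the transported values at `p` of the fields of a control system. -/
def transportSpan (M B : Set E) (r : E → E → Prop) (f : ι → E → E) (p : E) : Submodule ℝ E :=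
  Submodule.span ℝ {v | ∃ q A j, IsTransport M B r p q A ∧ A (f j q) = v}

namespace IsControlSystem

variable {M B : Set E} {r : E → E → Prop} {f : ι → E → E} {θ : ι → ℝ → E → E} {p q : E}
  {A : E →L[ℝ] E}

theorem isTransport_id (hp : p ∈ B) : IsTransport M B r p p (ContinuousLinearMap.id ℝ E) :=
  ⟨hp, 0, id, id, ContinuousLinearMap.id ℝ E, rfl, rfl, hasStrictFDerivAt_id p,
    hasStrictFDerivAt_id p, Eventually.of_forall fun _ => rfl,
    Eventually.of_forall fun x hx => ⟨hx, .refl r x⟩,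
    Eventually.of_forall fun x hx => ⟨hx, .refl r x⟩⟩

theorem continuousAt (h : IsControlSystem M B r f θ) (j : ι) (hq : q ∈ B) :
    ContinuousAt (fun t => θ j t q) 0 := by
  have h1 : ContinuousAt (fun t : ℝ => (t, q)) 0 := by fun_prop
  exact ContinuousAt.comp (f := fun t : ℝ => (t, q)) (g := fun z : ℝ × E => θ j z.1 z.2)
    (h.strict j q hq).continuousAt h1

theorem eventually_isTransport (h : IsControlSystem M B r f θ) (hA : IsTransport M B r p q A)
    (j : ι) {b c : ℝ → E →L[ℝ] E} (hbc : ∀ᶠ t in 𝓝 0,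
        HasStrictFDerivAt (θ j t) (b t) q ∧ HasStrictFDerivAt (θ j (-t)) (c t) (θ j t q)) :
    ∀ᶠ t in 𝓝 0, IsTransport M B r p (θ j t q) (A.comp (c t)) := by
  obtain ⟨hq, J, Φ, Ψ, A', hΨp, hΦq, hΨ, hΦ, hΦΨ, hΨr, hΦr⟩ := hA
  have hc := h.continuousAt j hq
  have hcB : ∀ᶠ t in 𝓝 (0 : ℝ), θ j t q ∈ B :=
    hc.eventually_mem (h.isOpen.mem_nhds (by rwa [h.zero]))
  have hstep := (h.step j q hq).eventually_nhds
  have h1 : Tendsto (fun t : ℝ => (t, q)) (𝓝 0) (𝓝 (0, q)) :=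
    Continuous.tendsto' (by fun_prop) _ _ rfl
  have h2 : Tendsto (fun t : ℝ => (-t, θ j t q)) (𝓝 0) (𝓝 (0, q)) := by
    have : ContinuousAt (fun t : ℝ => (-t, θ j t q)) 0 := continuousAt_neg.prodMk hc
    simpa [ContinuousAt, h.zero] using this
  have hslice : ∀ {P : ℝ × E → Prop} {t : ℝ} {x : E}, (∀ᶠ z in 𝓝 (t, x), P z) →
      ∀ᶠ y in 𝓝 x, P (t, y) := fun {P t x} hP =>
    (Continuous.tendsto' (by fun_prop : Continuous fun y : E => (t, y)) x (t, x) rfl).eventually hP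
  filter_upwards [hbc, hcB, h.inverse j, h1.eventually hstep, h2.eventually hstep]
    with t ⟨ht1, ht2⟩ ht3 ht4 ht5 ht6
  refine ⟨ht3, J + 1, fun x => Φ (θ j (-t) x), fun x => θ j t (Ψ x), (b t).comp A', by simp only [hΨp],
    by simp only [ht4, hΦq], ?_, ?_, ?_, ?_, ?_⟩
  · exact HasStrictFDerivAt.comp p (by rwa [hΨp]) hΨ
  · exact HasStrictFDerivAt.comp (θ j t q) (by rwa [ht4]) ht2
  · filter_upwards [hΦΨ] with x hx
    rw [ht4, hx]
  · have h3 := hΨ.continuousAt.tendsto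
    rw [hΨp] at h3
    filter_upwards [hΨr, h3.eventually (hslice ht5)] with x hx1 hx2 hxM
    obtain ⟨h4, h5⟩ := hx1 hxM
    obtain ⟨h6, h7⟩ := hx2 h4
    exact ⟨h6, h5.trans (.single h7)⟩
  · have h3 := ht2.continuousAt.tendsto
    rw [ht4] at h3
    filter_upwards [h3.eventually hΦr, hslice ht6] with x hx1 hx2 hxM
    obtain ⟨h4, h5⟩ := hx2 hxM
    obtain ⟨h6, h7⟩ := hx1 h4
    rw [add_comm]
    exact ⟨h6, (ReachedIn.single h5).trans h7⟩

/-- The transported values of a vector field remain in `transportSpan` when the bracket with a field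
of the control system is taken. -/
theorem lieBracket_mem_transportSpan [FiniteDimensional ℝ E] (h : IsControlSystem M B r f θ) {Z : E → E}
    (hZ : ∀ x ∈ B, DifferentiableAt ℝ Z x)
    (hZs : ∀ q A, IsTransport M B r p q A → A (Z q) ∈ transportSpan M B r f p) (j : ι)
    (hA : IsTransport M B r p q A) :
    A (VectorField.lieBracket ℝ (f j) Z q) ∈ transportSpan M B r f p := by
  obtain ⟨b, c, hc0, hc, hbc⟩ := h.derivatives j q hA.1
  have h1 : HasDerivAt (fun t => θ j t q) (f j q) 0 := by
    have h2 : HasDerivAt (fun t : ℝ => (t, q)) ((1 : ℝ), (0 : E)) 0 :=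
      (hasDerivAt_id (0 : ℝ)).prodMk (hasDerivAt_const 0 q)
    simpa [Function.comp_def] using (h.strict j q hA.1).hasFDerivAt.comp_hasDerivAt (0 : ℝ) h2
  have h2 : HasDerivAt (fun t => Z (θ j t q)) (fderiv ℝ Z q (f j q)) 0 := by
    have : HasFDerivAt Z (fderiv ℝ Z q) (θ j 0 q) := by
      rw [h.zero]
      exact (hZ q hA.1).hasFDerivAt
    exact this.comp_hasDerivAt 0 h1
  have h3 := A.hasFDerivAt.comp_hasDerivAt (0 : ℝ) (hc.clm_apply h2)
  -- For small `t`, `A ∘ c t` is again a transport, so the curve `A (c t (Z (θ j t q)))` lies in the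
  -- span. Its derivative at `0`, the image under `A` of a Lie derivative, lies there too.
  refine Submodule.mem_of_hasDerivAt_of_eventually_mem (t := 0)
    (g := fun t => A (c t (Z (θ j t q)))) ?_ ?_
  · rw [hc0, h.zero] at h3
    refine h3.congr_deriv ?_
    simp [VectorField.lieBracket, sub_eq_neg_add]
  · filter_upwards [h.eventually_isTransport hA j hbc] with t ht using hZs _ _ ht

theorem isReachableSubspace_sup (h : IsControlSystem M B r f θ) (hA : IsTransport M B r p q A)
    (j : ι) {W : Submodule ℝ E} (hW : IsReachableSubspace M r p W) :
    IsReachableSubspace M r p (W ⊔ Submodule.span ℝ {A (f j q)}) := by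
  obtain ⟨hq, J, Φ, Ψ, A', hΨp, hΦq, hΨ, hΦ, hΦΨ, hΨr, hΦr⟩ := hA
  obtain ⟨I, F, _, _, _, G, G', hG0, hG, hGW, hGr⟩ := hW
  have hAA : ∀ v, A (A' v) = v := by
    have h1 : HasFDerivAt (fun x => Φ (Ψ x)) (A.comp A') p :=
      HasFDerivAt.comp p (by rw [hΨp]; exact hΦ.hasFDerivAt) hΨ.hasFDerivAt
    have h2 := h1.unique ((hasFDerivAt_id p).congr_of_eventuallyEq hΦΨ)
    intro v
    exact congrArg (fun L : E →L[ℝ] E => L v) h2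
  -- The enlarged endpoint map reaches `G s`, is carried by `Ψ` to near `q`, follows the flow of `f
  -- j` for time `t`, and is carried back by `Φ`. As `A ∘ A' = id`, its differential is `(t, s) ↦ G'
  -- s + t A (f j q)`; the path has `I + J + 1 + J` steps.
  set G₂ : ℝ × F → ℝ × E := fun z => (z.1, Ψ (G z.2)) with hG₂
  have hG₂0 : G₂ 0 = (0, q) := by simp [hG₂, hG0, hΨp]
  have hG₂' : HasStrictFDerivAt G₂ ((ContinuousLinearMap.fst ℝ ℝ F).prod
      ((A'.comp G').comp (ContinuousLinearMap.snd ℝ ℝ F))) 0 := by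
    have h1 : HasStrictFDerivAt (fun s => Ψ (G s)) (A'.comp G') (0 : ℝ × F).2 :=
      HasStrictFDerivAt.comp _ (by simpa [hG0] using hΨ) hG
    exact hasStrictFDerivAt_fst.prodMk (h1.comp (0 : ℝ × F) hasStrictFDerivAt_snd)
  have hθ := h.strict j q hq
  have hG₃ : HasStrictFDerivAt (fun z => θ j (G₂ z).1 (G₂ z).2) _ 0 :=
    HasStrictFDerivAt.comp (g := fun z : ℝ × E => θ j z.1 z.2) (0 : ℝ × F)
      (by rw [hG₂0]; exact hθ) hG₂'
  have hG₃0 : θ j (G₂ 0).1 (G₂ 0).2 = q := by rw [hG₂0]; exact h.zero j q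
  have hG₄ : HasStrictFDerivAt (fun z => Φ (θ j (G₂ z).1 (G₂ z).2)) _ 0 :=
    HasStrictFDerivAt.comp (0 : ℝ × F) (by rw [hG₃0]; exact hΦ) hG₃
  refine ⟨I + J + 1 + J, ℝ × F, inferInstance, inferInstance, inferInstance, _, _, ?_, hG₄, ?_, ?_⟩
  · simp only [hG₃0, hΦq]
  · rw [sup_le_iff, Submodule.span_le, singleton_subset_iff]
    constructor
    · intro v hv
      obtain ⟨s, rfl⟩ := hGW hv
      exact ⟨(0, s), by simp [hAA]⟩
    · exact ⟨(1, 0), by simp⟩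
  · have hsnd : Tendsto (fun z : ℝ × F => z.2) (𝓝 0) (𝓝 0) :=
      Continuous.tendsto' continuous_snd _ _ rfl
    have hGc := hG.continuousAt.tendsto
    rw [hG0] at hGc
    have h2 := hG₂'.continuousAt.tendsto
    rw [hG₂0] at h2
    have h3 := hG₃.continuousAt.tendsto
    rw [hG₃0] at h3
    filter_upwards [hsnd.eventually hGr, (hGc.comp hsnd).eventually hΨr, h2.eventually (h.step j q hq),
      h3.eventually hΦr] with z ⟨hz1, hz1'⟩ hz2 hz3 hz4
    obtain ⟨hz5, hz5'⟩ := hz2 hz1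
    obtain ⟨hz6, hz6'⟩ := hz3 hz5
    obtain ⟨hz7, hz7'⟩ := hz4 hz6
    exact ⟨hz7, ((hz1'.trans hz5').trans (.single hz6')).trans hz7'⟩

theorem isReachableSubspace_transportSpan [FiniteDimensional ℝ E] (h : IsControlSystem M B r f θ) (hp : p ∈ M) :
    IsReachableSubspace M r p (transportSpan M B r f p) := by
  -- Finitely many transported values generate the span, and they are added one at a time.
  obtain ⟨s, hs, hspan⟩ := (Submodule.fg_span_iff_fg_span_finset_subset (R := ℝ)
    {v | ∃ q A j, IsTransport M B r p q A ∧ A (f j q) = v}).1 (IsNoetherian.noetherian _)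
  rw [transportSpan, hspan]
  clear hspan
  classical
  induction s using Finset.induction_on with
  | empty =>
    refine ⟨0, ℝ, inferInstance, inferInstance, inferInstance, fun _ => p, 0, rfl,
      hasStrictFDerivAt_const _ _, by simp, Eventually.of_forall fun _ => ⟨hp, .refl r p⟩⟩
  | insert v s _ ih =>
    rw [Finset.coe_insert, insert_subset_iff] at hs
    obtain ⟨⟨q, A, j, hA, rfl⟩, hs'⟩ := hs
    rw [Finset.coe_insert, Submodule.span_insert, sup_comm]
    exact h.isReachableSubspace_sup hA j (ih hs')

end IsControlSystem

end Chow

/-! ### Finite type, minimality and orbits -/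

section Orbits

variable {N : ℕ} {m : ℕ → ℝ} {M : Set (CSpace N)} {p : CSpace N} {c : ℕ} {U V : Set (CSpace N)}
  {ρ : CSpace N → EuclideanSpace ℝ (Fin c)} {ι : Type*} {X Y : ι → CSpace N → CSpace N}

theorem IsComplexTangentSection.neg {X : CSpace N → CSpace N}
    (hX : IsComplexTangentSection m M X) : IsComplexTangentSection m M (-X) := by
  refine ⟨fun p hp => neg_mem (hX.1 p hp), fun p hp => ?_⟩
  obtain ⟨U, Y, hU, hpU, hY, hXY⟩ := hX.2 p hp
  exact ⟨U, fun x => (-ContinuousLinearMap.id ℝ (CSpace N)) (Y x), hU, hpU, hY.clm_comp hU _,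
    fun x hx => by simp [hXY x hx]⟩

/-- The flows of tangent extensions, cut off away from `p`, move points of `M` along integral
curves of sections of the complex tangent bundle. -/
theorem IsTangentExtension.exists_isControlSystem (h : IsTangentExtension m M V ρ X Y)
    (hX : ∀ j, IsComplexTangentSection m M (X j))
    (hρ : IsDefiningFunction M U ρ) (hVU : V ⊆ U) {R : ℝ} (hR : 0 < R)
    (hRV : Metric.closedBall p (2 * R) ⊆ V) :
    ∃ (f : ι → CSpace N → CSpace N) (θ : ι → ℝ → CSpace N → CSpace N),
      (∀ j, ∀ x ∈ Metric.ball p R, f j x = Y j x) ∧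
      IsControlSystem M (Metric.ball p R)
        (JoinedByIntegralCurve {X | IsComplexTangentSection m M X} (M ∩ Metric.ball p R)) f θ := by
  obtain ⟨χ, hχ, hχc, hχs, hχ1⟩ := exists_cutoff p hR
  set f : ι → CSpace N → CSpace N := fun j x => χ x • Y j x with hf
  have hfc : ∀ j, ContDiff ℝ ∞ (f j) := fun j =>
    contDiff_cutoff_smul hχ h.isOpen (hχs.trans hRV) (h.ultra j).1
  choose K hK1 hK2 hK3 hK4 using fun j => exists_global_bounds (hfc j) hχc.smul_right
  choose θ hθ using fun j => exists_isUnitTimeFlow (hK1 j) (hK3 j)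
  have hfY : ∀ j, ∀ x ∈ Metric.ball p R, f j x = Y j x := fun j x hx => by
    simp [hf, hχ1 x (Metric.ball_subset_closedBall hx)]
  have hBV : Metric.ball p R ⊆ V := fun x hx =>
    hRV (Metric.closedBall_subset_closedBall (by linarith) (Metric.ball_subset_closedBall hx))
  refine ⟨f, θ, hfY, Metric.isOpen_ball, fun j x _ => (hθ j).hasStrictFDerivAt_zero (hK1 j) (hK3 j) x,
    fun j => (hθ j).zero, fun j => ?_, fun j x _ =>
      (hθ j).exists_derivatives (hfc j) (hK1 j) (hK2 j) (hK4 j) x, fun j x hx => ?_⟩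
  · filter_upwards [Ioo_mem_nhds (by norm_num : (-(1 / 2) : ℝ) < 0) (by norm_num : (0 : ℝ) < 1 / 2)]
      with t ht x using (hθ j).neg_apply (hK1 j) ht x
  · have hx' : ‖x - p‖ < R := mem_ball_iff_norm.1 hx
    -- Half the distance margin is spent on the starting point and half on the motion, whose length
    -- is at most `K j * T ≤ e`.
    set e : ℝ := (R - ‖x - p‖) / 2 with he
    have he0 : 0 < e := by simp only [he]; linarith
    set T : ℝ := min 1 (e / (K j + 1)) with hT
    have hT0 : 0 < T := lt_min one_pos (by positivity)
    have hKT : K j * T ≤ e := by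
      have h1 : T ≤ e / (K j + 1) := min_le_right _ _
      rw [le_div_iff₀ (by positivity)] at h1
      nlinarith [(K j).2]
    have hsub : Ioo (-T) T ⊆ Ioo (-1 : ℝ) 1 :=
      Ioo_subset_Ioo (by linarith [min_le_left 1 (e / (K j + 1))]) (min_le_left _ _)
    filter_upwards [prod_mem_nhds (Ioo_mem_nhds (neg_lt_zero.2 hT0) hT0) (Metric.ball_mem_nhds x he0)]
    rintro ⟨t, y⟩ ⟨ht, hy⟩ hyM
    simp only at ht hy hyM ⊢
    have hball : ∀ s ∈ Ioo (-T) T, θ j s y ∈ Metric.ball p R := by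
      intro s hs
      have h1 := (hθ j).norm_sub_self_le (hK3 j) (hsub hs) y
      have h2 : K j * |s| ≤ e := le_trans (by gcongr; exact (abs_lt.2 hs).le) hKT
      have h3 : ‖y - x‖ < e := mem_ball_iff_norm.1 hy
      rw [mem_ball_iff_norm]
      calc ‖θ j s y - p‖ = ‖(θ j s y - y) + (y - x) + (x - p)‖ := by congr 1; abel
        _ ≤ ‖θ j s y - y‖ + ‖y - x‖ + ‖x - p‖ := norm_add₃_le
        _ < e + e + ‖x - p‖ := by linarith
        _ = R := by simp only [he]; ring
    have hyB : y ∈ Metric.ball p R := by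
      have := hball 0 ⟨by linarith, hT0⟩
      rwa [(hθ j).zero] at this
    -- Inside the ball the field annihilates `dρ`, so `ρ` is constant along the flow line and points
    -- of `M` remain in `M`.
    have hmemM : ∀ s ∈ Ioo (-T) T, θ j s y ∈ M := by
      intro s hs
      have h1 : ∀ u ∈ Ioo (-T) T, HasDerivAt (fun u => ρ (θ j u y)) 0 u := by
        intro u hu
        have h2 := ((hρ.contDiffAt (hVU (hBV (hball u hu)))).differentiableAt
          (by simp)).hasFDerivAt.comp_hasDerivAt u ((hθ j).hasDerivAt y u (hsub hu))
        rwa [hfY j _ (hball u hu), h.tangent j _ (hBV (hball u hu))] at h2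
      have h2 := norm_curve_sub_le h1 (C := 0) (fun _ _ => by simp) (s := 0) ⟨by linarith, hT0⟩ hs
      rw [zero_mul, norm_le_zero_iff, sub_eq_zero, (hθ j).zero, hρ.eq_zero hyM (hVU (hBV hyB))] at h2
      exact hρ.mem (hVU (hBV (hball s hs))) h2
    have hder : ∀ s ∈ Ioo (-T) T, HasDerivAt (fun s => θ j s y) (X j (θ j s y)) s := fun s hs => by
      rw [h.eq j _ ⟨hmemM s hs, hBV (hball s hs)⟩, ← hfY j _ (hball s hs)]
      exact (hθ j).hasDerivAt y s (hsub hs)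
    refine ⟨hmemM t ht, ?_⟩
    rcases le_total 0 t with ht0 | ht0
    · refine ⟨X j, hX j, t, fun s => θ j s y, ht0, (hθ j).zero y, rfl, fun s hs => ?_⟩
      have hs' : s ∈ Ioo (-T) T := ⟨by linarith [hs.1], lt_of_le_of_lt hs.2 ht.2⟩
      exact ⟨⟨hmemM s hs', hball s hs'⟩, (hder s hs').hasDerivWithinAt⟩
    -- Integral curves are run in positive time, so a backward step follows the section `-X j`.
    · refine ⟨-X j, (hX j).neg, -t, fun s => θ j (-s) y, by linarith, by simp [(hθ j).zero],
        by simp, fun s hs => ?_⟩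
      have hs' : -s ∈ Ioo (-T) T := ⟨by linarith [hs.2, ht.1], by linarith [hs.1]⟩
      refine ⟨⟨hmemM _ hs', hball _ hs'⟩, ?_⟩
      simpa [Function.comp_def] using ((hder _ hs').scomp s (hasDerivAt_neg s)).hasDerivWithinAt

/-- The span of the transported values of a family of vector fields contains the values of all
fields of the generated Lie algebra. -/
theorem IsTangentExtension.generatedValues_le_transportSpan (h : IsTangentExtension m M V ρ X Y)
    (hm : IsRegularWeightSequence m) {B : Set (CSpace N)} {r : CSpace N → CSpace N → Prop}
    {f : ι → CSpace N → CSpace N} {θ : ι → ℝ → CSpace N → CSpace N}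
    (hs : IsControlSystem M B r f θ) (hBV : B ⊆ V) (hfY : ∀ j, ∀ x ∈ B, f j x = Y j x)
    (hp : p ∈ B) : generatedValues (range Y) p ≤ transportSpan M B r f p := by
  set W := transportSpan M B r f p with hW
  have hd : ∀ {Z : CSpace N → CSpace N}, IsUltradifferentiableOn m Z V → ∀ q ∈ B,
      ContDiffAt ℝ ∞ Z q := fun hZ q hq => hZ.contDiffAt h.isOpen (hBV hq)
  have hd' : ∀ {Z : CSpace N → CSpace N}, IsUltradifferentiableOn m Z V → ∀ q ∈ B,
      DifferentiableAt ℝ Z q := fun hZ q hq => (hd hZ q hq).differentiableAt (by simp)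
  let P : (CSpace N → CSpace N) → Prop := fun Z => ∀ q A, IsTransport M B r p q A → A (Z q) ∈ W
  -- Bracketing with a generator is covered by differentiation of transports. For an iterated
  -- bracket `D`, the Jacobi identity reduces `[[D, D'], Z]` to successive brackets with `D` and
  -- `D'`.
  have key : ∀ {D}, InGeneratedLieAlgebra univ (range Y) D → ∀ Z, IsUltradifferentiableOn m Z V →
      P Z → P (VectorField.lieBracket ℝ D Z) := by
    intro D hD
    induction hD with
    | base D hD =>
      obtain ⟨j, rfl⟩ := hD
      intro Z hZ hPZ q A hA
      have h1 : Y j =ᶠ[𝓝 q] f j := by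
        filter_upwards [hs.isOpen.mem_nhds hA.1] with x hx using (hfY j x hx).symm
      rw [h1.lieBracket_vectorField_eq EventuallyEq.rfl]
      exact hs.lieBracket_mem_transportSpan (hd' hZ) hPZ j hA
    | zero =>
      intro Z _ _ q A _
      simp [VectorField.lieBracket]
    | add D D' hD hD' ih ih' =>
      intro Z hZ hPZ q A hA
      rw [VectorField.lieBracket_add_left (hd' (h.ultra_of_inGenerated hm hD) q hA.1)
        (hd' (h.ultra_of_inGenerated hm hD') q hA.1), map_add]
      exact add_mem (ih Z hZ hPZ q A hA) (ih' Z hZ hPZ q A hA)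
    | smul a D hD ih =>
      intro Z hZ hPZ q A hA
      rw [VectorField.lieBracket_const_smul_left (hd' (h.ultra_of_inGenerated hm hD) q hA.1),
        map_smul]
      exact Submodule.smul_mem _ _ (ih Z hZ hPZ q A hA)
    | bracket D D' hD hD' ih ih' =>
      intro Z hZ hPZ q A hA
      have hDm := h.ultra_of_inGenerated hm hD
      have hDm' := h.ultra_of_inGenerated hm hD'
      have hJ := VectorField.leibniz_identity_lieBracket (𝕜 := ℝ) (n := ∞)
        (by simp; exact ENat.LEInfty.out) (hd hDm q hA.1) (hd hDm' q hA.1) (hd hZ q hA.1)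
      rw [VectorField.lieBracketWithin_univ, ← sub_eq_of_eq_add hJ, map_sub]
      exact sub_mem (ih _ (hDm'.lieBracket hm hZ h.isOpen) (ih' Z hZ hPZ) q A hA)
        (ih' _ (hDm.lieBracket hm hZ h.isOpen) (ih Z hZ hPZ) q A hA)
  have hP : ∀ {Z}, InGeneratedLieAlgebra univ (range Y) Z → P Z := by
    intro Z hZ
    induction hZ with
    | base Z hZ =>
      obtain ⟨j, rfl⟩ := hZ
      intro q A hA
      exact Submodule.subset_span ⟨q, A, j, hA, by rw [hfY j q hA.1]⟩
    | zero => intro q A _; simp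
    | add D D' _ _ ih ih' => intro q A hA; simpa using add_mem (ih q A hA) (ih' q A hA)
    | smul a D _ ih => intro q A hA; simpa using Submodule.smul_mem _ a (ih q A hA)
    | bracket D D' hD hD' _ ih' =>
      rw [VectorField.lieBracketWithin_univ]
      exact key hD D' (h.ultra_of_inGenerated hm hD') ih'
  rintro _ ⟨Z, hZ, rfl⟩
  exact hP hZ p _ (IsControlSystem.isTransport_id hp)

/-- **Chow's theorem**: at a point of finite type, nearby points of `M` are reached by a fixed
number of integral curves. -/
theorem IsFiniteTypeAt.exists_reachable {d : ℕ} (hft : IsFiniteTypeAt m M p)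
    (hm : IsRegularWeightSequence m) (hM : IsUltradifferentiableSubmanifold m M d) (hp : p ∈ M)
    {O : Set (CSpace N)} (hO : IsOpen O) (hpO : p ∈ O) :
    ∃ (J : ℕ) (V₁ V₂ : Set (CSpace N)), IsOpen V₁ ∧ IsOpen V₂ ∧ p ∈ V₁ ∧ V₁ ⊆ V₂ ∧ V₂ ⊆ O ∧
      ∀ x ∈ M ∩ V₁,
        ReachedIn (JoinedByIntegralCurve {X | IsComplexTangentSection m M X} (M ∩ V₂)) J p x := by
  obtain ⟨k, X, hX, hgen⟩ := hft
  obtain ⟨c, U, ρ, hd, hpU, hρ, hρm⟩ := exists_definingFunction_ultra hM hp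
  obtain ⟨V, Y, hpV, hVU, h⟩ := exists_isTangentExtension hm hX hρ hρm hp hpU
  obtain ⟨R, hR, hRV⟩ : ∃ R > 0, Metric.closedBall p (2 * R) ⊆ V ∩ O := by
    obtain ⟨R, hR, hRU⟩ := Metric.nhds_basis_closedBall.mem_iff.1
      ((h.isOpen.inter hO).mem_nhds ⟨hpV, hpO⟩)
    exact ⟨R / 2, by positivity, by rwa [mul_div_cancel₀ _ two_ne_zero]⟩
  have hB : Metric.ball p R ⊆ V ∩ O := fun x hx =>
    hRV (Metric.closedBall_subset_closedBall (by linarith) (Metric.ball_subset_closedBall hx))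
  obtain ⟨f, θ, hfY, hs⟩ :=
    h.exists_isControlSystem hX hρ hVU hR (hRV.trans inter_subset_left)
  have hpB : p ∈ Metric.ball p R := Metric.mem_ball_self hR
  have hle := h.generatedValues_le_transportSpan hm hs (hB.trans inter_subset_left) hfY hpB
  obtain ⟨J, F, _, _, _, G, G', hG0, hG, hGW, hGr⟩ := hs.isReachableSubspace_transportSpan hp
  have hT : realTangentSpace M p ≤ LinearMap.range (G' : F →ₗ[ℝ] CSpace N) := by
    refine le_trans (fun v hv => ?_) (hle.trans hGW)
    have h1 := h.generatedValues_eq hm hρ hVU hp hpV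
    rw [hgen] at h1
    exact h1.superset hv
  -- The differential of the endpoint map covers `T_p M`, so its values fill a neighbourhood of `p`
  -- in `M`.
  have hev := hρ.eventually_mem_image hp hpU hG0 hG (hGr.mono fun s hs => hs.1) hT hGr
  obtain ⟨V₁, hV₁, hV₁o, hpV₁⟩ := eventually_nhds_iff.1 hev
  refine ⟨J, V₁ ∩ Metric.ball p R, Metric.ball p R, hV₁o.inter Metric.isOpen_ball,
    Metric.isOpen_ball, ⟨hpV₁, hpB⟩, inter_subset_right, hB.trans inter_subset_right, ?_⟩
  rintro x ⟨hxM, hxV, -⟩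
  obtain ⟨s, hs, rfl⟩ := hV₁ x hxV hxM
  exact hs.2

theorem realTangentSpace_mono {S S' : Set (CSpace N)} (hSS : ∀ᶠ x in 𝓝 p, x ∈ S → x ∈ S') :
    realTangentSpace S p ≤ realTangentSpace S' p := by
  refine Submodule.span_mono ?_
  rintro v ⟨γ, hγ0, hγS, hγ⟩
  refine ⟨γ, hγ0, ?_, hγ⟩
  have h1 := hγ.continuousAt.tendsto
  rw [hγ0] at h1
  filter_upwards [hγS, h1.eventually hSS] with t ht1 ht2 using ht2 ht1

theorem IsSmoothSubmanifold.finrank_realTangentSpace {S : Set (CSpace N)} {d : ℕ}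
    (hS : IsSmoothSubmanifold S d) (hp : p ∈ S) : Module.finrank ℝ (realTangentSpace S p) = d := by
  obtain ⟨c, U, ρ, hd, hpU, hρ⟩ := hS.exists_definingFunction hp
  exact hρ.finrank_realTangentSpace hp hpU hd

/-- Points of finite type are minimal. -/
theorem IsFiniteTypeAt.isMinimalAt {d : ℕ} (hft : IsFiniteTypeAt m M p)
    (hm : IsRegularWeightSequence m) (hM : IsUltradifferentiableSubmanifold m M d) (hp : p ∈ M) :
    IsMinimalAt IsSmoothSubmanifold M d p := by
  rintro ⟨S, k, hS, hSM, hpS, hkd, hT⟩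
  obtain ⟨n, X, hX, hgen⟩ := hft
  obtain ⟨c, U, ρ, hd, hpU, hρ, hρm⟩ := exists_definingFunction_ultra hM hp
  obtain ⟨V, Y, hpV, hVU, h⟩ := exists_isTangentExtension hm hX hρ hρm hp hpU
  obtain ⟨c', U', σ, hk, hpU', hσ⟩ := hS.exists_definingFunction hpS
  have hO : IsOpen (V ∩ U') := h.isOpen.inter hσ.isOpen
  -- The generators are tangent to `S` because `S` carries `T^c M`, and tangency survives brackets;
  -- smoothness of `S` is enough for this.
  have key : ∀ {Z}, InGeneratedLieAlgebra univ (range Y) Z → ∀ x ∈ V ∩ U', x ∈ S →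
      Z x ∈ realTangentSpace S x := by
    intro Z hZ
    induction hZ with
    | base Z hZ =>
      obtain ⟨j, rfl⟩ := hZ
      intro x hx hxS
      rw [← h.eq j x ⟨hSM hxS, hx.1⟩]
      exact hT x hxS _ ((hX j).1 x (hSM hxS))
    | zero => intro x _ _; exact zero_mem _
    | add A B _ _ hA hB => intro x hx hxS; exact add_mem (hA x hx hxS) (hB x hx hxS)
    | smul a A _ hA => intro x hx hxS; exact Submodule.smul_mem _ _ (hA x hx hxS)
    | bracket A B hA' hB' hA hB =>
      intro x hx hxS
      rw [VectorField.lieBracketWithin_univ]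
      exact hσ.lieBracket_mem hxS hx.2
        ((h.ultra_of_inGenerated hm hA').contDiffAt h.isOpen hx.1)
        ((h.ultra_of_inGenerated hm hB').contDiffAt h.isOpen hx.1)
        (eventually_of_mem (hO.mem_nhds hx) hA) (eventually_of_mem (hO.mem_nhds hx) hB)
  have hle : realTangentSpace M p ≤ realTangentSpace S p := by
    intro v hv
    have h1 := h.generatedValues_eq hm hρ hVU hp hpV
    rw [hgen] at h1
    obtain ⟨Z, hZ, rfl⟩ := h1.superset hv
    exact key hZ p ⟨hpV, hpU'⟩ hpS
  have := Submodule.finrank_mono hle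
  rw [hρ.finrank_realTangentSpace hp hpU hd, hS.finrank_realTangentSpace hpS] at this
  omega

theorem IsMinimalAt.of_smooth {d : ℕ} (h : IsMinimalAt IsSmoothSubmanifold M d p) :
    IsMinimalAt (IsUltradifferentiableSubmanifold m) M d p := by
  rintro ⟨S, k, hS, h'⟩
  exact h ⟨S, k, hS.isSmoothSubmanifold, h'⟩

/-- At a point of finite type, `M` itself represents the CR orbit. -/
theorem IsFiniteTypeAt.hasCROrbitDim {d n : ℕ} (hft : IsFiniteTypeAt m M p)
    (hm : IsRegularWeightSequence m) (hM : IsUltradifferentiableCRSubmanifold m M d n)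
    (hp : p ∈ M) : HasCROrbitDim m M p d := by
  refine ⟨M, ⟨hM.submanifold, Subset.rfl, hp, fun X hX p hp => (hX.1 p hp).1⟩, ?_, ?_⟩
  · intro W' k' hW'
    -- A competitor carries the canonical sections, hence all of `T^c M`; minimality excludes a
    -- smaller dimension.
    have hk : d ≤ k' := by
      by_contra! hlt
      refine (hft.isMinimalAt hm hM.submanifold hp).of_smooth
        ⟨W', k', hW'.submanifold, hW'.subset, hW'.mem, hlt, fun q hq v hv => ?_⟩
      refine Submodule.span_le.2 ?_ (mem_span_canonicalSection hv)
      rintro _ ⟨j, rfl⟩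
      exact hW'.tangent _ (isComplexTangentSection_canonicalSection hm hM j) q hq
    obtain ⟨c, U, ρ, hd, hpU, hρ⟩ :=
      hM.submanifold.isSmoothSubmanifold.exists_definingFunction hp
    obtain ⟨c', U', σ, hd', hpU', hσ⟩ :=
      hW'.submanifold.isSmoothSubmanifold.exists_definingFunction hW'.mem
    have hT : realTangentSpace M p ≤ realTangentSpace W' p := by
      refine (Submodule.eq_of_le_of_finrank_le (realTangentSpace_mono
        (Eventually.of_forall fun x hx => hW'.subset hx)) ?_).ge
      rw [hρ.finrank_realTangentSpace hp hpU hd, hσ.finrank_realTangentSpace hW'.mem hpU' hd']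
      exact hk
    -- With equal tangent spaces at `p`, a local parametrization of `W'` is locally onto `M`, so the
    -- germ of `M` lies in `W'`.
    obtain ⟨G, hG0, hGS, hG⟩ := hσ.exists_parametrization hW'.mem hpU'
    have := FiniteDimensional.complete ℝ
      (LinearMap.ker (fderiv ℝ σ p : CSpace N →ₗ[ℝ] EuclideanSpace ℝ (Fin c')))
    have hev := hρ.eventually_mem_image hp hpU hG0 hG (hGS.mono fun s hs => hW'.subset hs)
      (fun v hv => ⟨⟨v, (hσ.mem_realTangentSpace_iff hW'.mem hpU').1 (hT hv)⟩, rfl⟩) hGS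
    obtain ⟨V, hV, hVo, hpV⟩ := eventually_nhds_iff.1 hev
    refine ⟨V, hVo, hpV, ?_⟩
    rintro x ⟨hxM, hxV⟩
    obtain ⟨s, hs, rfl⟩ := hV x hxV hxM
    exact ⟨hs, hxV⟩
  · intro O hO hpO
    exact hft.exists_reachable hm hM.submanifold hp hO hpO

/-- If the CR orbit has full dimension, then `M` is minimal within the class `{m}`. -/
theorem HasCROrbitDim.isMinimalAt {d : ℕ} (h : HasCROrbitDim m M p d) :
    IsMinimalAt (IsUltradifferentiableSubmanifold m) M d p := by
  rintro ⟨S, k, hS, hSM, hpS, hkd, hT⟩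
  obtain ⟨W, hW⟩ := h
  obtain ⟨V, hV, hpV, hWS⟩ := hW.germ_subset S k
    ⟨hS, hSM, hpS, fun X hX q hq => hT q hq _ (hX.1 q (hSM hq))⟩
  have hle : realTangentSpace W p ≤ realTangentSpace S p := realTangentSpace_mono <| by
    filter_upwards [hV.mem_nhds hpV] with x hxV hxW using (hWS ⟨hxW, hxV⟩).1
  have := Submodule.finrank_mono hle
  rw [hW.isTangentSubmanifold.submanifold.isSmoothSubmanifold.finrank_realTangentSpace
    hW.isTangentSubmanifold.mem, hS.isSmoothSubmanifold.finrank_realTangentSpace hpS] at this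
  omega

end Orbits

theorem mainTheorem10 (m : ℕ → ℝ) (hreg : IsRegularWeightSequence m)
    (hqa : IsQuasianalyticSequence m) (N d n : ℕ) (M : Set (EuclideanSpace ℂ (Fin N)))
    (hM : IsUltradifferentiableCRSubmanifold m M d n)
    (p₀ : EuclideanSpace ℂ (Fin N)) (hp₀ : p₀ ∈ M) :
    List.TFAE
      [IsMinimalAt IsSmoothSubmanifold M d p₀,
        IsMinimalAt (IsUltradifferentiableSubmanifold m) M d p₀,
        HasCROrbitDim m M p₀ d,
        IsFiniteTypeAt m M p₀] := by
  tfae_have 1 → 2 := fun h => h.of_smooth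
  tfae_have 2 → 4 := isFiniteTypeAt_of_isMinimalAt hreg hqa hM hp₀
  tfae_have 4 → 1 := fun h => h.isMinimalAt hreg hM.submanifold hp₀
  tfae_have 4 → 3 := fun h => h.hasCROrbitDim hreg hM hp₀
  tfae_have 3 → 2 := fun h => h.isMinimalAt
  tfae_finish
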